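/- Let $\Phi$ be a (reduced) irreducible simply laced root system, let $R$ be a commutative ring with $1$ and let $I$ be an ideal of $R$. Definitions. Fix a Chevalley basis of the simple complex Lie algebra of type $\Phi$, normalized by $[e_\alpha,e_{-\alpha}]=h_\alpha$ (the coroot of $\alpha$), and let $N_{\alpha,\beta}$ be its structure constants: $[e_\alpha,e_\beta]=N_{\alpha,\beta}e_{\alpha+\beta}$ if $\alpha+\beta\in\Phi$. A root subsystem of $\Phi$ is a subset $\Psi\subseteq\Phi$ stable under the reflections $\sigma_\alpha$, $\alpha\in\Psi$. For an irreducible root subsystem $\Psi$ of rank at least $2$ and a commutative ring $A$, the Steinberg group $\mathrm{St}(\Psi,A)$ is the group with generators $x_\alpha(\xi)$, $\alpha\in\Psi$, $\xi\in A$, and relations $$x_\alpha(\xi)x_\alpha(\eta)=x_\alpha(\xi+\eta),\qquad [x_\alpha(\xi),x_\beta(\eta)]=1\ \ (\alpha+\beta\notin\Psi\cup\{0\}),\qquad [x_\alpha(\xi),x_\beta(\eta)]=x_{\alpha+\beta}(N_{\alpha,\beta}\xi\eta)\ \ (\alpha+\beta\in\Psi),$$ where $[x,y]=xyx^{-1}y^{-1}$.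 If $\Psi=\{\pm\alpha\}$ has type $\mathsf A_1$, then $\mathrm{St}(\Psi,A)$ is given by the relations $x_\beta(\xi)x_\beta(\eta)=x_\beta(\xi+\eta)$ and $$w_\beta(u)x_\beta(\zeta)w_\beta(u)^{-1}=x_{-\beta}(-u^{-2}\zeta),\qquad w_\beta(u)x_{-\beta}(\zeta)w_\beta(u)^{-1}=x_{\beta}(-u^{2}\zeta)\qquad(\beta=\pm\alpha,\ u\in A^*,\ \zeta\in A),$$ where $w_\beta(u)=x_\beta(u)x_{-\beta}(-u^{-1})x_\beta(u)$. These groups are functorial in $A$ and, via $x_\alpha(\xi)\mapsto x_\alpha(\xi)$, in $\Psi$ with respect to inclusions. Let $D(R,I)=\{(a_1,a_2)\in R\times R: a_1-a_2\in I\}$, with projections $p_1,p_2\colon D(R,I)\to R$, and put $G_i(\Psi)=\mathrm{Ker}\bigl(p_i^*\colon\mathrm{St}(\Psi,D(R,I))\to\mathrm{St}(\Psi,R)\bigr)$. The relative Steinberg group is $\mathrm{St}(\Psi,R,I)=G_1(\Psi)/[G_1(\Psi),G_2(\Psi)]$; it is functorial in $\Psi$ with respect to inclusions. For $n\ge 2$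 let $\mathcal G_{1,n}$ be the category whose objects are the root subsystems of $\Phi$ of type $\mathsf A_1$ or $\mathsf A_n$ and whose morphisms are the inclusions between them. Theorem. 1. If $\Phi$ has rank at least $3$, then $\mathrm{St}(\Phi,R,I)$, as an abstract group, is the colimit $\varinjlim_{\Psi\in\mathcal G_{1,3}}\mathrm{St}(\Psi,R,I)$ in the category of groups; more precisely, the homomorphisms $\mathrm{St}(\Psi,R,I)\to\mathrm{St}(\Phi,R,I)$ induced by the inclusions $\Psi\subseteq\Phi$ form a colimit cocone, that is, the induced homomorphism $\varinjlim_{\mathcal G_{1,3}}\mathrm{St}(\Psi,R,I)\to\mathrm{St}(\Phi,R,I)$ is an isomorphism. 2. If $\Phi$ has type $\mathsf E_\ell$, $\ell\in\{6,7,8\}$, then likewise $\mathrm{St}(\Phi,R,I)\cong\varinjlim_{\Psi\in\mathcal G_{1,4}}\mathrm{St}(\Psi,R,I)$ through the homomorphisms induced by the inclusions. -/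

import Mathlib

namespace Steinberg

universe u v
noncomputable section

/-- A root system is simply laced if its (extended) Dynkin diagrams have no multiple bonds, that is,
if `⟨α, β⟩ ∈ {-1, 0, 1}` for any two roots `α ≠ ±β`. -/
class IsSimplyLaced {ι M V : Type*} [AddCommGroup M] [Module ℝ M] [AddCommGroup V] [Module ℝ V]
    (P : RootPairing ι ℝ M V) [P.IsCrystallographic] : Prop where
  pairingIn_mem : ∀ i j, i ≠ j → P.root i ≠ -P.root j →
    P.pairingIn ℤ i j = -1 ∨ P.pairingIn ℤ i j = 0 ∨ P.pairingIn ℤ i j = 1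

/-- A Chevalley basis of the complex semisimple Lie algebra of type `Φ = {P.root i | i : ι}`, together
with its structure constants. The Lie algebra `L`, with Cartan subalgebra `H`, has type `Φ`: its root
system is identified with `Φ` through a bijection `toRoot` which preserves the integers `⟨α, β⟩`
(when `Φ` is irreducible, `L` is thus the simple complex Lie algebra of type `Φ`). The root vectors
`e α` satisfy `[e α, e (-α)] = h_α`, where `h_α ∈ H` is the coroot of `α`, and
`[e α, e β] = N_{α,β} e (α + β)` with integers `N_{α,β} = -N_{-α,-β}`, whenever `α + β ∈ Φ`; the
values of `N` at other pairs are irrelevant. -/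
structure ChevalleyBasis {ι M V L : Type*} [AddCommGroup M] [Module ℝ M] [AddCommGroup V]
    [Module ℝ V] [LieRing L] [LieAlgebra ℂ L] [FiniteDimensional ℂ L] [LieAlgebra.IsKilling ℂ L]
    (P : RootPairing ι ℝ M V) [P.IsCrystallographic]
    (H : LieSubalgebra ℂ L) [H.IsCartanSubalgebra] where
  toRoot : ι ≃ H.root
  pairing_toRoot : ∀ i j,
    (LieAlgebra.IsKilling.rootSystem H).pairingIn ℤ (toRoot i) (toRoot j) = P.pairingIn ℤ i j
  e : ι → L
  e_mem : ∀ i, e i ∈ LieAlgebra.rootSpace H (toRoot i).1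
  lie_e_neg : ∀ i,
    ⁅e i, e (P.reflectionPerm i i)⁆ = ((LieAlgebra.IsKilling.coroot (toRoot i).1 : H) : L)
  N : ι → ι → ℤ
  lie_e : ∀ i j k, P.root k = P.root i + P.root j → ⁅e i, e j⁆ = N i j • e k
  N_neg : ∀ i j k, P.root k = P.root i + P.root j →
    N (P.reflectionPerm i i) (P.reflectionPerm j j) = -N i j

lemma eq_neg_index {ι M V : Type*} [AddCommGroup M] [Module ℝ M] [AddCommGroup V] [Module ℝ V]
    {P : RootPairing ι ℝ M V} {i k : ι} (h : P.root k = -P.root i) : k = P.reflectionPerm i i :=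
  P.root.injective (by rw [h]; simp)

section Chevalley

variable {ι M V L : Type*} [AddCommGroup M] [Module ℝ M] [AddCommGroup V]
    [Module ℝ V] [LieRing L] [LieAlgebra ℂ L] [FiniteDimensional ℂ L] [LieAlgebra.IsKilling ℂ L]
    {P : RootPairing ι ℝ M V} [P.IsCrystallographic]
    {H : LieSubalgebra ℂ L} [H.IsCartanSubalgebra]

open LieAlgebra.IsKilling

lemma ChevalleyBasis.apply_coroot (B : ChevalleyBasis P H) (i j : ι) :
    (B.toRoot i).1 (coroot (B.toRoot j).1) = (P.pairingIn ℤ i j : ℂ) := by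
  rw [← B.pairing_toRoot, ← rootSystem_pairing_apply,
    ← (rootSystem H).algebraMap_pairingIn ℤ]
  rfl

lemma pairingIn_add {i j k : ι} (h : P.root k = P.root i + P.root j) (l : ι) :
    P.pairingIn ℤ k l = P.pairingIn ℤ i l + P.pairingIn ℤ j l := by
  have := RootPairing.pairing_eq_add_of_root_eq_add (P := P) (l := l) h
  simp only [← P.algebraMap_pairingIn ℤ] at this
  exact_mod_cast this

lemma pairingIn_neg {i k : ι} (h : P.root k = -P.root i) (l : ι) :
    P.pairingIn ℤ k l = -P.pairingIn ℤ i l := by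
  have : P.pairing k l = - P.pairing i l := by
    simp only [← P.root_coroot_eq_pairing, h]; simp
  simp only [← P.algebraMap_pairingIn ℤ] at this
  exact_mod_cast this

lemma ChevalleyBasis.toRoot_add (B : ChevalleyBasis P H) {i j k : ι}
    (h : P.root k = P.root i + P.root j) (x : H) :
    (B.toRoot k).1 x = (B.toRoot i).1 x + (B.toRoot j).1 x := by
  have hx : x ∈ Submodule.span ℂ (Set.range (rootSystem H).coroot) := by simp
  induction hx using Submodule.span_induction with
  | mem x hx =>
    obtain ⟨a, rfl⟩ := hx
    obtain ⟨l, rfl⟩ := B.toRoot.surjective a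
    simp only [rootSystem_coroot_apply, B.apply_coroot, pairingIn_add h]
    push_cast; rfl
  | zero => simp only [map_zero, add_zero]
  | add x y _ _ hx hy =>
    simp only [← LieModule.Weight.toLinear_apply, map_add] at hx hy ⊢
    rw [hx, hy]; ring
  | smul c x _ hx =>
    simp only [← LieModule.Weight.toLinear_apply, map_smul] at hx ⊢
    rw [hx, smul_add]

lemma ChevalleyBasis.toRoot_neg (B : ChevalleyBasis P H) {i k : ι}
    (h : P.root k = -P.root i) (x : H) :
    (B.toRoot k).1 x = -(B.toRoot i).1 x := by
  have hx : x ∈ Submodule.span ℂ (Set.range (rootSystem H).coroot) := by simp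
  induction hx using Submodule.span_induction with
  | mem x hx =>
    obtain ⟨a, rfl⟩ := hx
    obtain ⟨l, rfl⟩ := B.toRoot.surjective a
    simp only [rootSystem_coroot_apply, B.apply_coroot, pairingIn_neg h]
    push_cast; rfl
  | zero => simp only [map_zero, neg_zero]
  | add x y _ _ hx hy =>
    simp only [← LieModule.Weight.toLinear_apply, map_add] at hx hy ⊢
    rw [hx, hy]; ring
  | smul c x _ hx =>
    simp only [← LieModule.Weight.toLinear_apply, map_smul] at hx ⊢
    rw [hx, smul_neg]

lemma pairingIn_neg_right {i k : ι} (h : P.root k = -P.root i) (l : ι) :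
    P.pairingIn ℤ l k = -P.pairingIn ℤ l i := by
  rw [eq_neg_index h, P.pairingIn_reflectionPerm_self_right]

lemma ChevalleyBasis.lie_e_neg' (B : ChevalleyBasis P H) {i k : ι} (h : P.root k = -P.root i) :
    ⁅B.e i, B.e k⁆ = ((coroot (B.toRoot i).1 : H) : L) := by
  rw [eq_neg_index h, B.lie_e_neg]

lemma ChevalleyBasis.coroot_lie_e (B : ChevalleyBasis P H) (i j : ι) :
    ⁅((coroot (B.toRoot i).1 : H) : L), B.e j⁆ = P.pairingIn ℤ j i • B.e j := by
  have := lie_eq_smul_of_mem_rootSpace (B.e_mem j) (coroot (B.toRoot i).1)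
  rw [B.apply_coroot] at this
  rw [← Int.cast_smul_eq_zsmul ℂ]
  exact this

lemma ChevalleyBasis.e_ne_zero (B : ChevalleyBasis P H) (i : ι) : B.e i ≠ 0 := by
  intro h
  have h1 := B.lie_e_neg i
  rw [h, zero_lie] at h1
  have h2 : coroot (B.toRoot i).1 = 0 := by exact_mod_cast h1.symm
  have h3 := B.apply_coroot i i
  rw [h2, P.pairingIn_same, ← LieModule.Weight.toLinear_apply, map_zero] at h3
  norm_num at h3


lemma pairingIn_of_add [IsSimplyLaced P] {i j k : ι} (h : P.root k = P.root i + P.root j) :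
    P.pairingIn ℤ j i = -1 := by
  have hadd := pairingIn_add h i
  have hii : P.pairingIn ℤ i i = 2 := P.pairingIn_same ℤ i
  have hki : k ≠ i := by
    rintro rfl
    exact P.ne_zero j (by simpa using h)
  by_cases hkn : P.root k = -P.root i
  · have h1 := pairingIn_neg hkn i
    by_cases hji : j = i
    · subst hji; omega
    by_cases hjn : P.root j = -P.root i
    · exact absurd (by rw [h, hjn, add_neg_cancel]) (P.ne_zero k)
    have := IsSimplyLaced.pairingIn_mem (P := P) j i hji hjn
    omega
  have hk := IsSimplyLaced.pairingIn_mem (P := P) k i hki hkn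
  by_cases hji : j = i
  · subst hji; omega
  by_cases hjn : P.root j = -P.root i
  · exact absurd (by rw [h, hjn, add_neg_cancel]) (P.ne_zero k)
  have := IsSimplyLaced.pairingIn_mem (P := P) j i hji hjn
  omega

lemma pairingIn_ge [IsSimplyLaced P] (i j : ι) : -2 ≤ P.pairingIn ℤ i j := by
  by_cases hij : i = j
  · subst hij; rw [P.pairingIn_same]; norm_num
  by_cases hn : P.root i = -P.root j
  · rw [pairingIn_neg hn, P.pairingIn_same]
  have := IsSimplyLaced.pairingIn_mem (P := P) i j hij hn
  omega

lemma ChevalleyBasis.lie_e_sub (B : ChevalleyBasis P H) [IsSimplyLaced P] {i i' j : ι}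
    (hi : P.root i' = -P.root i) (hp : P.pairingIn ℤ j i = -1) : ⁅B.e i', B.e j⁆ = 0 := by
  by_contra hne
  have hmem := LieAlgebra.lie_mem_genWeightSpace_of_mem_genWeightSpace (B.e_mem i') (B.e_mem j)
  let w : LieModule.Weight ℂ H L := ⟨(B.toRoot i').1 + (B.toRoot j).1, fun hb => by
    rw [hb] at hmem
    exact hne (by simpa using hmem)⟩
  have hw : w (coroot (B.toRoot i).1) = -3 := by
    change (B.toRoot i').1 (coroot (B.toRoot i).1) + (B.toRoot j).1 (coroot (B.toRoot i).1) = -3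
    rw [B.apply_coroot, B.apply_coroot, hp, pairingIn_neg hi, P.pairingIn_same]
    norm_num
  have hwn : w.IsNonZero := by
    intro h0
    have h0' : (w : H → ℂ) = 0 := h0
    rw [h0'] at hw
    norm_num at hw
  obtain ⟨l, hl⟩ := B.toRoot.surjective ⟨w, by simpa using hwn⟩
  have h1 := B.apply_coroot l i
  rw [hl] at h1
  have h2 : (P.pairingIn ℤ l i : ℂ) = -3 := h1.symm.trans hw
  have h3 : P.pairingIn ℤ l i = -3 := by exact_mod_cast h2
  have := pairingIn_ge (P := P) l i
  omega

/-- If `α`, `β` and `α + β` are roots then `N_{α,β} N_{-α,α+β} = 1`. -/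
lemma ChevalleyBasis.N_mul_N (B : ChevalleyBasis P H) [IsSimplyLaced P] {i i' j k : ι}
    (hi : P.root i' = -P.root i) (hk : P.root k = P.root i + P.root j) :
    B.N i j * B.N i' k = 1 := by
  have hp := pairingIn_of_add hk
  have h1 := leibniz_lie (B.e i') (B.e i) (B.e j)
  have hii : P.root i = -P.root i' := by rw [hi, neg_neg]
  rw [B.lie_e_sub hi hp, lie_zero, add_zero, ← lie_skew (B.e i') (B.e i), B.lie_e_neg' hi,
    neg_lie, B.coroot_lie_e, hp, B.lie_e i j k hk, lie_smul,
    B.lie_e i' k j (by rw [hk, hi]; abel), smul_smul, neg_smul, one_smul, neg_neg] at h1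
  have h2 : (B.N i j * B.N i' k) • B.e j = (1 : ℤ) • B.e j := by rw [h1, one_smul]
  rw [← Int.cast_smul_eq_zsmul ℂ, ← Int.cast_smul_eq_zsmul ℂ] at h2
  exact_mod_cast smul_left_injective ℂ (B.e_ne_zero j) h2

lemma ChevalleyBasis.N_swap (B : ChevalleyBasis P H) {i j k : ι}
    (hk : P.root k = P.root i + P.root j) : B.N j i = -B.N i j := by
  have h1 := B.lie_e i j k hk
  have h2 := B.lie_e j i k (by rw [hk, add_comm])
  rw [← lie_skew, h1, ← neg_smul] at h2
  rw [← Int.cast_smul_eq_zsmul ℂ, ← Int.cast_smul_eq_zsmul ℂ] at h2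
  exact_mod_cast (smul_left_injective ℂ (B.e_ne_zero k) h2).symm

/-- If `α + β + γ = 0` then `N_{α,β} = N_{β,γ}`. -/
lemma ChevalleyBasis.N_cyc (B : ChevalleyBasis P H) [IsSimplyLaced P] {i j k : ι}
    (h : P.root i + P.root j + P.root k = 0) : B.N i j = B.N j k := by
  have hneg (a : ι) : P.root (P.reflectionPerm a a) = -P.root a := by simp
  have hi : P.root (P.reflectionPerm i i) = P.root j + P.root k := by
    rw [hneg, eq_comm, ← sub_eq_zero, ← h]; abel
  have hj : P.root (P.reflectionPerm j j) = P.root k + P.root i := by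
    rw [hneg, eq_comm, ← sub_eq_zero, ← h]; abel
  have hk : P.root (P.reflectionPerm k k) = P.root i + P.root j := by
    rw [hneg, eq_comm, ← sub_eq_zero, ← h]; abel
  have hJ := lie_jacobi (B.e i) (B.e j) (B.e k)
  rw [B.lie_e j k _ hi, B.lie_e k i _ hj, B.lie_e i j _ hk, lie_smul, lie_smul, lie_smul,
    B.lie_e_neg, B.lie_e_neg, B.lie_e_neg] at hJ
  have key (l : ι) : B.N j k * P.pairingIn ℤ l i + B.N k i * P.pairingIn ℤ l j +
      B.N i j * P.pairingIn ℤ l k = 0 := by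
    have h1 := congrArg (fun x => ⁅x, B.e l⁆) hJ
    simp only [add_lie, smul_lie, B.coroot_lie_e, zero_lie, smul_smul, ← add_smul] at h1
    rw [← Int.cast_smul_eq_zsmul ℂ] at h1
    exact_mod_cast (smul_eq_zero.mp h1).resolve_right (B.e_ne_zero l)
  have k1 := key i
  have k2 := key j
  rw [P.pairingIn_same, pairingIn_of_add (show P.root _ = P.root j + P.root i by rw [hk, add_comm]),
    pairingIn_of_add (show P.root _ = P.root k + P.root i by rw [hj])] at k1
  rw [P.pairingIn_same, pairingIn_of_add hk,
    pairingIn_of_add (show P.root _ = P.root k + P.root j by rw [hi, add_comm])] at k2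
  omega

end Chevalley

section WeylAux
open scoped commutatorElement
variable {G R : Type*} [Group G] [CommRing R]

lemma conj_of_commutator {a g d : G} (h : ⁅a, g⁆ = d) : a * g * a⁻¹ = d * g := by
  rw [← h, commutatorElement_def]; group

lemma weyl_conj_aux {xa xb xg xd : R → G} {ε : R} (hε : ε * ε = 1)
    (hg : ∀ s t, xg s * xg t = xg (s + t)) (hd : ∀ s t, xd s * xd t = xd (s + t))
    (hag : ∀ s t, ⁅xa s, xg t⁆ = xd (ε * s * t)) (hbd : ∀ s t, ⁅xb s, xd t⁆ = xg (ε * s * t))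
    (had : ∀ s t, ⁅xa s, xd t⁆ = 1) (hbg : ∀ s t, ⁅xb s, xg t⁆ = 1)
    (hgd : ∀ s t, ⁅xg s, xd t⁆ = 1) (u : Rˣ) (t : R) :
    MulAut.conj (xa u * xb (-((u⁻¹ : Rˣ) : R)) * xa u) (xg t) = xd (ε * u * t) ∧
    MulAut.conj (xa u * xb (-((u⁻¹ : Rˣ) : R)) * xa u) (xd t) = xg (-(ε * (u⁻¹ : Rˣ) * t)) := by
  have cag (s t) : MulAut.conj (xa s) (xg t) = xd (ε * s * t) * xg t := conj_of_commutator (hag s t)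
  have cbd (s t) : MulAut.conj (xb s) (xd t) = xg (ε * s * t) * xd t := conj_of_commutator (hbd s t)
  have cad (s t) : MulAut.conj (xa s) (xd t) = xd t := by
    simpa using conj_of_commutator (had s t)
  have cbg (s t) : MulAut.conj (xb s) (xg t) = xg t := by
    simpa using conj_of_commutator (hbg s t)
  have comm (s t) : xg s * xd t = xd t * xg s := commutatorElement_eq_one_iff_mul_comm.mp (hgd s t)
  have hg0 : xg 0 = 1 := by have := hg 0 0; rw [add_zero] at this; exact mul_eq_left.mp this
  have hd0 : xd 0 = 1 := by have := hd 0 0; rw [add_zero] at this; exact mul_eq_left.mp this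
  have hu : (u : R) * (u⁻¹ : Rˣ) = 1 := u.mul_inv
  constructor
  · have h1 : ε * -((u⁻¹ : Rˣ) : R) * (ε * u * t) = -t := by
      linear_combination (-t) * hε + (-t * ε * ε) * hu
    rw [map_mul, map_mul, MulAut.mul_apply, MulAut.mul_apply, cag, map_mul, cbd, cbg, h1, comm,
      mul_assoc, hg, neg_add_cancel, hg0, mul_one, cad]
  · have h1 : ε * u * (ε * -((u⁻¹ : Rˣ) : R) * t) = -t := by
      linear_combination (-t) * hε + (-t * ε * ε) * hu
    rw [map_mul, map_mul, MulAut.mul_apply, MulAut.mul_apply, cad, cbd, map_mul, cag, cad, h1, 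
      mul_assoc, comm, ← mul_assoc, hd, neg_add_cancel, hd0, one_mul]
    congr 1; ring

lemma weyl_relations {xa xb xg xd xg' xd' : R → G} {ε : R} (hε : ε * ε = 1)
    (hg : ∀ s t, xg s * xg t = xg (s + t)) (hd : ∀ s t, xd s * xd t = xd (s + t))
    (hg' : ∀ s t, xg' s * xg' t = xg' (s + t)) (hd' : ∀ s t, xd' s * xd' t = xd' (s + t))
    (hag : ∀ s t, ⁅xa s, xg t⁆ = xd (ε * s * t)) (hbd : ∀ s t, ⁅xb s, xd t⁆ = xg (ε * s * t))
    (had : ∀ s t, ⁅xa s, xd t⁆ = 1) (hbg : ∀ s t, ⁅xb s, xg t⁆ = 1)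
    (hgd : ∀ s t, ⁅xg s, xd t⁆ = 1)
    (had' : ∀ s t, ⁅xa s, xd' t⁆ = xg' (-ε * s * t))
    (hbg' : ∀ s t, ⁅xb s, xg' t⁆ = xd' (-ε * s * t))
    (hag' : ∀ s t, ⁅xa s, xg' t⁆ = 1) (hbd' : ∀ s t, ⁅xb s, xd' t⁆ = 1)
    (hdg' : ∀ s t, ⁅xd' s, xg' t⁆ = 1)
    (hda : ∀ s t, ⁅xd s, xg' t⁆ = xa (ε * s * t)) (hgb : ∀ s t, ⁅xg s, xd' t⁆ = xb (ε * s * t))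
    (u : Rˣ) (t : R) :
    MulAut.conj (xa u * xb (-((u⁻¹ : Rˣ) : R)) * xa u) (xa t) =
      xb (-(((u⁻¹ : Rˣ) : R) ^ 2 * t)) ∧
    MulAut.conj (xa u * xb (-((u⁻¹ : Rˣ) : R)) * xa u) (xb t) = xa (-((u : R) ^ 2 * t)) := by
  have A := weyl_conj_aux hε hg hd hag hbd had hbg hgd u
  have B := weyl_conj_aux (ε := -ε) (by rw [neg_mul_neg, hε]) hd' hg' had' hbg' hag' hbd' hdg' u
  have ha : xa t = ⁅xd (ε * t), xg' 1⁆ := by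
    rw [hda]; congr 1; linear_combination (-t) * hε
  have hb : xb t = ⁅xg (ε * t), xd' 1⁆ := by
    rw [hgb]; congr 1; linear_combination (-t) * hε
  constructor
  · rw [ha, map_commutatorElement, (A _).2, (B _).2, hgb]
    congr 1
    linear_combination (-ε * ε * t * ((u⁻¹ : Rˣ) : R) ^ 2 - t * ((u⁻¹ : Rˣ) : R) ^ 2) * hε
  · rw [hb, map_commutatorElement, (A _).1, (B _).1, hda]
    congr 1
    linear_combination (-ε * ε * t * (u : R) ^ 2 - t * (u : R) ^ 2) * hε
end WeylAux

section Subsystems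

variable {ι M V : Type*} [AddCommGroup M] [Module ℝ M] [AddCommGroup V] [Module ℝ V]

/-- A root subsystem of a root system `Φ = {P.root i | i : ι}`: a set of (indices of) roots which is
stable under the reflections in its own members. Root subsystems are ordered by inclusion. -/
@[ext]
structure Subsystem (P : RootPairing ι ℝ M V) where
  carrier : Set ι
  reflectionPerm_mem' : ∀ i ∈ carrier, ∀ j ∈ carrier, P.reflectionPerm i j ∈ carrier

namespace Subsystem

variable {P : RootPairing ι ℝ M V}

instance : SetLike (Subsystem P) ι where
  coe := carrier
  coe_injective _ _ h := Subsystem.ext h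

instance : PartialOrder (Subsystem P) := .ofSetLike (Subsystem P) ι

/-- The whole root system `Φ`, as a subsystem of itself. -/
instance : OrderTop (Subsystem P) where
  top := ⟨Set.univ, fun _ _ _ _ => Set.mem_univ _⟩
  le_top _ _ _ := Set.mem_univ _

lemma reflectionPerm_mem (Ψ : Subsystem P) {i j : ι} (hi : i ∈ Ψ) (hj : j ∈ Ψ) :
    P.reflectionPerm i j ∈ Ψ :=
  Ψ.reflectionPerm_mem' i hi j hj

/-- The inclusion of the sets of roots attached to an inclusion of subsystems. -/
def incl {Ψ₁ Ψ₂ : Subsystem P} (h : Ψ₁ ≤ Ψ₂) (α : Ψ₁) : Ψ₂ := ⟨α.1, h α.2⟩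

/-- `Ψ` has Dynkin type with Cartan matrix `C`: it is the smallest root subsystem containing some
family of roots `b` with `⟨b i, b j⟩ = C i j`. When `C` is the Cartan matrix of a finite root system,
it is invertible, so that `b` is linearly independent, and `b` is then a basis (a system of simple
roots) of `Ψ`. -/
def IsOfType [P.IsCrystallographic] (Ψ : Subsystem P) {n : ℕ} (C : Matrix (Fin n) (Fin n) ℤ) :
    Prop :=
  ∃ b : Fin n → ι, (∀ i j, P.pairingIn ℤ (b i) (b j) = C i j) ∧
    (∀ i, b i ∈ Ψ) ∧ ∀ Ψ' : Subsystem P, (∀ i, b i ∈ Ψ') → Ψ ≤ Ψ'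

end Subsystem

end Subsystems

section SteinbergGroup

variable {ι : Type u} {M V L : Type*} [AddCommGroup M] [Module ℝ M] [AddCommGroup V]
    [Module ℝ V] [LieRing L] [LieAlgebra ℂ L] [FiniteDimensional ℂ L] [LieAlgebra.IsKilling ℂ L]
    {P : RootPairing ι ℝ M V} [P.IsCrystallographic]
    {H : LieSubalgebra ℂ L} [H.IsCartanSubalgebra]
    (B : ChevalleyBasis P H)

open scoped commutatorElement

/-- The relators of the Steinberg group `St(Ψ, R)`, where the letter `FreeGroup.of (α, ξ)` stands
for `x_α(ξ)`:
* `x_α(ξ) x_α(η) = x_α(ξ + η)`;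
* `[x_α(ξ), x_β(η)] = 1` if `α + β ∉ Ψ ∪ {0}`;
* `[x_α(ξ), x_β(η)] = x_{α+β}(N_{α,β} ξ η)` if `α + β ∈ Ψ`;
* only if `{±α}` is an irreducible component of type `A₁` of `Ψ`: the relations
  `w_α(u) x_β(ζ) w_α(u)⁻¹ = x_{σ_α β}(η_{α,β} u^{-⟨β,α⟩} ζ)` with `β = ±α` and `u` invertible, where
  `w_α(u) = x_α(u) x_{-α}(-u⁻¹) x_α(u)` and `η_{α,±α} = -1`.

If `Ψ` is irreducible of rank at least `2`, then there are only the first three families, and if `Ψ`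
has type `A₁`, this is the classical definition of the Steinberg group of rank one. -/
inductive Relator (Ψ : Subsystem P) (R : Type v) [CommRing R] : FreeGroup (Ψ × R) → Prop
  | add (α : Ψ) (ξ η : R) :
      Relator Ψ R (FreeGroup.of (α, ξ) * FreeGroup.of (α, η) * (FreeGroup.of (α, ξ + η))⁻¹)
  | commute (α β : Ψ) (ξ η : R) (h₀ : P.root α + P.root β ≠ 0)
      (h : ∀ γ : Ψ, P.root γ ≠ P.root α + P.root β) :
      Relator Ψ R ⁅FreeGroup.of (α, ξ), FreeGroup.of (β, η)⁆
  | commutator (α β γ : Ψ) (ξ η : R) (h : P.root γ = P.root α + P.root β) :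
      Relator Ψ R (⁅FreeGroup.of (α, ξ), FreeGroup.of (β, η)⁆ * (FreeGroup.of (γ, (B.N α β : R) * ξ * η))⁻¹)
  | weyl_same (α β : Ψ) (u : Rˣ) (ζ : R) (hβ : P.root β = -P.root α)
      (h : ∀ γ : Ψ, γ ≠ α → γ ≠ β → P.pairingIn ℤ γ α = 0) :
      Relator Ψ R (MulAut.conj (FreeGroup.of (α, (u : R)) * FreeGroup.of (β, -((u⁻¹ : Rˣ) : R)) * FreeGroup.of (α, (u : R)))
        (FreeGroup.of (α, ζ)) * (FreeGroup.of (β, -(((u⁻¹ : Rˣ) : R) ^ 2 * ζ)))⁻¹)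
  | weyl_neg (α β : Ψ) (u : Rˣ) (ζ : R) (hβ : P.root β = -P.root α)
      (h : ∀ γ : Ψ, γ ≠ α → γ ≠ β → P.pairingIn ℤ γ α = 0) :
      Relator Ψ R (MulAut.conj (FreeGroup.of (α, (u : R)) * FreeGroup.of (β, -((u⁻¹ : Rˣ) : R)) * FreeGroup.of (α, (u : R)))
        (FreeGroup.of (β, ζ)) * (FreeGroup.of (α, -((u : R) ^ 2 * ζ)))⁻¹)

/-- The Steinberg group `St(Ψ, R)` of a root subsystem `Ψ` of `Φ`, with respect to the structure
constants of `Φ` that come from the Chevalley basis `B`. The group `St(Φ, R)` itself is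
`St B ⊤ R`. -/
abbrev St (Ψ : Subsystem P) (R : Type v) [CommRing R] : Type (max u v) :=
  PresentedGroup {w : FreeGroup (Ψ × R) | Relator B Ψ R w}

namespace St

variable {B} {Ψ Ψ₁ Ψ₂ Ψ₃ : Subsystem P} {R S : Type v} [CommRing R] [CommRing S]

/-- The generator `x_α(ξ)` of `St(Ψ, R)`. -/
def x (B : ChevalleyBasis P H) {Ψ : Subsystem P} (α : Ψ) (ξ : R) : St B Ψ R :=
  PresentedGroup.of (α, ξ)

lemma mk_of (a : Ψ × R) :
    PresentedGroup.mk {w : FreeGroup (Ψ × R) | Relator B Ψ R w} (.of a) = x B a.1 a.2 := rfl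

lemma x_add (α : Ψ) (ξ η : R) : x B α ξ * x B α η = x B α (ξ + η) :=
  PresentedGroup.mk_eq_mk_of_mul_inv_mem (Relator.add (B := B) α ξ η)

lemma x_commute (α β : Ψ) (ξ η : R) (h₀ : P.root α + P.root β ≠ 0)
    (h : ∀ γ : Ψ, P.root γ ≠ P.root α + P.root β) : ⁅x B α ξ, x B β η⁆ = 1 :=
  PresentedGroup.one_of_mem (Relator.commute (B := B) α β ξ η h₀ h)

lemma x_commutator (α β γ : Ψ) (ξ η : R) (h : P.root γ = P.root α + P.root β) :
    ⁅x B α ξ, x B β η⁆ = x B γ ((B.N α β : R) * ξ * η) :=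
  PresentedGroup.mk_eq_mk_of_mul_inv_mem (Relator.commutator (B := B) α β γ ξ η h)

/-- The relations between `w_α(u)` and `x_{±α}(ζ)` hold in every `St(Ψ, R)`. They are defining ones if
`{±α}` is a component of `Ψ`, and follow from the other relations if it is not. -/
lemma x_weyl [IsSimplyLaced P] (α β : Ψ) (u : Rˣ) (ζ : R) (hβ : P.root β = -P.root α) :
    MulAut.conj (x B α (u : R) * x B β (-((u⁻¹ : Rˣ) : R)) * x B α (u : R)) (x B α ζ) =
      x B β (-(((u⁻¹ : Rˣ) : R) ^ 2 * ζ)) ∧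
    MulAut.conj (x B α (u : R) * x B β (-((u⁻¹ : Rˣ) : R)) * x B α (u : R)) (x B β ζ) =
      x B α (-((u : R) ^ 2 * ζ)) := by
  by_cases h : ∀ γ : Ψ, γ ≠ α → γ ≠ β → P.pairingIn ℤ γ α = 0
  · constructor
    · exact PresentedGroup.mk_eq_mk_of_mul_inv_mem (Relator.weyl_same (B := B) α β u ζ hβ h)
    · exact PresentedGroup.mk_eq_mk_of_mul_inv_mem (Relator.weyl_neg (B := B) α β u ζ hβ h)
  -- there are roots `γ` and `δ = α + γ` in `Ψ`
  obtain ⟨γ, δ, hδ⟩ : ∃ γ δ : Ψ, P.root δ = P.root α + P.root γ := by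
    push Not at h
    obtain ⟨γ, h1, h2, h3⟩ := h
    have hr : P.root (P.reflectionPerm α γ) = P.root γ - P.pairingIn ℤ γ α • P.root α := by
      rw [P.root_reflectionPerm, P.reflection_apply_root, ← P.algebraMap_pairingIn ℤ]
      exact congrArg _ (Int.cast_smul_eq_zsmul ℝ _ _)
    have h4 : (γ : ι) ≠ α := fun h => h1 (Subtype.ext h)
    have h5 : P.root γ ≠ -P.root α := fun h => h2 (Subtype.ext (P.root.injective (by rw [h, hβ])))
    rcases IsSimplyLaced.pairingIn_mem (P := P) γ α h4 h5 with hp | hp | hp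
    · refine ⟨γ, ⟨_, Ψ.reflectionPerm_mem α.2 γ.2⟩, ?_⟩
      rw [hr, hp]; simp [add_comm]
    · exact absurd hp h3
    · refine ⟨⟨_, Ψ.reflectionPerm_mem α.2 γ.2⟩, γ, ?_⟩
      rw [hr, hp]; simp
  have hneg (a : Ψ) : ∃ a' : Ψ, P.root a' = -P.root a :=
    ⟨⟨_, Ψ.reflectionPerm_mem a.2 a.2⟩, by simp⟩
  obtain ⟨γ', hγ'⟩ := hneg γ
  obtain ⟨δ', hδ'⟩ := hneg δ
  have hp : P.pairingIn ℤ γ α = -1 := pairingIn_of_add hδ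
  have hp' : P.pairingIn ℤ α γ = -1 := pairingIn_of_add (hδ.trans (add_comm _ _))
  -- no root is the sum of two roots with non-negative pairing
  have hno (a b : Ψ) (hab : 0 ≤ P.pairingIn ℤ a b ∨ 0 ≤ P.pairingIn ℤ b a) (ξ η : R) : ⁅x B a ξ, x B b η⁆ = 1 := by
    refine x_commute a b ξ η (fun h0 => ?_) (fun c hc => ?_)
    · have h1 := pairingIn_neg (eq_neg_of_add_eq_zero_left h0) (b : ι)
      have h2 := pairingIn_neg (eq_neg_of_add_eq_zero_right h0) (a : ι)
      rw [P.pairingIn_same] at h1 h2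
      omega
    · have h1 := pairingIn_of_add (hc.trans (add_comm _ _))
      have h2 := pairingIn_of_add hc
      omega
  have q1 : P.pairingIn ℤ δ α = 1 := by
    rw [pairingIn_add hδ, P.pairingIn_same, hp]; norm_num
  have q2 : P.pairingIn ℤ δ γ = 1 := by
    rw [pairingIn_add hδ, P.pairingIn_same, hp']; norm_num
  have n1 : B.N α γ * B.N β δ = 1 := B.N_mul_N hβ hδ
  have n2 : B.N δ γ' = B.N γ' β := B.N_cyc (by rw [hδ, hγ', hβ]; abel)
  have n3 : B.N γ' β = B.N β δ := B.N_cyc (by rw [hδ, hγ', hβ]; abel)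
  have n4 : B.N γ δ' = B.N δ' α := B.N_cyc (by rw [hδ', hδ]; abel)
  have n5 : B.N δ' α = B.N α γ := B.N_cyc (by rw [hδ', hδ]; abel)
  have n6 : B.N α δ' = -B.N δ' α := B.N_swap (k := γ') (by rw [hγ', hδ', hδ]; abel)
  have n7 : B.N β γ' = -B.N γ' β := B.N_swap (k := δ') (by rw [hγ', hδ', hδ, hβ]; abel)
  have n8 : B.N β δ = B.N α γ := by
    rcases Int.eq_one_or_neg_one_of_mul_eq_one n1 with h | h <;> rw [h] at n1 ⊢ <;> omega
  have hε : (B.N α γ : R) * (B.N α γ : R) = 1 := by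
    rw [n8] at n1
    rw [← Int.cast_mul, n1, Int.cast_one]
  refine weyl_relations (xg := x B γ) (xd := x B δ) (xg' := x B γ') (xd' := x B δ') hε
    (x_add γ) (x_add δ) (x_add γ') (x_add δ') ?_ ?_ ?_ ?_ ?_ ?_ ?_ ?_ ?_ ?_ ?_ ?_ u ζ
  · exact fun s t => x_commutator α γ δ s t hδ
  · intro s t
    rw [x_commutator β δ γ s t (by rw [hδ, hβ]; abel), n8]
  · exact hno α δ (Or.inr (by rw [q1]; norm_num))
  · exact hno β γ (Or.inl (by rw [pairingIn_neg hβ, hp']; norm_num))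
  · exact hno γ δ (Or.inr (by rw [q2]; norm_num))
  · intro s t
    rw [x_commutator α δ' γ' s t (by rw [hγ', hδ', hδ]; abel), n6, n5]; push_cast; rfl
  · intro s t
    rw [x_commutator β γ' δ' s t (by rw [hγ', hδ', hδ, hβ]; abel), n7, n3, n8]; push_cast; rfl
  · exact hno α γ' (Or.inr (by rw [pairingIn_neg hγ', hp]; norm_num))
  · exact hno β δ' (Or.inr (by rw [pairingIn_neg hδ', pairingIn_neg_right hβ, q1]; norm_num))
  · exact hno δ' γ' (Or.inl (by rw [pairingIn_neg hδ', pairingIn_neg_right hγ', q2]; norm_num))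
  · intro s t
    rw [x_commutator δ γ' α s t (by rw [hγ', hδ]; abel), n2, n3, n8]
  · intro s t
    rw [x_commutator γ δ' β s t (by rw [hδ', hδ, hβ]; abel), n4, n5]

/-- The homomorphism `St(Ψ₁, R) → St(Ψ₂, S)`, `x_α(ξ) ↦ x_α(f(ξ))`, attached to an inclusion
`Ψ₁ ⊆ Ψ₂` of subsystems and a homomorphism of rings `f : R → S`. -/
def map (B : ChevalleyBasis P H) [IsSimplyLaced P] (h : Ψ₁ ≤ Ψ₂) (f : R →+* S) :
    St B Ψ₁ R →* St B Ψ₂ S :=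
  PresentedGroup.toGroup (f := fun a => x B (Subsystem.incl h a.1) (f a.2)) (by
    intro r hr
    have hr' : Relator B Ψ₁ R r := hr
    cases hr' with
    | add α ξ η => simp [x_add]
    | commute α β ξ η h₀ hn =>
      rw [map_commutatorElement, FreeGroup.lift_apply_of, FreeGroup.lift_apply_of]
      refine x_commute _ _ _ _ h₀ fun γ hγ => hn ⟨γ, ?_⟩ hγ
      -- subsystems are closed under the addition of roots
      have hp := pairingIn_of_add hγ
      have : P.reflectionPerm α β = γ := P.root.injective (by
        rw [P.root_reflectionPerm, P.reflection_apply_root, ← P.algebraMap_pairingIn ℤ, hγ]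
        change _ - (algebraMap ℤ ℝ) (P.pairingIn ℤ β α) • _ = _
        have hp' : P.pairingIn ℤ β α = -1 := hp
        rw [hp']
        simp [Subsystem.incl, add_comm])
      rw [← this]
      exact Ψ₁.reflectionPerm_mem α.2 β.2
    | commutator α β γ ξ η hγ =>
      rw [map_mul, map_commutatorElement, map_inv, FreeGroup.lift_apply_of,
        FreeGroup.lift_apply_of, FreeGroup.lift_apply_of, mul_inv_eq_one,
        x_commutator (Subsystem.incl h α) (Subsystem.incl h β) (Subsystem.incl h γ) _ _ hγ]
      simp [Subsystem.incl]
    | weyl_same α β u ζ hβ hn =>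
      have := (x_weyl (B := B) (Subsystem.incl h α) (Subsystem.incl h β)
        (Units.map (f : R →* S) u) (f ζ) hβ).1
      simp only [MulAut.conj_apply] at this ⊢
      simp only [map_mul, map_inv, FreeGroup.lift_apply_of, mul_inv_eq_one,
        map_neg, map_pow] at this ⊢
      exact this
    | weyl_neg α β u ζ hβ hn =>
      have := (x_weyl (B := B) (Subsystem.incl h α) (Subsystem.incl h β)
        (Units.map (f : R →* S) u) (f ζ) hβ).2
      simp only [MulAut.conj_apply] at this ⊢
      simp only [map_mul, map_inv, FreeGroup.lift_apply_of, mul_inv_eq_one,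
        map_neg, map_pow] at this ⊢
      exact this)

@[simp]
lemma map_x [IsSimplyLaced P] (h : Ψ₁ ≤ Ψ₂) (f : R →+* S) (α : Ψ₁) (ξ : R) :
    map B h f (x B α ξ) = x B (Subsystem.incl h α) (f ξ) :=
  PresentedGroup.toGroup.of _

lemma map_id [IsSimplyLaced P] (g : St B Ψ R) : map B (le_refl Ψ) (RingHom.id R) g = g := by
  have : map B (le_refl Ψ) (RingHom.id R) = MonoidHom.id _ :=
    PresentedGroup.ext fun a => map_x (B := B) (le_refl Ψ) (RingHom.id R) a.1 a.2
  rw [this]; rfl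

lemma map_map [IsSimplyLaced P] {T : Type v} [CommRing T] (h : Ψ₁ ≤ Ψ₂) (h' : Ψ₂ ≤ Ψ₃)
    (f : R →+* S) (f' : S →+* T) (g : St B Ψ₁ R) :
    map B h' f' (map B h f g) = map B (h.trans h') (f'.comp f) g := by
  have : (map B h' f').comp (map B h f) = map B (h.trans h') (f'.comp f) :=
    PresentedGroup.ext fun a => by
      change map B h' f' (map B h f (x B a.1 a.2)) = map B (h.trans h') (f'.comp f) (x B a.1 a.2)
      rw [map_x, map_x, map_x]; rfl
  exact DFunLike.congr_fun this g

end St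

end SteinbergGroup

section Relative

/-- The double `D(R, I)` of `R` along `I`: the ring of pairs `(a₁, a₂)` with `a₁ - a₂ ∈ I`, that is,
the fibre product of two copies of `R` over `R/I`. -/
def double {R : Type v} [CommRing R] (I : Ideal R) : Subring (R × R) where
  carrier := {a | a.1 - a.2 ∈ I}
  mul_mem' {a b} ha hb := by
    have : (a * b).1 - (a * b).2 = a.1 * (b.1 - b.2) + (a.1 - a.2) * b.2 := by
      simp only [Prod.fst_mul, Prod.snd_mul]; ring
    change _ ∈ I
    rw [this]
    exact I.add_mem (I.mul_mem_left _ hb) (I.mul_mem_right _ ha)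
  one_mem' := by simp
  add_mem' {a b} ha hb := by
    have : (a + b).1 - (a + b).2 = (a.1 - a.2) + (b.1 - b.2) := by
      simp only [Prod.fst_add, Prod.snd_add]; ring
    change _ ∈ I
    rw [this]
    exact I.add_mem ha hb
  zero_mem' := by simp
  neg_mem' {a} ha := by
    have : (-a).1 - (-a).2 = -(a.1 - a.2) := by
      simp only [Prod.fst_neg, Prod.snd_neg]; ring
    change _ ∈ I
    rw [this]
    exact I.neg_mem ha

/-- The first projection `p₁ : D(R, I) → R`. -/
def p₁ {R : Type v} [CommRing R] (I : Ideal R) : double I →+* R :=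
  (RingHom.fst R R).comp (double I).subtype

/-- The second projection `p₂ : D(R, I) → R`. -/
def p₂ {R : Type v} [CommRing R] (I : Ideal R) : double I →+* R :=
  (RingHom.snd R R).comp (double I).subtype

variable {ι : Type u} {M V L : Type*} [AddCommGroup M] [Module ℝ M] [AddCommGroup V]
    [Module ℝ V] [LieRing L] [LieAlgebra ℂ L] [FiniteDimensional ℂ L] [LieAlgebra.IsKilling ℂ L]
    {P : RootPairing ι ℝ M V} [P.IsCrystallographic] [IsSimplyLaced P]
    {H : LieSubalgebra ℂ L} [H.IsCartanSubalgebra]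
    (B : ChevalleyBasis P H)
    {R : Type v} [CommRing R]

/-- `G₁ = Ker(p₁^* : St(Ψ, D(R, I)) → St(Ψ, R))`. -/
def G₁ (Ψ : Subsystem P) (I : Ideal R) : Subgroup (St B Ψ (double I)) :=
  (St.map B (le_refl Ψ) (p₁ I)).ker

/-- `G₂ = Ker(p₂^* : St(Ψ, D(R, I)) → St(Ψ, R))`. -/
def G₂ (Ψ : Subsystem P) (I : Ideal R) : Subgroup (St B Ψ (double I)) :=
  (St.map B (le_refl Ψ) (p₂ I)).ker

instance (Ψ : Subsystem P) (I : Ideal R) : (G₁ B Ψ I).Normal := MonoidHom.normal_ker _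

instance (Ψ : Subsystem P) (I : Ideal R) : (G₂ B Ψ I).Normal := MonoidHom.normal_ker _

/-- The relative Steinberg group `St(Ψ, R, I) = G₁ / [G₁, G₂]`. -/
abbrev RelSt (Ψ : Subsystem P) (I : Ideal R) : Type (max u v) :=
  G₁ B Ψ I ⧸ (⁅G₁ B Ψ I, G₂ B Ψ I⁆).subgroupOf (G₁ B Ψ I)

variable {Ψ₁ Ψ₂ Ψ₃ : Subsystem P} (I : Ideal R)

lemma map_mem_G₁ (h : Ψ₁ ≤ Ψ₂) {g : St B Ψ₁ (double I)} (hg : g ∈ G₁ B Ψ₁ I) :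
    St.map B h (RingHom.id _) g ∈ G₁ B Ψ₂ I := by
  have hg' : St.map B (le_refl Ψ₁) (p₁ I) g = 1 := hg
  change St.map B (le_refl Ψ₂) (p₁ I) _ = 1
  have h1 := St.map_map (B := B) (le_refl Ψ₁) h (p₁ I) (RingHom.id R) g
  rw [hg', map_one] at h1
  rw [St.map_map]
  exact h1.symm

lemma map_mem_G₂ (h : Ψ₁ ≤ Ψ₂) {g : St B Ψ₁ (double I)} (hg : g ∈ G₂ B Ψ₁ I) :
    St.map B h (RingHom.id _) g ∈ G₂ B Ψ₂ I := by
  have hg' : St.map B (le_refl Ψ₁) (p₂ I) g = 1 := hg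
  change St.map B (le_refl Ψ₂) (p₂ I) _ = 1
  have h1 := St.map_map (B := B) (le_refl Ψ₁) h (p₂ I) (RingHom.id R) g
  rw [hg', map_one] at h1
  rw [St.map_map]
  exact h1.symm

/-- The homomorphism `G₁(Ψ₁) → G₁(Ψ₂)` induced by `St(Ψ₁, D(R, I)) → St(Ψ₂, D(R, I))`. -/
def G₁.map (h : Ψ₁ ≤ Ψ₂) : G₁ B Ψ₁ I →* G₁ B Ψ₂ I :=
  ((St.map B h (RingHom.id (double I))).comp (G₁ B Ψ₁ I).subtype).codRestrict (G₁ B Ψ₂ I)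
    fun g => map_mem_G₁ B I h g.2

/-- The homomorphism `St(Ψ₁, R, I) → St(Ψ₂, R, I)` induced by an inclusion `Ψ₁ ⊆ Ψ₂`. -/
def RelSt.map (h : Ψ₁ ≤ Ψ₂) : RelSt B Ψ₁ I →* RelSt B Ψ₂ I :=
  QuotientGroup.map _ _ (G₁.map B I h) (by
    have key : ⁅G₁ B Ψ₁ I, G₂ B Ψ₁ I⁆ ≤
        (⁅G₁ B Ψ₂ I, G₂ B Ψ₂ I⁆).comap (St.map B h (RingHom.id (double I))) := by
      rw [Subgroup.commutator_le]
      intro a ha b hb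
      rw [Subgroup.mem_comap, map_commutatorElement]
      exact Subgroup.commutator_mem_commutator (map_mem_G₁ B I h ha) (map_mem_G₂ B I h hb)
    exact fun g hg => key hg)

lemma RelSt.map_mk (h : Ψ₁ ≤ Ψ₂) (g : G₁ B Ψ₁ I) :
    RelSt.map B I h (QuotientGroup.mk g) = QuotientGroup.mk (G₁.map B I h g) := rfl

lemma RelSt.map_id (Ψ : Subsystem P) : RelSt.map B I (le_refl Ψ) = MonoidHom.id _ :=
  QuotientGroup.monoidHom_ext _ (MonoidHom.ext fun g => congrArg QuotientGroup.mk
    (Subtype.ext (St.map_id (B := B) g.1) : G₁.map B I (le_refl Ψ) g = g))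

lemma RelSt.map_comp (h : Ψ₁ ≤ Ψ₂) (h' : Ψ₂ ≤ Ψ₃) :
    RelSt.map B I (h.trans h') = (RelSt.map B I h').comp (RelSt.map B I h) :=
  QuotientGroup.monoidHom_ext _ (MonoidHom.ext fun g => congrArg QuotientGroup.mk
    (Subtype.ext (St.map_map (B := B) h h' (RingHom.id _) (RingHom.id _) g.1).symm :
      G₁.map B I (h.trans h') g = G₁.map B I h' (G₁.map B I h g)))

open CategoryTheory Limits

/-- The functor `Ψ ↦ St(Ψ, R, I)` from the category of root subsystems of `Φ` and their inclusions
to the category of groups. -/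
def relStFunctor : Subsystem P ⥤ GrpCat.{max u v} where
  obj Ψ := GrpCat.of (RelSt B Ψ I)
  map f := GrpCat.ofHom (RelSt.map B I (leOfHom f))
  map_id _ := congrArg GrpCat.ofHom (RelSt.map_id B I _)
  map_comp f f' := congrArg GrpCat.ofHom (RelSt.map_comp B I (leOfHom f) (leOfHom f'))

/-- The objects of the category `𝒢_{1,n}`: the root subsystems of `Φ` of type `A₁` or `A_n`. -/
def bipartite (P : RootPairing ι ℝ M V) [P.IsCrystallographic] (n : ℕ) :
    ObjectProperty (Subsystem P) :=
  fun Ψ => Ψ.IsOfType (CartanMatrix.A 1) ∨ Ψ.IsOfType (CartanMatrix.A n)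

/-- The restriction of the functor `St(-, R, I)` to the full subcategory `𝒢_{1,n}`. -/
def relStDiagram (n : ℕ) : (bipartite P n).FullSubcategory ⥤ GrpCat.{max u v} :=
  (bipartite P n).ι ⋙ relStFunctor B I

/-- The cocone over the restriction of `St(-, R, I)` to `𝒢_{1,n}` with vertex `St(Φ, R, I)` whose
legs are the homomorphisms `St(Ψ, R, I) → St(Φ, R, I)` induced by the inclusions `Ψ ⊆ Φ`. -/
def relStCocone (n : ℕ) : Cocone (relStDiagram B I n) where
  pt := (relStFunctor B I).obj ⊤
  ι :=
    { app := fun _ => (relStFunctor B I).map (homOfLE le_top)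
      naturality := fun _ _ f =>
        ((relStFunctor B I).map_comp ((bipartite P n).ι.map f) (homOfLE le_top)).symm.trans (Category.comp_id _).symm }

end Relative

end

end Steinberg

namespace Steinberg

set_option linter.unusedSectionVars false

universe u v

/-! ### Root subsystems, their A₃'s and abelian radicals. -/

section RootCombinatorics

variable {ι M V : Type*} [AddCommGroup M] [Module ℝ M] [AddCommGroup V] [Module ℝ V]
    {P : RootPairing ι ℝ M V}

namespace Subsystem

/-! Let A be the amalgam of the groups St(Ψ, R, I) over the subsystems Ψ of type A₁ and A₃.
Uniqueness of homomorphisms out of St(Φ, R, I) is cheap: G₁(Ψ) is generated by the images of the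
groups G₁({±β}), β ∈ Ψ (`G₁_le_rankOneSubgroup`), so everything is determined on the subsystems of
type A₁. What must be built is a homomorphism St(Φ, R, I) → A compatible with the legs (`ofRelSt`).

The diagonal Δ : R → D(R, I) splits p₁, so St(Φ, D(R, I)) is a semidirect product of G₁ and St(Φ,
R). If St(Φ, R) acts on A as it acts on G₁ by conjugation, then x_α(d) ↦ (x_α(d - Δp₁(d)),
x_α(p₁(d))) defines a homomorphism St(Φ, D(R, I)) → A ⋊ St(Φ, R): each Steinberg relation takes
place in a subsystem containing two given roots, and any two roots lie in a common A₃
(`exists_isAThree_pair`). It sends G₁ into A. The conjugation action of its image on A factors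
through p₂ (`conjLeft_toSemidirect`), because G₂(Ψ) acts trivially on G₁(Ψ)/[G₁(Ψ), G₂(Ψ)]; hence
the image of G₂ centralizes that of G₁, and [G₁, G₂] is killed.

The heart is the action (`exists_conj`): conjugation by x_α(r) must be defined on the leg of every
Ψ. It is clear if Ψ lies in an A₃ containing α. Otherwise Ψ is an A₃ with α ∉ Ψ, and the roots
congruent to α modulo the span of Ψ form a set U with pairwise non-negative pairings
(`IsAThree.isRadical`). The corresponding root elements commute and are permuted linearly by St(Ψ)
through the adjoint representation (`radicalRep`, `conj_prodHom`). So x g x⁻¹ = X(u - g·u) g, where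
X is the product of root elements over U and u is the vector of x; for g ∈ G₁ the coordinates of u -
g·u lie in Ker p₁, and the right-hand side makes sense in A. The Steinberg relations for the
resulting automorphisms are tested on a third root δ: either all roots involved lie in one A₃, or
enough of them are orthogonal (`exists_isAThree_triple`).

In type E every A₃ lies in an A₄ (`exists_isOfType_A_four`), so a compatible family on the A₁'s and
A₄'s restricts to one on the A₁'s and A₃'s. If A₃ with end roots a, c did not extend, (a + c)/2
would be a weight of squared length 1, and E₆, E₇, E₈ have none congruent to half a root lattice
vector in this way. -/

/-- The smallest root subsystem containing a given set of roots. -/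
def closure (P : RootPairing ι ℝ M V) (s : Set ι) : Subsystem P where
  carrier := {i | ∀ Ψ : Subsystem P, s ⊆ Ψ → i ∈ Ψ}
  reflectionPerm_mem' _ hi _ hj Ψ hΨ := Ψ.reflectionPerm_mem (hi Ψ hΨ) (hj Ψ hΨ)

lemma subset_closure (s : Set ι) : s ⊆ closure P s := fun _ hi _ hΨ => hΨ hi

lemma closure_le {s : Set ι} {Ψ : Subsystem P} (h : s ⊆ Ψ) : closure P s ≤ Ψ :=
  fun _ hi => hi Ψ h

/-- The intersection of two root subsystems. -/
def inter (Ψ₁ Ψ₂ : Subsystem P) : Subsystem P where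
  carrier := {i | i ∈ Ψ₁ ∧ i ∈ Ψ₂}
  reflectionPerm_mem' _ hi _ hj :=
    ⟨Ψ₁.reflectionPerm_mem hi.1 hj.1, Ψ₂.reflectionPerm_mem hi.2 hj.2⟩

lemma inter_le_left (Ψ₁ Ψ₂ : Subsystem P) : inter Ψ₁ Ψ₂ ≤ Ψ₁ := fun _ h => h.1

lemma inter_le_right (Ψ₁ Ψ₂ : Subsystem P) : inter Ψ₁ Ψ₂ ≤ Ψ₂ := fun _ h => h.2

end Subsystem

variable [P.IsCrystallographic]

lemma root_reflectionPerm' (i j : ι) :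
    P.root (P.reflectionPerm i j) = P.root j - (P.pairingIn ℤ j i : ℝ) • P.root i := by
  rw [P.root_reflectionPerm, P.reflection_apply_root, ← P.algebraMap_pairingIn ℤ]
  rfl

lemma root_neg (i : ι) : P.root (P.reflectionPerm i i) = -P.root i := by simp

lemma Subsystem.neg_mem (Ψ : Subsystem P) {i : ι} (hi : i ∈ Ψ) : P.reflectionPerm i i ∈ Ψ :=
  Ψ.reflectionPerm_mem hi hi

namespace Subsystem

/-- The roots whose vectors lie in a given subspace. -/
def ofSubmodule (P : RootPairing ι ℝ M V) [P.IsCrystallographic] (q : Submodule ℝ M) :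
    Subsystem P where
  carrier := {i | P.root i ∈ q}
  reflectionPerm_mem' i hi j hj := by
    change P.root _ ∈ q
    rw [root_reflectionPerm']
    exact q.sub_mem hj (q.smul_mem _ hi)

/-- The roots that are orthogonal to a given root. -/
def orthogonal (P : RootPairing ι ℝ M V) [P.IsCrystallographic] (a : ι) : Subsystem P where
  carrier := {i | P.pairingIn ℤ i a = 0}
  reflectionPerm_mem' i hi j hj := by
    have hi' : P.pairingIn ℤ i a = 0 := hi
    have hj' : P.pairingIn ℤ j a = 0 := hj
    change P.pairingIn ℤ _ a = 0
    have h : P.pairing (P.reflectionPerm i j) a = 0 := by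
      rw [← P.root_coroot_eq_pairing, root_reflectionPerm', map_sub, map_smul,
        LinearMap.sub_apply, LinearMap.smul_apply, P.root_coroot_eq_pairing,
        P.root_coroot_eq_pairing, ← P.algebraMap_pairingIn ℤ, ← P.algebraMap_pairingIn ℤ, hi', hj']
      simp
    rw [← P.algebraMap_pairingIn ℤ] at h
    exact (algebraMap ℤ ℝ).injective_int (h.trans (map_zero _).symm)

variable [IsSimplyLaced P]

/-- In the simply laced case a root α + β equals σ_α(β). -/
lemma add_mem (Ψ : Subsystem P) {i j k : ι} (hi : i ∈ Ψ) (hj : j ∈ Ψ)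
    (h : P.root k = P.root i + P.root j) : k ∈ Ψ := by
  have : P.reflectionPerm i j = k := P.root.injective (by
    rw [root_reflectionPerm', pairingIn_of_add h, h]
    simp [add_comm])
  exact this ▸ Ψ.reflectionPerm_mem hi hj

end Subsystem

variable [IsSimplyLaced P]

lemma not_pairingIn_nonneg_of_add {i j k : ι} (h : P.root k = P.root i + P.root j) :
    ¬ 0 ≤ P.pairingIn ℤ i j := by
  have := pairingIn_of_add (h.trans (add_comm _ _))
  omega

lemma pairingIn_of_add_eq_zero {i j : ι} (h : P.root i + P.root j = 0) :
    P.pairingIn ℤ i j = -2 := by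
  rw [pairingIn_neg (eq_neg_of_add_eq_zero_left h), P.pairingIn_same]

lemma exists_root_add {i j : ι} (h : P.pairingIn ℤ j i = -1) :
    ∃ k, P.root k = P.root i + P.root j :=
  ⟨P.reflectionPerm i j, by rw [root_reflectionPerm', h]; simp [add_comm]⟩

/-- All roots have the same length, so the pairing behaves as an inner product with (α, α) = 2. The
value -1 makes the sum a root, which forces -1 the other way round; the value 1 is reduced to it by
a sign. -/
lemma pairingIn_symm (i j : ι) : P.pairingIn ℤ i j = P.pairingIn ℤ j i := by
  by_cases hij : i = j
  · rw [hij]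
  by_cases hn : P.root i = -P.root j
  · rw [pairingIn_neg hn, P.pairingIn_same, pairingIn_neg (i := i) (by rw [hn, neg_neg]),
      P.pairingIn_same]
  have hn' : P.root j ≠ -P.root i := fun h => hn (by rw [h, neg_neg])
  have key (a b : ι) (hab : a ≠ b) (hn : P.root b ≠ -P.root a) (h : P.pairingIn ℤ a b = -1) :
      P.pairingIn ℤ b a = -1 := by
    obtain ⟨k, hk⟩ := exists_root_add h
    exact pairingIn_of_add (hk.trans (add_comm _ _))
  have key' (a b : ι) (hab : a ≠ b) (hn : P.root a ≠ -P.root b) (h : P.pairingIn ℤ a b = 1) :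
      P.pairingIn ℤ b a = 1 := by
    have h1 := key (P.reflectionPerm a a) b (fun h0 => hn (by rw [← h0, root_neg, neg_neg]))
      (fun h0 => hab (P.root.injective (by rw [h0, root_neg, neg_neg])))
      (by rw [pairingIn_neg (root_neg a), h])
    rw [pairingIn_neg_right (root_neg a)] at h1
    omega
  have hn'' : P.root j ≠ -P.root i := hn'
  rcases IsSimplyLaced.pairingIn_mem (P := P) i j hij hn with h | h | h
  · rw [h, key i j hij hn' h]
  · rcases IsSimplyLaced.pairingIn_mem (P := P) j i (Ne.symm hij) hn' with h' | h' | h'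
    · have := key j i (Ne.symm hij) hn h'; omega
    · omega
    · have := key' j i (Ne.symm hij) hn' h'; omega
  · rw [h, key' i j hij hn h]

lemma coroot'_root (i j : ι) : P.coroot' j (P.root i) = (P.pairingIn ℤ i j : ℝ) := by
  rw [P.root_coroot'_eq_pairing, ← P.algebraMap_pairingIn ℤ]; rfl

lemma eq_or_neg_of_pairingIn {i j : ι} (h : P.pairingIn ℤ i j < -1 ∨ 1 < P.pairingIn ℤ i j) :
    i = j ∨ P.root i = -P.root j := by
  by_contra! hc
  have := IsSimplyLaced.pairingIn_mem (P := P) i j hc.1 hc.2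
  omega

lemma Subsystem.mem_of_eq_or_neg (Ψ : Subsystem P) {i j : ι} (hj : j ∈ Ψ)
    (h : i = j ∨ P.root i = -P.root j) : i ∈ Ψ := by
  rcases h with rfl | h
  · exact hj
  · exact eq_neg_index h ▸ Ψ.neg_mem hj

lemma Subsystem.pairingIn_bound (Ψ : Subsystem P) {i j : ι} (hi : i ∉ Ψ) (hj : j ∈ Ψ) :
    -1 ≤ P.pairingIn ℤ i j ∧ P.pairingIn ℤ i j ≤ 1 := by
  by_contra hc
  exact hi (Ψ.mem_of_eq_or_neg hj (eq_or_neg_of_pairingIn (by omega)))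

lemma Subsystem.mem_of_neg_mem (Ψ : Subsystem P) {i : ι} (h : P.reflectionPerm i i ∈ Ψ) : i ∈ Ψ :=
  Ψ.mem_of_eq_or_neg h (Or.inr (by rw [root_neg, neg_neg]))

/-- A basis of simple roots for a subsystem of type `A₃`. -/
structure IsAThree (Ψ : Subsystem P) (a b c : ι) : Prop where
  ab : P.pairingIn ℤ a b = -1
  bc : P.pairingIn ℤ b c = -1
  ac : P.pairingIn ℤ a c = 0
  ha : a ∈ Ψ
  hb : b ∈ Ψ
  hc : c ∈ Ψ
  le : ∀ Ψ' : Subsystem P, a ∈ Ψ' → b ∈ Ψ' → c ∈ Ψ' → Ψ ≤ Ψ'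

lemma isOfType_A_three_iff {Ψ : Subsystem P} :
    Ψ.IsOfType (CartanMatrix.A 3) ↔ ∃ a b c, IsAThree Ψ a b c := by
  constructor
  · rintro ⟨b, h1, h2, h3⟩
    refine ⟨b 0, b 1, b 2, ⟨h1 0 1, h1 1 2, h1 0 2, h2 0, h2 1, h2 2, fun Ψ' p q r => h3 Ψ' ?_⟩⟩
    intro i; fin_cases i <;> assumption
  · rintro ⟨a, b, c, h⟩
    refine ⟨![a, b, c], ?_, ?_, fun Ψ' h' => h.le Ψ' (h' 0) (h' 1) (h' 2)⟩
    · intro i j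
      fin_cases i <;> fin_cases j <;>
        simp [CartanMatrix.A, h.ab, h.bc, h.ac, pairingIn_symm b a, pairingIn_symm c b,
          pairingIn_symm c a]
    · intro i; fin_cases i
      exacts [h.ha, h.hb, h.hc]

lemma isAThree_closure {a b c : ι} (ab : P.pairingIn ℤ a b = -1) (bc : P.pairingIn ℤ b c = -1)
    (ac : P.pairingIn ℤ a c = 0) : IsAThree (Subsystem.closure P {a, b, c}) a b c where
  ab := ab
  bc := bc
  ac := ac
  ha := Subsystem.subset_closure _ (by simp)
  hb := Subsystem.subset_closure _ (by simp)
  hc := Subsystem.subset_closure _ (by simp)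
  le Ψ' ha hb hc := Subsystem.closure_le (by
    rintro i (rfl | rfl | rfl) <;> assumption)

/-- The subsystem `{±α}`. -/
def pair (P : RootPairing ι ℝ M V) (a : ι) : Subsystem P := Subsystem.closure P {a}

lemma mem_pair (a : ι) : a ∈ pair P a := Subsystem.subset_closure _ rfl

lemma pair_le {Ψ : Subsystem P} {a : ι} (h : a ∈ Ψ) : pair P a ≤ Ψ :=
  Subsystem.closure_le (by rintro _ rfl; exact h)

lemma mem_pair_iff {a i : ι} : i ∈ pair P a ↔ i = a ∨ P.root i = -P.root a := by
  refine ⟨fun h => ?_, fun h => Subsystem.mem_of_eq_or_neg _ (mem_pair a) h⟩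
  let Ψ : Subsystem P := ⟨{i | i = a ∨ P.root i = -P.root a}, by
    rintro i hi j hj
    have h1 : P.root (P.reflectionPerm i j) = - P.root j := by
      rw [root_reflectionPerm']
      rcases hi with rfl | hi <;> rcases hj with rfl | hj
      · simp [two_smul]
      · rw [pairingIn_neg hj, hj]; simp [two_smul]
      · rw [pairingIn_neg_right hi, hi]; simp [two_smul]
      · rw [pairingIn_neg_right hi, pairingIn_neg hj, hi, hj]; simp [two_smul]
    rcases hj with rfl | hj
    · exact Or.inr h1
    · exact Or.inl (P.root.injective (by rw [h1, hj, neg_neg]))⟩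
  exact pair_le (Ψ := Ψ) (Or.inl rfl) h

lemma pair_isOfType (a : ι) : (pair P a).IsOfType (CartanMatrix.A 1) := by
  refine ⟨fun _ => a, fun i j => ?_, fun _ => mem_pair a, fun Ψ' h => pair_le (h 0)⟩
  rw [P.pairingIn_same, Subsingleton.elim i j]
  simp [CartanMatrix.A]

/-- A set `U` of roots which is an abelian unipotent radical normalized by `Ψ`. -/
structure IsRadical (Ψ : Subsystem P) (U : Set ι) : Prop where
  add_ne_zero : ∀ {β γ}, β ∈ Ψ → γ ∈ U → P.root β + P.root γ ≠ 0
  add_mem : ∀ {β γ δ}, β ∈ Ψ → γ ∈ U → P.root δ = P.root β + P.root γ → δ ∈ U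
  pairingIn_nonneg : ∀ {γ γ'}, γ ∈ U → γ' ∈ U → 0 ≤ P.pairingIn ℤ γ γ'

lemma IsRadical.mono {Ψ Ψ' : Subsystem P} {U : Set ι} (h : IsRadical Ψ' U) (hΨ : Ψ ≤ Ψ') :
    IsRadical Ψ U where
  add_ne_zero hβ hγ := h.add_ne_zero (hΨ hβ) hγ
  add_mem hβ hγ := h.add_mem (hΨ hβ) hγ
  pairingIn_nonneg := h.pairingIn_nonneg

/-- The roots congruent to `α` modulo the span of `Ψ`. -/
def radical (Ψ : Subsystem P) (α : ι) : Set ι :=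
  {γ | P.root γ - P.root α ∈ Submodule.span ℝ (P.root '' (Ψ : Set ι))}

lemma self_mem_radical (Ψ : Subsystem P) (α : ι) : α ∈ radical Ψ α := by
  change _ ∈ Submodule.span _ _
  rw [sub_self]; exact Submodule.zero_mem _

/-- Stability under Ψ is automatic for a coset of the span; only the sign of the pairings needs an
argument specific to Ψ. -/
lemma isRadical_of_notMem_span {Ψ : Subsystem P} {α : ι}
    (h : P.root α ∉ Submodule.span ℝ (P.root '' (Ψ : Set ι)))
    (h' : ∀ {γ γ'}, γ ∈ radical Ψ α → γ' ∈ radical Ψ α → 0 ≤ P.pairingIn ℤ γ γ') :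
    IsRadical Ψ (radical Ψ α) where
  add_ne_zero {β γ} hβ hγ h0 := h (by
    have h1 : P.root β ∈ Submodule.span ℝ (P.root '' (Ψ : Set ι)) :=
      Submodule.subset_span ⟨β, hβ, rfl⟩
    have h2 : P.root α = -(P.root γ - P.root α) - P.root β := by
      rw [eq_neg_of_add_eq_zero_left h0]; abel
    rw [h2]
    exact Submodule.sub_mem _ (Submodule.neg_mem _ hγ) h1)
  add_mem {β γ δ} hβ hγ hδ := by
    change _ ∈ Submodule.span _ _
    rw [hδ, add_sub_assoc]
    exact Submodule.add_mem _ (Submodule.subset_span ⟨β, hβ, rfl⟩) hγ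
  pairingIn_nonneg := h'

lemma pairingIn_add_right {i j k : ι} (h : P.root k = P.root i + P.root j) (l : ι) :
    P.pairingIn ℤ l k = P.pairingIn ℤ l i + P.pairingIn ℤ l j := by
  rw [pairingIn_symm, pairingIn_add h, pairingIn_symm i, pairingIn_symm j]

/-- The norm of the projection of a root to the span of an `A₃` is at most one. -/
lemma IsAThree.quadratic_le {Ψ : Subsystem P} {a b c : ι} (h : IsAThree Ψ a b c) {γ : ι}
    (hγ : γ ∉ Ψ) {x y z : ℤ} (hx : P.pairingIn ℤ γ a = x) (hy : P.pairingIn ℤ γ b = y)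
    (hz : P.pairingIn ℤ γ c = z) :
    3 * x ^ 2 + 4 * y ^ 2 + 3 * z ^ 2 + 4 * x * y + 2 * x * z + 4 * y * z ≤ 4 := by
  -- The form is 4 vᵀC⁻¹v with C the Cartan matrix of A₃, that is, four times the squared length of
  -- the projection. The bound is a finite check, given that the pairings with all positive roots a,
  -- b, c, a+b, b+c, a+b+c lie in [-1, 1].
  obtain ⟨d, hd⟩ := exists_root_add (P := P) (i := a) (j := b) ((pairingIn_symm _ _).trans h.ab)
  obtain ⟨e, he⟩ := exists_root_add (P := P) (i := b) (j := c) ((pairingIn_symm _ _).trans h.bc)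
  obtain ⟨f, hf⟩ := exists_root_add (P := P) (i := d) (j := c) (by
    rw [pairingIn_symm, pairingIn_add hd, h.ac, h.bc]; rfl)
  have hdm := Ψ.add_mem h.ha h.hb hd
  have b1 := Ψ.pairingIn_bound hγ h.ha
  have b2 := Ψ.pairingIn_bound hγ h.hb
  have b3 := Ψ.pairingIn_bound hγ h.hc
  have b4 := Ψ.pairingIn_bound hγ hdm
  have b5 := Ψ.pairingIn_bound hγ (Ψ.add_mem h.hb h.hc he)
  have b6 := Ψ.pairingIn_bound hγ (Ψ.add_mem hdm h.hc hf)
  rw [pairingIn_add_right hf] at b6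
  rw [pairingIn_add_right hd] at b4 b6
  rw [pairingIn_add_right he] at b5
  rw [hx] at b1 b4 b6
  rw [hy] at b2 b4 b5 b6
  rw [hz] at b3 b5 b6
  have hx' : x = -1 ∨ x = 0 ∨ x = 1 := by omega
  have hy' : y = -1 ∨ y = 0 ∨ y = 1 := by omega
  have hz' : z = -1 ∨ z = 0 ∨ z = 1 := by omega
  rcases hx' with rfl | rfl | rfl <;> rcases hy' with rfl | rfl | rfl <;>
    rcases hz' with rfl | rfl | rfl <;> omega

lemma IsAThree.span_eq {Ψ : Subsystem P} {a b c : ι} (h : IsAThree Ψ a b c) :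
    Submodule.span ℝ (P.root '' (Ψ : Set ι)) =
      Submodule.span ℝ {P.root a, P.root b, P.root c} := by
  apply le_antisymm
  · rw [Submodule.span_le]
    rintro _ ⟨i, hi, rfl⟩
    have key (j : ι) (hj : P.root j ∈ ({P.root a, P.root b, P.root c} : Set M)) :
        j ∈ Subsystem.ofSubmodule P (Submodule.span ℝ {P.root a, P.root b, P.root c}) :=
      Submodule.subset_span hj
    exact h.le _ (key a (by simp)) (key b (by simp)) (key c (by simp)) hi
  · rw [Submodule.span_le]
    rintro _ (rfl | rfl | rfl)
    exacts [Submodule.subset_span ⟨a, h.ha, rfl⟩, Submodule.subset_span ⟨b, h.hb, rfl⟩,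
      Submodule.subset_span ⟨c, h.hc, rfl⟩]

lemma IsAThree.exists_coeff {Ψ : Subsystem P} {a b c : ι} (h : IsAThree Ψ a b c) {v : M}
    (hv : v ∈ Submodule.span ℝ (P.root '' (Ψ : Set ι))) :
    ∃ s t u : ℝ, (∀ i, P.coroot' i v = s * P.pairingIn ℤ i a + t * P.pairingIn ℤ i b +
      u * P.pairingIn ℤ i c) ∧ P.coroot' a v = 2 * s - t ∧ P.coroot' b v = -s + 2 * t - u ∧
      P.coroot' c v = -t + 2 * u := by
  rw [h.span_eq, Submodule.mem_span_triple] at hv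
  obtain ⟨s, t, u, rfl⟩ := hv
  have key (i : ι) : P.coroot' i (s • P.root a + t • P.root b + u • P.root c) =
      s * P.pairingIn ℤ i a + t * P.pairingIn ℤ i b + u * P.pairingIn ℤ i c := by
    rw [map_add, map_add, map_smul, map_smul, map_smul, coroot'_root, coroot'_root, coroot'_root,
      pairingIn_symm a, pairingIn_symm b, pairingIn_symm c]; rfl
  refine ⟨s, t, u, key, ?_, ?_, ?_⟩ <;> rw [key] <;>
    simp only [P.pairingIn_same, h.ab, h.bc, h.ac, pairingIn_symm b a, pairingIn_symm c b,
      pairingIn_symm c a] <;> push_cast <;> ring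

/-- A root in the span is its own projection, of squared length 2, while a root outside Ψ projects
to squared length at most 1. -/
lemma IsAThree.mem_of_mem_span {Ψ : Subsystem P} {a b c : ι} (h : IsAThree Ψ a b c) {γ : ι}
    (hγ : P.root γ ∈ Submodule.span ℝ (P.root '' (Ψ : Set ι))) : γ ∈ Ψ := by
  by_contra hn
  have hq := h.quadratic_le hn rfl rfl rfl
  obtain ⟨s, t, u, h0, h1, h2, h3⟩ := h.exists_coeff hγ
  have h4 := h0 γ
  rw [coroot'_root] at h1 h2 h3 h4
  rw [P.pairingIn_same] at h4
  rify at hq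
  rw [h1, h2, h3] at hq h4
  push_cast at h4
  nlinarith

/-- Two roots of the coset have the same component orthogonal to the span, so ⟨γ, γ'⟩ = 2 - |p -
p'|²/2 for their projections p, p'. As |p|², |p'|² ≤ 1, the parallelogram law gives |p - p'|² ≤ 4.
-/
lemma IsAThree.isRadical {Ψ : Subsystem P} {a b c : ι} (h : IsAThree Ψ a b c) {α : ι}
    (hα : α ∉ Ψ) : IsRadical Ψ (radical Ψ α) := by
  have hs (γ : ι) (hγ : γ ∈ radical Ψ α) : γ ∉ Ψ := by
    intro hm
    refine hα (h.mem_of_mem_span ?_)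
    have h1 : P.root α = P.root γ - (P.root γ - P.root α) := by abel
    rw [h1]
    exact Submodule.sub_mem _ (Submodule.subset_span ⟨γ, hm, rfl⟩) hγ
  refine isRadical_of_notMem_span (fun hα' => hα (h.mem_of_mem_span hα'))
    fun {γ γ'} hγ hγ' => ?_
  have q1 := h.quadratic_le (hs γ hγ) rfl rfl rfl
  have q2 := h.quadratic_le (hs γ' hγ') rfl rfl rfl
  have hv : P.root γ - P.root γ' ∈ Submodule.span ℝ (P.root '' (Ψ : Set ι)) := by
    have h1 : P.root γ - P.root γ' = (P.root γ - P.root α) - (P.root γ' - P.root α) := by abel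
    rw [h1]
    exact Submodule.sub_mem _ hγ hγ'
  obtain ⟨s, t, u, h0, h1, h2, h3⟩ := h.exists_coeff hv
  have h4 := h0 γ
  have h5 := h0 γ'
  rw [map_sub, coroot'_root, coroot'_root] at h1 h2 h3 h4 h5
  rw [P.pairingIn_same] at h4 h5
  rw [pairingIn_symm γ' γ] at h4
  rify at q1 q2
  have h6 : (-1 : ℝ) < P.pairingIn ℤ γ γ' := by
    push_cast at h4 h5
    generalize (P.pairingIn ℤ γ a : ℝ) = x1 at *
    generalize (P.pairingIn ℤ γ b : ℝ) = x2 at *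
    generalize (P.pairingIn ℤ γ c : ℝ) = x3 at *
    generalize (P.pairingIn ℤ γ' a : ℝ) = y1 at *
    generalize (P.pairingIn ℤ γ' b : ℝ) = y2 at *
    generalize (P.pairingIn ℤ γ' c : ℝ) = y3 at *
    have e : 4 * (s * (x1 - y1) + t * (x2 - y2) + u * (x3 - y3)) =
      3 * (x1 - y1) ^ 2 + 4 * (x2 - y2) ^ 2 + 3 * (x3 - y3) ^ 2 + 4 * (x1 - y1) * (x2 - y2) +
        2 * (x1 - y1) * (x3 - y3) + 4 * (x2 - y2) * (x3 - y3) := by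
      rw [h1, h2, h3]; ring
    -- This is |p + p'|² ≥ 0, the other half of the parallelogram law.
    have pos : 0 ≤ 3 * (x1 + y1) ^ 2 + 4 * (x2 + y2) ^ 2 + 3 * (x3 + y3) ^ 2 +
        4 * (x1 + y1) * (x2 + y2) + 2 * (x1 + y1) * (x3 + y3) + 4 * (x2 + y2) * (x3 + y3) := by
      have : 3 * (x1 + y1) ^ 2 + 4 * (x2 + y2) ^ 2 + 3 * (x3 + y3) ^ 2 +
          4 * (x1 + y1) * (x2 + y2) + 2 * (x1 + y1) * (x3 + y3) + 4 * (x2 + y2) * (x3 + y3) =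
          (2 * (x2 + y2) + (x1 + y1) + (x3 + y3)) ^ 2 + 2 * (x1 + y1) ^ 2 +
          2 * (x3 + y3) ^ 2 := by ring
      rw [this]; positivity
    linarith
  have h7 : (-1 : ℤ) < P.pairingIn ℤ γ γ' := by exact_mod_cast h6
  omega

/-- The same argument as for A₃; the projections to ℝβ now have squared length at most 1/2. -/
lemma isRadical_pair {α β : ι} (h : α ∉ pair P β) :
    IsRadical (pair P β) (radical (pair P β) α) := by
  have hspan : Submodule.span ℝ (P.root '' (pair P β : Set ι)) = Submodule.span ℝ {P.root β} := by
    apply le_antisymm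
    · rw [Submodule.span_le]
      rintro _ ⟨i, hi, rfl⟩
      have key : β ∈ Subsystem.ofSubmodule P (Submodule.span ℝ {P.root β}) :=
        Submodule.subset_span (Set.mem_singleton (P.root β))
      exact pair_le key hi
    · rw [Submodule.span_le]
      rintro _ rfl
      exact Submodule.subset_span ⟨β, mem_pair β, rfl⟩
  -- Pairing γ = kβ with β and with γ itself gives k² = 1.
  have hred (γ : ι) (k : ℝ) (hγ : P.root γ = k • P.root β) : γ ∈ pair P β := by
    have h1 : P.coroot' β (P.root γ) = k * 2 := by
      rw [hγ, map_smul, coroot'_root, P.pairingIn_same]; rfl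
    have h2 : P.coroot' γ (P.root γ) = k * P.pairingIn ℤ β γ := by
      conv_lhs => rw [hγ, map_smul, coroot'_root, smul_eq_mul]
    rw [coroot'_root] at h1 h2
    rw [P.pairingIn_same, pairingIn_symm] at h2
    rw [h1] at h2
    push_cast at h2
    have h3 : (k - 1) * (k + 1) = 0 := by nlinarith
    rw [mem_pair_iff]
    rcases mul_eq_zero.mp h3 with h3 | h3
    · left; exact P.root.injective (by rw [hγ, sub_eq_zero.mp h3, one_smul])
    · right; rw [hγ, eq_neg_of_add_eq_zero_left h3, neg_smul, one_smul]
  have hb (γ : ι) (hγ : γ ∈ radical (pair P β) α) : ∃ k : ℝ, P.root γ = P.root α + k • P.root β ∧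
      γ ∉ pair P β := by
    have hγ' : P.root γ - P.root α ∈ Submodule.span ℝ {P.root β} := hspan ▸ hγ
    obtain ⟨k, hk⟩ := Submodule.mem_span_singleton.mp hγ'
    refine ⟨k, by rw [hk]; abel, fun hm => h ?_⟩
    rcases mem_pair_iff.mp hm with rfl | hm
    · exact hred α (1 - k) (by rw [sub_smul, one_smul, hk]; abel)
    · exact hred α (-1 - k) (by rw [sub_smul, neg_smul, one_smul, hk, hm]; abel)
  refine isRadical_of_notMem_span (fun h' => ?_) fun {γ γ'} hγ hγ' => ?_
  · rw [hspan] at h'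
    obtain ⟨k, hk⟩ := Submodule.mem_span_singleton.mp h'
    exact h (hred α k hk.symm)
  · obtain ⟨k, hk, hn⟩ := hb γ hγ
    obtain ⟨k', hk', hn'⟩ := hb γ' hγ'
    have h1 := coroot'_root (P := P) γ γ'
    have h2 := coroot'_root (P := P) γ β
    have h3 := coroot'_root (P := P) γ' β
    have h4 : P.root γ = P.root γ' + (k - k') • P.root β := by rw [hk, hk', sub_smul]; abel
    rw [h4, map_add, map_smul, coroot'_root, coroot'_root, P.pairingIn_same, pairingIn_symm β,
      smul_eq_mul] at h1
    rw [h4, map_add, map_smul, coroot'_root, coroot'_root, P.pairingIn_same, smul_eq_mul] at h2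
    have b1 := (pair P β).pairingIn_bound hn (mem_pair β)
    have b2 := (pair P β).pairingIn_bound hn' (mem_pair β)
    have h5 : (2 : ℝ) * P.pairingIn ℤ γ γ' = 4 + (P.pairingIn ℤ γ β - P.pairingIn ℤ γ' β) *
        P.pairingIn ℤ γ' β := by
      push_cast at h1 h2
      rw [← h1]
      linear_combination ((P.pairingIn ℤ γ' β : ℝ)) * h2
    have h6 : 2 * P.pairingIn ℤ γ γ' = 4 + (P.pairingIn ℤ γ β - P.pairingIn ℤ γ' β) *
        P.pairingIn ℤ γ' β := by exact_mod_cast h5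
    have hx : P.pairingIn ℤ γ' β = -1 ∨ P.pairingIn ℤ γ' β = 0 ∨ P.pairingIn ℤ γ' β = 1 := by omega
    rcases hx with hx | hx | hx <;> rw [hx] at h6 <;> omega

end RootCombinatorics

/-! ### Roots lying in a common A₃. -/

section RootCombinatorics

variable {ι M V : Type*} [AddCommGroup M] [Module ℝ M] [AddCommGroup V] [Module ℝ V]
    {P : RootPairing ι ℝ M V} [P.IsCrystallographic] [IsSimplyLaced P]

lemma pairingIn_of_notMem_pair {i j : ι} (h : i ∉ pair P j) (h0 : P.pairingIn ℤ i j ≠ 0) :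
    P.pairingIn ℤ i j = -1 ∨ P.pairingIn ℤ i j = 1 := by
  have := (pair P j).pairingIn_bound h (mem_pair j)
  omega

/-- A path of three roots generates an `A₃`. -/
lemma exists_isAThree_of_path {a b c : ι} (ab : P.pairingIn ℤ a b = -1 ∨ P.pairingIn ℤ a b = 1)
    (bc : P.pairingIn ℤ b c = -1 ∨ P.pairingIn ℤ b c = 1) (ac : P.pairingIn ℤ a c = 0) :
    ∃ Ψ : Subsystem P, Ψ.IsOfType (CartanMatrix.A 3) ∧ a ∈ Ψ ∧ b ∈ Ψ ∧ c ∈ Ψ := by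
  -- A subsystem contains a root as soon as it contains its negative, so the signs of the end roots
  -- may be changed to make both edges -1.
  obtain ⟨a', ha', hab, hac⟩ : ∃ a', (∀ Ψ : Subsystem P, a' ∈ Ψ → a ∈ Ψ) ∧
      P.pairingIn ℤ a' b = -1 ∧ P.pairingIn ℤ a' c = 0 := by
    rcases ab with ab | ab
    · exact ⟨a, fun _ h => h, ab, ac⟩
    · exact ⟨P.reflectionPerm a a, fun Ψ h => Ψ.mem_of_neg_mem h,
        by rw [pairingIn_neg (root_neg a), ab], by rw [pairingIn_neg (root_neg a), ac]; rfl⟩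
  obtain ⟨c', hc', hbc, hac⟩ : ∃ c', (∀ Ψ : Subsystem P, c' ∈ Ψ → c ∈ Ψ) ∧
      P.pairingIn ℤ b c' = -1 ∧ P.pairingIn ℤ a' c' = 0 := by
    rcases bc with bc | bc
    · exact ⟨c, fun _ h => h, bc, hac⟩
    · exact ⟨P.reflectionPerm c c, fun Ψ h => Ψ.mem_of_neg_mem h,
        by rw [pairingIn_neg_right (root_neg c), bc],
        by rw [pairingIn_neg_right (root_neg c), hac]; rfl⟩
  have h := isAThree_closure hab hbc hac
  exact ⟨_, isOfType_A_three_iff.mpr ⟨_, _, _, h⟩, ha' _ h.ha, h.hb, hc' _ h.hc⟩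

/-- Three connected roots generate an `A₃` unless they are dependent. -/
lemma exists_isAThree_of_connected {a b c : ι}
    (ab : P.pairingIn ℤ a b = -1 ∨ P.pairingIn ℤ a b = 1)
    (bc : P.pairingIn ℤ b c = -1 ∨ P.pairingIn ℤ b c = 1) :
    (∃ Ψ : Subsystem P, Ψ.IsOfType (CartanMatrix.A 3) ∧ a ∈ Ψ ∧ b ∈ Ψ ∧ c ∈ Ψ) ∨
      ∀ Ψ : Subsystem P, a ∈ Ψ → b ∈ Ψ → c ∈ Ψ := by
  by_cases hac : P.pairingIn ℤ a c = 0
  · exact Or.inl (exists_isAThree_of_path ab bc hac)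
  by_cases hmem : a ∈ pair P c
  · right
    intro Ψ ha _
    refine Ψ.mem_of_eq_or_neg ha ?_
    rcases mem_pair_iff.mp hmem with rfl | h
    · exact Or.inl rfl
    · exact Or.inr (by rw [h, neg_neg])
  have hac := pairingIn_of_notMem_pair hmem hac
  obtain ⟨a', ha', ha'', hab, hac⟩ : ∃ a', (∀ Ψ : Subsystem P, a' ∈ Ψ → a ∈ Ψ) ∧
      (∀ Ψ : Subsystem P, a ∈ Ψ → a' ∈ Ψ) ∧
      P.pairingIn ℤ a' b = -1 ∧ (P.pairingIn ℤ a' c = -1 ∨ P.pairingIn ℤ a' c = 1) := by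
    rcases ab with ab | ab
    · exact ⟨a, fun _ h => h, fun _ h => h, ab, hac⟩
    · refine ⟨P.reflectionPerm a a, fun Ψ h => Ψ.mem_of_neg_mem h, fun Ψ h => Ψ.neg_mem h,
        by rw [pairingIn_neg (root_neg a), ab], ?_⟩
      rw [pairingIn_neg (root_neg a)]; omega
  -- The root d = b + a' pairs with c to 0 or ±2. In the first case d, b, c is a path; in the second
  -- c = ±d.
  obtain ⟨d, hd⟩ := exists_root_add (P := P) (i := b) (j := a') hab
  have h1 : P.pairingIn ℤ d c = P.pairingIn ℤ b c + P.pairingIn ℤ a' c := pairingIn_add hd c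
  have hda : P.pairingIn ℤ b a' = -1 := (pairingIn_symm _ _).trans hab
  by_cases hz : P.pairingIn ℤ d c = 0
  · left
    obtain ⟨Ψ, h2, h3, h4, h5⟩ := exists_isAThree_of_path (a := d) (b := b) (c := c)
      (Or.inr (by rw [pairingIn_add hd, P.pairingIn_same, hab]; rfl)) bc hz
    refine ⟨Ψ, h2, ha' Ψ ?_, h4, h5⟩
    exact Ψ.add_mem (i := P.reflectionPerm b b) (Ψ.neg_mem h4) h3 (by rw [hd, root_neg]; abel)
  · right
    intro Ψ ha hb
    have hdm := Ψ.add_mem hb (ha'' Ψ ha) hd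
    refine Ψ.mem_of_eq_or_neg hdm ?_
    rcases eq_or_neg_of_pairingIn (P := P) (i := d) (j := c) (by omega) with h | h
    · exact Or.inl h.symm
    · exact Or.inr (by rw [h, neg_neg])

lemma isOrthogonal_of_pairingIn {i j : ι} (h : P.pairingIn ℤ i j = 0) : P.IsOrthogonal i j := by
  have h' := (pairingIn_symm j i).trans h
  constructor
  · rw [← P.algebraMap_pairingIn ℤ, h, map_zero]
  · rw [← P.algebraMap_pairingIn ℤ, h', map_zero]

variable [P.IsRootSystem] [P.IsIrreducible]

/-- By irreducibility, a nonempty set of roots orthogonal to all roots outside its span must span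
everything. -/
lemma exists_notMem_span_pairingIn_ne_zero (s : Set ι) (hs : s.Nonempty)
    (h : Submodule.span ℝ (P.root '' s) ≠ ⊤) :
    ∃ j, P.root j ∉ Submodule.span ℝ (P.root '' s) ∧ ∃ i ∈ s, P.pairingIn ℤ j i ≠ 0 := by
  by_contra! hc
  exact h (P.span_root_image_eq_top_of_forall_orthogonal s hs fun j hj i hi =>
    isOrthogonal_of_pairingIn (hc j hj i hi))

/-- Two orthogonal roots have a common neighbour. -/
lemma exists_common_neighbour (a b : ι) :
    ∃ c, P.pairingIn ℤ c a ≠ 0 ∧ P.pairingIn ℤ c b ≠ 0 := by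
  by_contra! hc
  -- The span of the neighbours of a is stable under every reflection σ_i: if i is orthogonal to a,
  -- then σ_i preserves the neighbours; if not, i is itself one of them. By irreducibility it is
  -- everything. If no neighbour of a were a neighbour of b, the coroot of b would vanish on it, and
  -- so on b.
  have htop : Submodule.span ℝ (P.root '' {c | P.pairingIn ℤ c a ≠ 0}) = ⊤ := by
    refine RootPairing.IsIrreducible.eq_top_of_invtSubmodule_reflection (P := P) _ ?_ ?_
    · intro i
      rw [Module.End.mem_invtSubmodule, Submodule.span_le]
      rintro _ ⟨c, hca, rfl⟩
      change P.reflection i (P.root c) ∈ Submodule.span _ _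
      rw [← P.root_reflectionPerm]
      by_cases hi : P.pairingIn ℤ i a = 0
      · refine Submodule.subset_span ⟨_, ?_, rfl⟩
        change P.pairingIn ℤ _ a ≠ 0
        intro h0
        have h1 := coroot'_root (P := P) (P.reflectionPerm i c) a
        rw [root_reflectionPerm', map_sub, map_smul, coroot'_root, coroot'_root, hi, h0] at h1
        simp at h1
        exact hca h1
      · rw [root_reflectionPerm']
        exact Submodule.sub_mem _ (Submodule.subset_span ⟨c, hca, rfl⟩)
          (Submodule.smul_mem _ _ (Submodule.subset_span ⟨i, hi, rfl⟩))
    · intro h0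
      have h1 : P.root a ∈ Submodule.span ℝ (P.root '' {c | P.pairingIn ℤ c a ≠ 0}) :=
        Submodule.subset_span ⟨a, by simp, rfl⟩
      rw [h0, Submodule.mem_bot] at h1
      exact P.ne_zero a h1
  have h1 : Submodule.span ℝ (P.root '' {c | P.pairingIn ℤ c a ≠ 0}) ≤
      LinearMap.ker (P.coroot' b) := by
    rw [Submodule.span_le]
    rintro _ ⟨c, hca, rfl⟩
    change P.coroot' b (P.root c) = 0
    rw [coroot'_root, hc c hca, Int.cast_zero]
  have h2 : P.root b ∈ LinearMap.ker (P.coroot' b) := h1 (htop ▸ Submodule.mem_top)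
  rw [LinearMap.mem_ker, coroot'_root, P.pairingIn_same] at h2
  norm_num at h2

variable (hr : 3 ≤ Module.finrank ℝ M)
include hr

/-- As the rank is at least 3, some root outside the plane of a and b is not orthogonal to one of
them. The three roots are connected, and independence rules out the degenerate alternative. -/
lemma exists_isAThree_of_pairingIn_ne {a b : ι}
    (ab : P.pairingIn ℤ a b = -1 ∨ P.pairingIn ℤ a b = 1) :
    ∃ Ψ : Subsystem P, Ψ.IsOfType (CartanMatrix.A 3) ∧ a ∈ Ψ ∧ b ∈ Ψ := by
  classical
  obtain ⟨c, hc, i, hi, hci⟩ := exists_notMem_span_pairingIn_ne_zero (P := P) {a, b} (by simp)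
    (fun h => by
      have h1 : Module.finrank ℝ (Submodule.span ℝ (P.root '' {a, b})) ≤ 2 := by
        have h3 := finrank_span_finset_le_card (R := ℝ) (M := M) (Finset.image P.root {a, b})
        rw [Finset.coe_image, Finset.coe_pair] at h3
        exact h3.trans (Finset.card_image_le.trans Finset.card_le_two)
      rw [h, finrank_top] at h1
      omega)
  have hmem (j : ι) (hj : j ∈ ({a, b} : Set ι)) : c ∉ pair P j := by
    intro h
    have h2 : P.root j ∈ Submodule.span ℝ (P.root '' {a, b}) := Submodule.subset_span ⟨j, hj, rfl⟩
    rcases mem_pair_iff.mp h with rfl | h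
    · exact hc h2
    · exact hc (h ▸ Submodule.neg_mem _ h2)
  have hspan : ¬ ∀ Ψ : Subsystem P, a ∈ Ψ → b ∈ Ψ → c ∈ Ψ := fun h => by
    have key (j : ι) (hj : j ∈ ({a, b} : Set ι)) :
        j ∈ Subsystem.ofSubmodule P (Submodule.span ℝ (P.root '' {a, b})) :=
      Submodule.subset_span ⟨j, hj, rfl⟩
    exact hc (h _ (key a (by simp)) (key b (by simp)))
  have hci' := pairingIn_of_notMem_pair (hmem i hi) hci
  rw [pairingIn_symm] at hci'
  rcases hi with rfl | rfl
  · obtain ⟨Ψ, h1, h2, h3, -⟩ := (exists_isAThree_of_connected (a := b) (b := i) (c := c)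
      (by rwa [pairingIn_symm]) hci').resolve_right (fun h => hspan fun Ψ h1 h2 => h Ψ h2 h1)
    exact ⟨Ψ, h1, h3, h2⟩
  · obtain ⟨Ψ, h1, h2, h3, -⟩ := (exists_isAThree_of_connected (c := c) ab hci').resolve_right hspan
    exact ⟨Ψ, h1, h2, h3⟩

/-- Any two roots lie in a common subsystem of type `A₃`. -/
lemma exists_isAThree_pair (a b : ι) :
    ∃ Ψ : Subsystem P, Ψ.IsOfType (CartanMatrix.A 3) ∧ a ∈ Ψ ∧ b ∈ Ψ := by
  by_cases hab : a ∈ pair P b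
  · obtain ⟨c, hc, i, hi, hci⟩ := exists_notMem_span_pairingIn_ne_zero (P := P) {b} (by simp)
      (fun h => by
        have h1 := finrank_span_le_card (R := ℝ) {P.root b}
        rw [Set.image_singleton] at h
        rw [h, finrank_top] at h1
        simp at h1
        omega)
    rw [Set.mem_singleton_iff] at hi
    subst hi
    have h1 : c ∉ pair P i := fun h => by
      have h2 : P.root i ∈ Submodule.span ℝ (P.root '' {i}) := Submodule.subset_span ⟨i, rfl, rfl⟩
      rcases mem_pair_iff.mp h with rfl | h
      · exact hc h2
      · exact hc (h ▸ Submodule.neg_mem _ h2)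
    obtain ⟨Ψ, h2, -, h3⟩ := exists_isAThree_of_pairingIn_ne hr (pairingIn_of_notMem_pair h1 hci)
    exact ⟨Ψ, h2, Ψ.mem_of_eq_or_neg h3 (mem_pair_iff.mp hab), h3⟩
  by_cases h0 : P.pairingIn ℤ a b = 0
  · obtain ⟨c, hca, hcb⟩ := exists_common_neighbour (P := P) a b
    have h1 : c ∉ pair P a := fun h => by
      rcases mem_pair_iff.mp h with rfl | h
      · exact hcb h0
      · rw [pairingIn_neg h, h0] at hcb; exact hcb rfl
    have h2 : c ∉ pair P b := fun h => by
      rw [pairingIn_symm] at h0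
      rcases mem_pair_iff.mp h with rfl | h
      · exact hca h0
      · rw [pairingIn_neg h, h0] at hca; exact hca rfl
    have h3 := pairingIn_of_notMem_pair h1 hca
    rw [pairingIn_symm] at h3
    obtain ⟨Ψ, h4, h5, -, h6⟩ :=
      exists_isAThree_of_path h3 (pairingIn_of_notMem_pair h2 hcb) h0
    exact ⟨Ψ, h4, h5, h6⟩
  · exact exists_isAThree_of_pairingIn_ne hr (pairingIn_of_notMem_pair hab h0)

/-- Three roots lie in a common `A₃`, or enough of them are orthogonal. -/
lemma exists_isAThree_triple (a b c : ι) :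
    (∃ Ψ : Subsystem P, Ψ.IsOfType (CartanMatrix.A 3) ∧ a ∈ Ψ ∧ b ∈ Ψ ∧ c ∈ Ψ) ∨
      (P.pairingIn ℤ c a = 0 ∧ P.pairingIn ℤ c b = 0) ∨
      (P.pairingIn ℤ a b = 0 ∧ (P.pairingIn ℤ c a = 0 ∨ P.pairingIn ℤ c b = 0)) := by
  have key (x y z : ι) (h : x ∈ pair P y) :
      ∃ Ψ : Subsystem P, Ψ.IsOfType (CartanMatrix.A 3) ∧ x ∈ Ψ ∧ y ∈ Ψ ∧ z ∈ Ψ := by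
    obtain ⟨Ψ, h1, h2, h3⟩ := exists_isAThree_pair (P := P) hr y z
    exact ⟨Ψ, h1, pair_le h2 h, h2, h3⟩
  have key' (x y z : ι) (xy : P.pairingIn ℤ x y = -1 ∨ P.pairingIn ℤ x y = 1)
      (yz : P.pairingIn ℤ y z = -1 ∨ P.pairingIn ℤ y z = 1) :
      ∃ Ψ : Subsystem P, Ψ.IsOfType (CartanMatrix.A 3) ∧ x ∈ Ψ ∧ y ∈ Ψ ∧ z ∈ Ψ := by
    rcases exists_isAThree_of_connected xy yz with h | h
    · exact h
    · obtain ⟨Ψ, h1, h2, h3⟩ := exists_isAThree_pair (P := P) hr x y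
      exact ⟨Ψ, h1, h2, h3, h Ψ h2 h3⟩
  by_cases h1 : a ∈ pair P b
  · exact Or.inl (key a b c h1)
  by_cases h2 : c ∈ pair P a
  · obtain ⟨Ψ, p, q, r, s⟩ := key c a b h2
    exact Or.inl ⟨Ψ, p, r, s, q⟩
  by_cases h3 : c ∈ pair P b
  · obtain ⟨Ψ, p, q, r, s⟩ := key c b a h3
    exact Or.inl ⟨Ψ, p, s, r, q⟩
  -- No two of the roots now agree up to sign. If their non-orthogonality graph is connected they
  -- lie in an A₃; if not, at least two of its three edges are missing.
  have e1 := pairingIn_of_notMem_pair h1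
  have e2 := pairingIn_of_notMem_pair h2
  have e3 := pairingIn_of_notMem_pair h3
  by_cases z1 : P.pairingIn ℤ a b = 0
  · by_cases z2 : P.pairingIn ℤ c a = 0
    · exact Or.inr (Or.inr ⟨z1, Or.inl z2⟩)
    by_cases z3 : P.pairingIn ℤ c b = 0
    · exact Or.inr (Or.inr ⟨z1, Or.inr z3⟩)
    obtain ⟨Ψ, p, q, r, s⟩ := key' a c b (by rw [pairingIn_symm]; exact e2 z2) (e3 z3)
    exact Or.inl ⟨Ψ, p, q, s, r⟩
  · by_cases z2 : P.pairingIn ℤ c a = 0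
    · by_cases z3 : P.pairingIn ℤ c b = 0
      · exact Or.inr (Or.inl ⟨z2, z3⟩)
      · obtain ⟨Ψ, p, q, r, s⟩ := key' a b c (e1 z1) (by rw [pairingIn_symm]; exact e3 z3)
        exact Or.inl ⟨Ψ, p, q, r, s⟩
    · obtain ⟨Ψ, p, q, r, s⟩ := key' c a b (e2 z2) (e1 z1)
      exact Or.inl ⟨Ψ, p, r, s, q⟩

end RootCombinatorics

/-! ### Extending an A₃ to an A₄ in type E. -/

section RootCombinatorics

variable {ι M V : Type*} [AddCommGroup M] [Module ℝ M] [AddCommGroup V] [Module ℝ V]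
    {P : RootPairing ι ℝ M V} [P.IsCrystallographic] [IsSimplyLaced P]

lemma IsAThree.exists_isOfType_A_four_of_pairingIn {Ψ : Subsystem P} {a b c d : ι}
    (h : IsAThree Ψ a b c) (ha : P.pairingIn ℤ d a = 0) (hb : P.pairingIn ℤ d b = 0)
    (hc : P.pairingIn ℤ d c = -1) :
    ∃ Ψ' : Subsystem P, Ψ'.IsOfType (CartanMatrix.A 4) ∧ Ψ ≤ Ψ' := by
  refine ⟨Subsystem.closure P {a, b, c, d}, ⟨![a, b, c, d], ?_, ?_, fun Ψ' h' => ?_⟩, ?_⟩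
  · intro i j
    fin_cases i <;> fin_cases j <;>
      simp [CartanMatrix.A, h.ab, h.bc, h.ac, pairingIn_symm b a, pairingIn_symm c b,
        pairingIn_symm c a, ha, hb, hc, pairingIn_symm a d, pairingIn_symm b d, pairingIn_symm c d]
  · intro i
    apply Subsystem.subset_closure
    fin_cases i <;> simp
  · refine Subsystem.closure_le ?_
    rintro i (rfl | rfl | rfl | rfl)
    exacts [h' 0, h' 1, h' 2, h' 3]
  · exact h.le _ (Subsystem.subset_closure _ (by simp)) (Subsystem.subset_closure _ (by simp))
      (Subsystem.subset_closure _ (by simp))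

lemma pairingIn_reflectionPerm_left (i j k : ι) : P.pairingIn ℤ (P.reflectionPerm i j) k =
    P.pairingIn ℤ j k - P.pairingIn ℤ j i * P.pairingIn ℤ i k := by
  have h := coroot'_root (P := P) (P.reflectionPerm i j) k
  rw [root_reflectionPerm', map_sub, map_smul, coroot'_root, coroot'_root, smul_eq_mul] at h
  exact_mod_cast h.symm

/-- The roots `γ` for which `⟨γ, α⟩ + ⟨γ, β⟩` is even. -/
def evenSubsystem (P : RootPairing ι ℝ M V) [P.IsCrystallographic] [IsSimplyLaced P] (a c : ι) :
    Subsystem P where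
  carrier := {i | Even (P.pairingIn ℤ i a + P.pairingIn ℤ i c)}
  reflectionPerm_mem' i hi j hj := by
    change Even _
    obtain ⟨x, hx⟩ := hi
    obtain ⟨y, hy⟩ := hj
    refine ⟨y - P.pairingIn ℤ j i * x, ?_⟩
    rw [pairingIn_reflectionPerm_left, pairingIn_reflectionPerm_left]
    linear_combination hy - P.pairingIn ℤ j i * hx

/-- The parity condition and the length bound leave for the pairings of d with a, b, c only the
weights of the standard representation of A₃ and of its dual. Each is a single orbit of the Weyl
group, so d can be moved by reflections and a sign to a root prolonging the chain a, b, c. -/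
lemma IsAThree.exists_isOfType_A_four {Ψ : Subsystem P} {a b c d : ι}
    (h : IsAThree Ψ a b c) (hd : d ∉ evenSubsystem P a c) :
    ∃ Ψ' : Subsystem P, Ψ'.IsOfType (CartanMatrix.A 4) ∧ Ψ ≤ Ψ' := by
  have hle : Ψ ≤ evenSubsystem P a c := by
    refine h.le _ ?_ ?_ ?_ <;> change Even _ <;>
      simp [h.ac, h.bc, pairingIn_symm b a, h.ab, pairingIn_symm c a]
  have hq := h.quadratic_le (fun hm => hd (hle hm)) (γ := d) rfl rfl rfl
  have bx := Ψ.pairingIn_bound (fun hm => hd (hle hm)) h.ha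
  have bY := Ψ.pairingIn_bound (fun hm => hd (hle hm)) h.hb
  have bz := Ψ.pairingIn_bound (fun hm => hd (hle hm)) h.hc
  have hodd : ¬ Even (P.pairingIn ℤ d a + P.pairingIn ℤ d c) := hd
  have r1 (e i : ι) (x y z : ℤ) (h1 : P.pairingIn ℤ e a = x) (h2 : P.pairingIn ℤ e b = y)
      (h3 : P.pairingIn ℤ e c = z) :
      ∃ e', P.pairingIn ℤ e' a = x - P.pairingIn ℤ e i * P.pairingIn ℤ i a ∧
        P.pairingIn ℤ e' b = y - P.pairingIn ℤ e i * P.pairingIn ℤ i b ∧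
        P.pairingIn ℤ e' c = z - P.pairingIn ℤ e i * P.pairingIn ℤ i c :=
    ⟨P.reflectionPerm i e, by rw [pairingIn_reflectionPerm_left, h1],
      by rw [pairingIn_reflectionPerm_left, h2], by rw [pairingIn_reflectionPerm_left, h3]⟩
  have hba : P.pairingIn ℤ b a = -1 := (pairingIn_symm _ _).trans h.ab
  have hcb : P.pairingIn ℤ c b = -1 := (pairingIn_symm _ _).trans h.bc
  have hca : P.pairingIn ℤ c a = 0 := (pairingIn_symm _ _).trans h.ac
  -- The orbit (1,0,0), (-1,1,0), (0,-1,1), (0,0,-1), traversed by reflections in a, b and c; its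
  -- last member prolongs the chain at c.
  have k0 (e : ι) (h1 : P.pairingIn ℤ e a = 0) (h2 : P.pairingIn ℤ e b = 0)
      (h3 : P.pairingIn ℤ e c = -1) := h.exists_isOfType_A_four_of_pairingIn h1 h2 h3
  have k1 (e : ι) (h1 : P.pairingIn ℤ e a = 0) (h2 : P.pairingIn ℤ e b = -1)
      (h3 : P.pairingIn ℤ e c = 1) : ∃ Ψ' : Subsystem P, Ψ'.IsOfType (CartanMatrix.A 4) ∧ Ψ ≤ Ψ' := by
    obtain ⟨e', h1', h2', h3'⟩ := r1 e c _ _ _ h1 h2 h3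
    rw [h3, hca] at h1'; rw [h3, hcb] at h2'; rw [h3, P.pairingIn_same] at h3'
    exact k0 e' h1' h2' h3'
  have k2 (e : ι) (h1 : P.pairingIn ℤ e a = -1) (h2 : P.pairingIn ℤ e b = 1)
      (h3 : P.pairingIn ℤ e c = 0) : ∃ Ψ' : Subsystem P, Ψ'.IsOfType (CartanMatrix.A 4) ∧ Ψ ≤ Ψ' := by
    obtain ⟨e', h1', h2', h3'⟩ := r1 e b _ _ _ h1 h2 h3
    rw [h2, hba] at h1'; rw [h2, P.pairingIn_same] at h2'; rw [h2, h.bc] at h3'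
    exact k1 e' h1' h2' h3'
  have k3 (e : ι) (h1 : P.pairingIn ℤ e a = 1) (h2 : P.pairingIn ℤ e b = 0)
      (h3 : P.pairingIn ℤ e c = 0) : ∃ Ψ' : Subsystem P, Ψ'.IsOfType (CartanMatrix.A 4) ∧ Ψ ≤ Ψ' := by
    obtain ⟨e', h1', h2', h3'⟩ := r1 e a _ _ _ h1 h2 h3
    rw [h1, P.pairingIn_same] at h1'; rw [h1, h.ab] at h2'; rw [h1, h.ac] at h3'
    exact k2 e' h1' h2' h3'
  -- Reflecting d in itself gives -d, which takes care of the dual weights.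
  obtain ⟨d', n1, n2, n3⟩ := r1 d d _ _ _ rfl rfl rfl
  rw [P.pairingIn_same] at n1 n2 n3
  rw [Int.not_even_iff] at hodd
  generalize hx : P.pairingIn ℤ d a = x at *
  generalize hy : P.pairingIn ℤ d b = y at *
  generalize hz : P.pairingIn ℤ d c = z at *
  have hx' : x = -1 ∨ x = 0 ∨ x = 1 := by omega
  have hy' : y = -1 ∨ y = 0 ∨ y = 1 := by omega
  have hz' : z = -1 ∨ z = 0 ∨ z = 1 := by omega
  rcases hx' with rfl | rfl | rfl <;> rcases hz' with rfl | rfl | rfl <;>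
    first
    | (exfalso; omega)
    | (rcases hy' with rfl | rfl | rfl <;>
        first
        | (exfalso; omega)
        | exact k0 d hx hy hz
        | exact k1 d hx hy hz
        | exact k2 d hx hy hz
        | exact k3 d hx hy hz
        | exact k0 d' n1 n2 n3
        | exact k1 d' n1 n2 n3
        | exact k2 d' n1 n2 n3
        | exact k3 d' n1 n2 n3)

open Matrix in
-- If no such root exists, let v be the integral coordinates of a + c in the simple roots. All
-- pairings of a + c with simple roots are even, and its squared length vᵀCv is 2 + 2 = 4 by
-- orthogonality; `hC` forbids this.
lemma notMem_evenSubsystem_of_isOfType {n : ℕ} {C : Matrix (Fin n) (Fin n) ℤ}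
    (hC : ∀ v : Fin n → ℤ, (∀ j, Even (∑ i, v i * C i j)) → ∑ j, v j * ∑ i, v i * C i j ≠ 4)
    (hΦ : (⊤ : Subsystem P).IsOfType C) {a c : ι} (hac : P.pairingIn ℤ a c = 0) :
    ∃ d, d ∉ evenSubsystem P a c := by
  by_contra! hc
  obtain ⟨s, hs, -, hmin⟩ := hΦ
  let Ψ : Subsystem P :=
    { carrier := {i | P.root i ∈ Submodule.span ℤ (Set.range (P.root ∘ s))}
      reflectionPerm_mem' := fun i hi j hj => by
        change P.root _ ∈ Submodule.span ℤ _
        rw [root_reflectionPerm', Int.cast_smul_eq_zsmul]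
        exact Submodule.sub_mem _ hj (Submodule.smul_mem _ _ hi) }
  have hΨ (i : ι) : P.root i ∈ Submodule.span ℤ (Set.range (P.root ∘ s)) :=
    hmin Ψ (fun i => Submodule.subset_span ⟨i, rfl⟩) trivial
  obtain ⟨v, hv⟩ := (Submodule.mem_span_range_iff_exists_fun ℤ).mp
    (Submodule.add_mem _ (hΨ a) (hΨ c))
  have key (j : ι) : ∑ i, v i * P.pairingIn ℤ (s i) j = P.pairingIn ℤ a j + P.pairingIn ℤ c j := by
    have h := congrArg (P.coroot' j) hv
    rw [map_sum, map_add, coroot'_root, coroot'_root] at h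
    simp only [Function.comp, map_zsmul, coroot'_root, zsmul_eq_mul] at h
    exact_mod_cast h
  have key' (j : Fin n) : ∑ i, v i * C i j = P.pairingIn ℤ (s j) a + P.pairingIn ℤ (s j) c := by
    rw [pairingIn_symm _ a, pairingIn_symm _ c, ← key]
    simp only [hs]
  refine hC v (fun j => key' j ▸ hc (s j)) ?_
  simp only [key', mul_add, Finset.sum_add_distrib, key, P.pairingIn_same, hac, pairingIn_symm c a]
  rfl

/-- The determinant 3 is odd, so v = 2w, and vᵀCv = 4 wᵀCw is divisible by 8 because the lattice is
even. -/
lemma two_even_of_E₆ (v : Fin 6 → ℤ) (h : ∀ j, Even (∑ i, v i * CartanMatrix.E₆ i j)) :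
    ∑ j, v j * ∑ i, v i * CartanMatrix.E₆ i j ≠ 4 := by
  have h0 := h 0
  have h1 := h 1
  have h2 := h 2
  have h3 := h 3
  have h4 := h 4
  have h5 := h 5
  simp only [Fin.sum_univ_six, CartanMatrix.E₆] at h0 h1 h2 h3 h4 h5 ⊢
  simp [Int.even_iff] at h0 h1 h2 h3 h4 h5 ⊢
  obtain ⟨x0, e0⟩ : ∃ x, v 0 = 2 * x := ⟨v 0 / 2, by omega⟩
  obtain ⟨x1, e1⟩ : ∃ x, v 1 = 2 * x := ⟨v 1 / 2, by omega⟩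
  obtain ⟨x2, e2⟩ : ∃ x, v 2 = 2 * x := ⟨v 2 / 2, by omega⟩
  obtain ⟨x3, e3⟩ : ∃ x, v 3 = 2 * x := ⟨v 3 / 2, by omega⟩
  obtain ⟨x4, e4⟩ : ∃ x, v 4 = 2 * x := ⟨v 4 / 2, by omega⟩
  obtain ⟨x5, e5⟩ : ∃ x, v 5 = 2 * x := ⟨v 5 / 2, by omega⟩
  rw [e0, e1, e2, e3, e4, e5]
  intro hc
  have : 8 * (x0 ^ 2 + x1 ^ 2 + x2 ^ 2 + x3 ^ 2 + x4 ^ 2 + x5 ^ 2 -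
    (x0 * x2 + x2 * x3 + x3 * x4 + x4 * x5 + x1 * x3)) = 4 := by rw [← hc]; ring
  omega

/-- As for E₆, with determinant 1. -/
lemma two_even_of_E₈ (v : Fin 8 → ℤ) (h : ∀ j, Even (∑ i, v i * CartanMatrix.E₈ i j)) :
    ∑ j, v j * ∑ i, v i * CartanMatrix.E₈ i j ≠ 4 := by
  have h0 := h 0
  have h1 := h 1
  have h2 := h 2
  have h3 := h 3
  have h4 := h 4
  have h5 := h 5
  have h6 := h 6
  have h7 := h 7
  simp only [Fin.sum_univ_eight, CartanMatrix.E₈] at h0 h1 h2 h3 h4 h5 h6 h7 ⊢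
  simp [Int.even_iff] at h0 h1 h2 h3 h4 h5 h6 h7 ⊢
  obtain ⟨x0, e0⟩ : ∃ x, v 0 = 2 * x := ⟨v 0 / 2, by omega⟩
  obtain ⟨x1, e1⟩ : ∃ x, v 1 = 2 * x := ⟨v 1 / 2, by omega⟩
  obtain ⟨x2, e2⟩ : ∃ x, v 2 = 2 * x := ⟨v 2 / 2, by omega⟩
  obtain ⟨x3, e3⟩ : ∃ x, v 3 = 2 * x := ⟨v 3 / 2, by omega⟩
  obtain ⟨x4, e4⟩ : ∃ x, v 4 = 2 * x := ⟨v 4 / 2, by omega⟩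
  obtain ⟨x5, e5⟩ : ∃ x, v 5 = 2 * x := ⟨v 5 / 2, by omega⟩
  obtain ⟨x6, e6⟩ : ∃ x, v 6 = 2 * x := ⟨v 6 / 2, by omega⟩
  obtain ⟨x7, e7⟩ : ∃ x, v 7 = 2 * x := ⟨v 7 / 2, by omega⟩
  rw [e0, e1, e2, e3, e4, e5, e6, e7]
  intro hc
  have : 8 * (x0 ^ 2 + x1 ^ 2 + x2 ^ 2 + x3 ^ 2 + x4 ^ 2 + x5 ^ 2 + x6 ^ 2 + x7 ^ 2 -
    (x0 * x2 + x2 * x3 + x3 * x4 + x4 * x5 + x1 * x3 + x5 * x6 + x6 * x7)) = 4 := by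
    rw [← hc]; ring
  omega

/-- The determinant is 2, and modulo 2 the kernel of C is spanned by the indicator of the indices 1,
4, 6. With t = v 1 the form is 6t² modulo 8, that is, 0 or 6 and never 4. -/
lemma two_even_of_E₇ (v : Fin 7 → ℤ) (h : ∀ j, Even (∑ i, v i * CartanMatrix.E₇ i j)) :
    ∑ j, v j * ∑ i, v i * CartanMatrix.E₇ i j ≠ 4 := by
  have h0 := h 0
  have h1 := h 1
  have h2 := h 2
  have h3 := h 3
  have h4 := h 4
  have h5 := h 5
  have h6 := h 6
  simp only [Fin.sum_univ_seven, CartanMatrix.E₇] at h0 h1 h2 h3 h4 h5 h6 ⊢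
  simp [Int.even_iff] at h0 h1 h2 h3 h4 h5 h6 ⊢
  obtain ⟨x0, e0⟩ : ∃ x, v 0 = 2 * x := ⟨v 0 / 2, by omega⟩
  obtain ⟨x2, e2⟩ : ∃ x, v 2 = 2 * x := ⟨v 2 / 2, by omega⟩
  obtain ⟨x3, e3⟩ : ∃ x, v 3 = 2 * x := ⟨v 3 / 2, by omega⟩
  obtain ⟨x5, e5⟩ : ∃ x, v 5 = 2 * x := ⟨v 5 / 2, by omega⟩
  obtain ⟨y, e4, e6⟩ : ∃ y, v 4 = 2 * y + v 1 ∧ v 6 = 2 * ((v 6 - v 1) / 2) + v 1 :=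
    ⟨(v 4 - v 1) / 2, by omega, by omega⟩
  generalize (v 6 - v 1) / 2 = z at e6
  generalize v 1 = t at *
  rw [e0, e2, e3, e4, e5, e6]
  intro hc
  have : 8 * (x0 ^ 2 + x2 ^ 2 + x3 ^ 2 + y ^ 2 + y * t + x5 ^ 2 + z ^ 2 + z * t - x0 * x2 -
      x2 * x3 - x3 * y - y * x5 - x5 * z - x3 * t - x5 * t) + 6 * (t * t) = 4 := by
    rw [← hc]; ring
  obtain ⟨w, rfl | rfl⟩ := t.even_or_odd'
  · have h9 : (2 * w) * (2 * w) = 4 * (w * w) := by ring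
    omega
  · have h9 : (2 * w + 1) * (2 * w + 1) = 4 * (w * w + w) + 1 := by ring
    omega

/-- In the root systems `E₆`, `E₇`, `E₈` every `A₃` lies in an `A₄`. -/
lemma exists_isOfType_A_four (hΦ : (⊤ : Subsystem P).IsOfType CartanMatrix.E₆ ∨
      (⊤ : Subsystem P).IsOfType CartanMatrix.E₇ ∨ (⊤ : Subsystem P).IsOfType CartanMatrix.E₈)
    {Ψ : Subsystem P} (h : Ψ.IsOfType (CartanMatrix.A 3)) :
    ∃ Ψ' : Subsystem P, Ψ'.IsOfType (CartanMatrix.A 4) ∧ Ψ ≤ Ψ' := by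
  obtain ⟨a, b, c, h⟩ := isOfType_A_three_iff.mp h
  obtain ⟨d, hd⟩ : ∃ d, d ∉ evenSubsystem P a c := by
    rcases hΦ with hΦ | hΦ | hΦ
    · exact notMem_evenSubsystem_of_isOfType two_even_of_E₆ hΦ h.ac
    · exact notMem_evenSubsystem_of_isOfType two_even_of_E₇ hΦ h.ac
    · exact notMem_evenSubsystem_of_isOfType two_even_of_E₈ hΦ h.ac
  exact h.exists_isOfType_A_four hd

/-- The nodes 0, 2, 3 of each diagram form a chain A₃, and its Cartan matrix is invertible. -/
lemma three_le_finrank [Finite ι] [P.IsRootSystem]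
    (hΦ : (⊤ : Subsystem P).IsOfType CartanMatrix.E₆ ∨
      (⊤ : Subsystem P).IsOfType CartanMatrix.E₇ ∨ (⊤ : Subsystem P).IsOfType CartanMatrix.E₈) :
    3 ≤ Module.finrank ℝ M := by
  obtain ⟨a, b, c, ab, bc, ac⟩ : ∃ a b c, P.pairingIn ℤ a b = -1 ∧ P.pairingIn ℤ b c = -1 ∧
      P.pairingIn ℤ a c = 0 := by
    rcases hΦ with ⟨s, hs, -⟩ | ⟨s, hs, -⟩ | ⟨s, hs, -⟩ <;>
      exact ⟨s 0, s 2, s 3, hs 0 2, hs 2 3, hs 0 3⟩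
  have hli : LinearIndependent ℝ ![P.root a, P.root b, P.root c] := by
    rw [Fintype.linearIndependent_iff]
    intro g hg
    simp only [Fin.sum_univ_three, Matrix.cons_val_zero, Matrix.cons_val_one,
      Matrix.cons_val_two, Matrix.tail_cons, Matrix.head_cons] at hg
    have key (i : ι) : g 0 * P.pairingIn ℤ i a + g 1 * P.pairingIn ℤ i b +
        g 2 * P.pairingIn ℤ i c = 0 := by
      have := congrArg (P.coroot' i) hg
      rwa [map_add, map_add, map_smul, map_smul, map_smul, coroot'_root, coroot'_root,
        coroot'_root, pairingIn_symm a, pairingIn_symm b, pairingIn_symm c, map_zero] at this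
    have k1 := key a
    have k2 := key b
    have k3 := key c
    rw [P.pairingIn_same, ab, ac] at k1
    rw [P.pairingIn_same, pairingIn_symm b a, ab, bc] at k2
    rw [P.pairingIn_same, pairingIn_symm c a, pairingIn_symm c b, ac, bc] at k3
    push_cast at k1 k2 k3
    intro i
    fin_cases i <;> simp <;> linarith
  have : Module.Finite ℝ M :=
    ⟨⟨(Set.finite_range P.root).toFinset, by
      rw [Set.Finite.coe_toFinset]; exact RootPairing.IsRootSystem.span_root_eq_top⟩⟩
  simpa using hli.fintype_card_le_finrank

end RootCombinatorics

/-! ### Relations between units 1 + x with x² = 0. -/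

section RingLemmas

variable {A E : Type*} [CommRing A] [Ring E] [Algebra A E]

lemma one_add_mul_one_sub {x : E} (h : x * x = 0) : (1 + x) * (1 - x) = 1 := by
  have : (1 + x) * (1 - x) = 1 - x * x := by noncomm_ring
  rw [this, h, sub_zero]

/-- The unit `1 + x` for an element `x` of square zero. -/
def oneAdd (x : E) (h : x * x = 0) : Eˣ where
  val := 1 + x
  inv := 1 - x
  val_inv := one_add_mul_one_sub h
  inv_val := by
    have : (1 - x) * (1 + x) = 1 - x * x := by noncomm_ring
    rw [this, h, sub_zero]

open scoped commutatorElement in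
-- The hypotheses give ca = cb = 0, so no terms beyond the ring commutator survive.
lemma oneAdd_commutator {a b c : E} (ha : a * a = 0) (hb : b * b = 0) (hc : c * c = 0)
    (hab : c = a * b - b * a) (haba : a * b * a = 0) (hbab : b * a * b = 0) :
    ⁅oneAdd a ha, oneAdd b hb⁆ = oneAdd c hc := by
  rw [commutatorElement_def, mul_inv_eq_iff_eq_mul, mul_inv_eq_iff_eq_mul]
  refine Units.ext ?_
  change (1 + a) * (1 + b) = (1 + c) * (1 + b) * (1 + a)
  have h1 : c * b = 0 := by
    rw [hab]
    have : (a * b - b * a) * b = a * (b * b) - b * a * b := by noncomm_ring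
    rw [this, hb, hbab]; simp
  have h2 : c * a = 0 := by
    rw [hab]
    have : (a * b - b * a) * a = a * b * a - b * (a * a) := by noncomm_ring
    rw [this, ha, haba]; simp
  have : (1 + c) * (1 + b) * (1 + a) = 1 + a + b + b * a + c + c * b + c * a + c * b * a := by
    noncomm_ring
  rw [this, h1, h2, hab]
  noncomm_ring

lemma oneAdd_weyl_aux {a b s t : E} (ha : a * a = 0) (hb : b * b = 0) (hs : s * s = 0)
    (ht : t * t = 0)
    (h : (1 + a) * (1 + b) * (1 + a) * s = t * ((1 + a) * (1 + b) * (1 + a))) :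
    MulAut.conj (oneAdd a ha * oneAdd b hb * oneAdd a ha) (oneAdd s hs) = oneAdd t ht := by
  rw [MulAut.conj_apply, mul_inv_eq_iff_eq_mul]
  refine Units.ext ?_
  change (1 + a) * (1 + b) * (1 + a) * (1 + s) = (1 + t) * ((1 + a) * (1 + b) * (1 + a))
  rw [mul_add, h, mul_one, add_mul 1 t, one_mul]

/-- Under these hypotheses x and y behave like the matrix units e₁₂ and e₂₁, and the Weyl element is
1 + ux - u⁻¹y - yx - xy; the claim is the computation in rank one. -/
lemma weyl_matrix {x y : E} (hx : x * x = 0) (hy : y * y = 0) (hxyx : x * y * x = x)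
    (hyxy : y * x * y = y) (u : Aˣ) (z : A) :
    (1 + (u : A) • x) * (1 + (-((u⁻¹ : Aˣ) : A)) • y) * (1 + (u : A) • x) * (z • x) =
      (-(((u⁻¹ : Aˣ) : A) ^ 2 * z)) • y *
        ((1 + (u : A) • x) * (1 + (-((u⁻¹ : Aˣ) : A)) • y) * (1 + (u : A) • x)) ∧
    (1 + (u : A) • x) * (1 + (-((u⁻¹ : Aˣ) : A)) • y) * (1 + (u : A) • x) * (z • y) =
      (-((u : A) ^ 2 * z)) • x *
        ((1 + (u : A) • x) * (1 + (-((u⁻¹ : Aˣ) : A)) • y) * (1 + (u : A) • x)) := by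
  have huv : (u : A) * ((u⁻¹ : Aˣ) : A) = 1 := u.mul_inv
  generalize ((u⁻¹ : Aˣ) : A) = v at *
  generalize (u : A) = u at *
  have hw : (1 + u • x) * (1 + (-v) • y) * (1 + u • x) =
      1 + u • x - v • y - y * x - x * y := by
    have : (1 + u • x) * (1 + (-v) • y) * (1 + u • x) =
        1 + u • x + u • x - v • y - (u * v) • (y * x) - (u * v) • (x * y) + (u * u) • (x * x) -
          (u * (u * v)) • (x * y * x) := by
      simp only [mul_add, add_mul, mul_one, one_mul, neg_smul, mul_neg,
        neg_mul, smul_mul_assoc, mul_smul_comm, mul_assoc]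
      module
    rw [this, huv, hxyx, hx]
    module
  have e1 : (1 + u • x - v • y - y * x - x * y) * x = -(v • (y * x)) := by
    simp only [add_mul, sub_mul, one_mul, smul_mul_assoc, mul_assoc y, hx, hxyx]
    simp
  have e2 : y * (1 + u • x - v • y - y * x - x * y) = u • (y * x) := by
    simp only [mul_add, mul_sub, mul_one, mul_smul_comm, ← mul_assoc, hy, hyxy]
    simp
  have e3 : (1 + u • x - v • y - y * x - x * y) * y = u • (x * y) := by
    simp only [add_mul, sub_mul, one_mul, smul_mul_assoc, mul_assoc x, hy, hyxy]
    simp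
  have e4 : x * (1 + u • x - v • y - y * x - x * y) = -(v • (x * y)) := by
    simp only [mul_add, mul_sub, mul_one, mul_smul_comm, ← mul_assoc, hx, hxyx]
    simp
  rw [hw, mul_smul_comm, mul_smul_comm, smul_mul_assoc, smul_mul_assoc, e1, e2, e3, e4, smul_smul,
    smul_neg, smul_neg, smul_smul, smul_smul, smul_smul, ← neg_smul, ← neg_smul]
  constructor <;> congr 1
  · linear_combination v * z * huv
  · linear_combination (-(u * z)) * huv

end RingLemmas

/-! ### The adjoint action on an abelian radical. -/

section Representation

variable {ι : Type u} {M V L : Type*} [AddCommGroup M] [Module ℝ M] [AddCommGroup V]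
    [Module ℝ V] [LieRing L] [LieAlgebra ℂ L] [FiniteDimensional ℂ L] [LieAlgebra.IsKilling ℂ L]
    {P : RootPairing ι ℝ M V} [P.IsCrystallographic]
    {H : LieSubalgebra ℂ L} [H.IsCartanSubalgebra]

lemma ChevalleyBasis.linearIndependent (B : ChevalleyBasis P H) : LinearIndependent ℤ B.e := by
  have h1 : LinearIndependent ℂ B.e := by
    have h2 := LieModule.iSupIndep_genWeightSpace ℂ H L
    have h3 : Function.Injective fun i => ((B.toRoot i).1 : H → ℂ) := fun i j h =>
      B.toRoot.injective (Subtype.ext (DFunLike.coe_injective h))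
    have h4 := h2.comp h3
    rw [← LieSubmodule.iSupIndep_toSubmodule] at h4
    exact h4.linearIndependent _ (fun i => B.e_mem i) B.e_ne_zero
  exact h1.restrict_scalars (by
    intro a b hab
    simpa using hab)

/-- A nonzero bracket makes α + β a weight of the Lie algebra. Weight 0 forces β = -α; otherwise the
weight comes from a root k with ⟨k, ·⟩ = ⟨α, ·⟩ + ⟨β, ·⟩, and ⟨k, k⟩ = 2 gives ⟨α, β⟩ = -1, so that
α + β is a root of `P`. -/
lemma ChevalleyBasis.lie_e_eq_zero (B : ChevalleyBasis P H) [IsSimplyLaced P] {i j : ι}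
    (h0 : P.root i + P.root j ≠ 0) (h : ∀ k, P.root k ≠ P.root i + P.root j) :
    ⁅B.e i, B.e j⁆ = 0 := by
  by_contra hne
  have hmem := LieAlgebra.lie_mem_genWeightSpace_of_mem_genWeightSpace (B.e_mem i) (B.e_mem j)
  let w : LieModule.Weight ℂ H L := ⟨(B.toRoot i).1 + (B.toRoot j).1, fun hb => by
    rw [hb] at hmem
    exact hne (by simpa using hmem)⟩
  have hw (l : ι) : w (LieAlgebra.IsKilling.coroot (B.toRoot l).1) =
      ((P.pairingIn ℤ i l + P.pairingIn ℤ j l : ℤ) : ℂ) := by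
    change (B.toRoot i).1 _ + (B.toRoot j).1 _ = _
    rw [B.apply_coroot, B.apply_coroot]
    push_cast; rfl
  by_cases hw0 : w.IsZero
  · have h1 := hw i
    have h2 : (w : H → ℂ) = 0 := hw0
    rw [h2, P.pairingIn_same, Pi.zero_apply] at h1
    have h3 : 2 + P.pairingIn ℤ j i = 0 := by exact_mod_cast h1.symm
    rcases eq_or_neg_of_pairingIn (P := P) (i := j) (j := i) (by omega) with rfl | h4
    · rw [P.pairingIn_same] at h3; omega
    · exact h0 (by rw [h4, add_neg_cancel])
  · obtain ⟨k, hk⟩ := B.toRoot.surjective ⟨w, by simpa using hw0⟩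
    have h1 (l : ι) : P.pairingIn ℤ k l = P.pairingIn ℤ i l + P.pairingIn ℤ j l := by
      have h2 := B.apply_coroot k l
      rw [hk] at h2
      exact_mod_cast h2.symm.trans (hw l)
    have h2 := h1 i
    have h3 := h1 j
    have h4 := h1 k
    rw [P.pairingIn_same] at h2 h3 h4
    rw [pairingIn_symm i k, pairingIn_symm j k, h2, h3, pairingIn_symm i j] at h4
    obtain ⟨d, hd⟩ := exists_root_add (P := P) (i := i) (j := j) (by omega)
    exact h d hd

variable [Fintype ι] [DecidableEq ι]

open Classical in
/-- The matrix of `ad e_β` on the span of the root vectors with roots in `U`. -/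
noncomputable def adMatrix (B : ChevalleyBasis P H) (U : Set ι) (b : ι) : Matrix ι ι ℤ :=
  Matrix.of fun d c => if c ∈ U ∧ P.root d = P.root b + P.root c then B.N b c else 0

variable {B : ChevalleyBasis P H} {U : Set ι}

lemma adMatrix_apply {b c d : ι} (hc : c ∈ U) (h : P.root d = P.root b + P.root c) :
    adMatrix B U b d c = B.N b c := by
  simp [adMatrix, hc, h]

lemma adMatrix_apply_ne {b c d : ι} (h : adMatrix B U b d c ≠ 0) :
    c ∈ U ∧ P.root d = P.root b + P.root c := by
  by_contra hn
  exact h (by simp only [adMatrix, Matrix.of_apply, if_neg hn])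

lemma mul_adMatrix_apply (Y : Matrix ι ι ℤ) {b c d : ι} (hc : c ∈ U)
    (h : P.root d = P.root b + P.root c) (e : ι) :
    (Y * adMatrix B U b) e c = Y e d * B.N b c := by
  rw [Matrix.mul_apply, Finset.sum_eq_single d, adMatrix_apply hc h]
  · intro x _ hx
    by_contra hn
    have := (adMatrix_apply_ne (right_ne_zero_of_mul hn)).2
    exact hx (P.root.injective (this.trans h.symm))
  · simp

lemma mul_adMatrix_apply_ne {Y : Matrix ι ι ℤ} {b c e : ι} (h : (Y * adMatrix B U b) e c ≠ 0) :
    ∃ d, c ∈ U ∧ P.root d = P.root b + P.root c ∧ Y e d ≠ 0 := by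
  rw [Matrix.mul_apply] at h
  obtain ⟨d, -, hd⟩ := Finset.exists_ne_zero_of_sum_ne_zero h
  have := adMatrix_apply_ne (right_ne_zero_of_mul hd)
  exact ⟨d, this.1, this.2, left_ne_zero_of_mul hd⟩

variable [IsSimplyLaced P]

/-- Once β has been added the pairing with β is 1, and a second addition would need -1. -/
lemma adMatrix_sq (b : ι) : adMatrix B U b * adMatrix B U b = 0 := by
  ext e c
  by_contra hn
  obtain ⟨d, -, h1, h2⟩ := mul_adMatrix_apply_ne hn
  have h3 := pairingIn_of_add h1
  have h4 := pairingIn_of_add (adMatrix_apply_ne h2).2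
  rw [pairingIn_add h1, P.pairingIn_same] at h4
  omega

/-- Between the two additions of b the pairing with b must drop from 1 to -1, which only a b'
pairing to -2 achieves. -/
lemma adMatrix_mul_mul {b b' : ι} (h : P.pairingIn ℤ b' b ≠ -2) :
    adMatrix B U b * adMatrix B U b' * adMatrix B U b = 0 := by
  ext e c
  by_contra hn
  obtain ⟨d, -, h1, h2⟩ := mul_adMatrix_apply_ne hn
  obtain ⟨f, -, h3, h4⟩ := mul_adMatrix_apply_ne h2
  have h5 := pairingIn_of_add h1
  have h6 := pairingIn_of_add (adMatrix_apply_ne h4).2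
  rw [pairingIn_add h3, pairingIn_add h1, P.pairingIn_same] at h6
  omega

/-- Going from γ to β + γ and back multiplies by N_{β,γ} N_{-β,β+γ} = 1. -/
lemma adMatrix_neg {b b' : ι} (hb : P.root b' = -P.root b) {Ψ : Subsystem P} (hU : IsRadical Ψ U)
    (hm : b ∈ Ψ) :
    adMatrix B U b * adMatrix B U b' * adMatrix B U b = adMatrix B U b := by
  ext e c
  by_cases h : c ∈ U ∧ ∃ d, P.root d = P.root b + P.root c
  · obtain ⟨hc, d, hd⟩ := h
    rw [mul_adMatrix_apply _ hc hd, mul_adMatrix_apply _ (hU.add_mem hm hc hd) (d := c)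
      (by rw [hd, hb]; abel), mul_assoc, mul_comm (B.N b' d), B.N_mul_N hb hd, mul_one]
  · have h1 : adMatrix B U b e c = 0 := by
      by_contra hn
      exact h ⟨(adMatrix_apply_ne hn).1, e, (adMatrix_apply_ne hn).2⟩
    rw [h1]
    by_contra hn
    obtain ⟨d, h2, h3, -⟩ := mul_adMatrix_apply_ne hn
    exact h ⟨h2, d, h3⟩

lemma sum_adMatrix_smul {Ψ : Subsystem P} (hU : IsRadical Ψ U) {b c : ι} (hb : b ∈ Ψ)
    (hc : c ∈ U) : ∑ d, adMatrix B U b d c • B.e d = ⁅B.e b, B.e c⁆ := by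
  by_cases h : ∃ d, P.root d = P.root b + P.root c
  · obtain ⟨d, hd⟩ := h
    rw [Finset.sum_eq_single d, adMatrix_apply hc hd, B.lie_e b c d hd]
    · intro x _ hx
      have : adMatrix B U b x c = 0 := by
        by_contra hn
        exact hx (P.root.injective ((adMatrix_apply_ne hn).2.trans hd.symm))
      rw [this, zero_smul]
    · simp
  · push Not at h
    rw [B.lie_e_eq_zero (hU.add_ne_zero hb hc) h]
    refine Finset.sum_eq_zero fun d _ => ?_
    have : adMatrix B U b d c = 0 := by
      by_contra hn
      exact h d (adMatrix_apply_ne hn).2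
    rw [this, zero_smul]

lemma sum_adMatrix_mul_smul {Ψ : Subsystem P} (hU : IsRadical Ψ U) {b b' c : ι} (hb : b ∈ Ψ)
    (hb' : b' ∈ Ψ) (hc : c ∈ U) :
    ∑ d, (adMatrix B U b * adMatrix B U b') d c • B.e d = ⁅B.e b, ⁅B.e b', B.e c⁆⁆ := by
  rw [← sum_adMatrix_smul hU hb' hc, lie_sum]
  simp only [Matrix.mul_apply, Finset.sum_smul]
  rw [Finset.sum_comm]
  refine Finset.sum_congr rfl fun d _ => ?_
  rw [lie_zsmul]
  by_cases h : adMatrix B U b' d c = 0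
  · simp [h]
  · have h1 := adMatrix_apply_ne h
    rw [← sum_adMatrix_smul hU hb (hU.add_mem hb' hc h1.2), Finset.smul_sum]
    refine Finset.sum_congr rfl fun x _ => ?_
    rw [smul_smul, mul_comm]

lemma adMatrix_apply_of_notMem {b c d : ι} (hc : c ∉ U) : adMatrix B U b d c = 0 := by
  simp [adMatrix, hc]

lemma mul_adMatrix_apply_of_notMem {Y : Matrix ι ι ℤ} {b c d : ι} (hc : c ∉ U) :
    (Y * adMatrix B U b) d c = 0 := by
  simp [Matrix.mul_apply, adMatrix_apply_of_notMem hc]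

/-- This is the Jacobi identity. Column by column the matrices encode brackets in the Lie algebra
(`sum_adMatrix_smul`), and the root vectors are linearly independent over ℤ. -/
lemma adMatrix_commutator {Ψ : Subsystem P} (hU : IsRadical Ψ U) {b b' k : ι} (hb : b ∈ Ψ)
    (hb' : b' ∈ Ψ) (hk : P.root k = P.root b + P.root b') :
    adMatrix B U b * adMatrix B U b' - adMatrix B U b' * adMatrix B U b =
      B.N b b' • adMatrix B U k := by
  ext d c
  revert d
  by_cases hc : c ∈ U
  · rw [← funext_iff]
    refine B.linearIndependent.fintypeLinearCombination_injective ?_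
    simp only [Fintype.linearCombination_apply, Matrix.sub_apply, sub_smul, Finset.sum_sub_distrib,
      Matrix.smul_apply, smul_assoc, ← Finset.smul_sum]
    rw [sum_adMatrix_mul_smul hU hb hb' hc, sum_adMatrix_mul_smul hU hb' hb hc,
      sum_adMatrix_smul hU (Ψ.add_mem hb hb' hk) hc, ← smul_lie, ← B.lie_e b b' k hk, lie_lie]
  · intro d
    simp [mul_adMatrix_apply_of_notMem hc, adMatrix_apply_of_notMem hc]

lemma adMatrix_commute {Ψ : Subsystem P} (hU : IsRadical Ψ U) {b b' : ι} (hb : b ∈ Ψ)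
    (hb' : b' ∈ Ψ) (h0 : P.root b + P.root b' ≠ 0) (h : ∀ k, P.root k ≠ P.root b + P.root b') :
    adMatrix B U b * adMatrix B U b' = adMatrix B U b' * adMatrix B U b := by
  rw [← sub_eq_zero]
  ext d c
  revert d
  by_cases hc : c ∈ U
  · rw [← funext_iff]
    refine B.linearIndependent.fintypeLinearCombination_injective ?_
    simp only [Fintype.linearCombination_apply, Matrix.sub_apply, sub_smul, Finset.sum_sub_distrib,
      Matrix.zero_apply, zero_smul, Finset.sum_const_zero]
    rw [sum_adMatrix_mul_smul hU hb hb' hc, sum_adMatrix_mul_smul hU hb' hb hc, ← lie_lie,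
      B.lie_e_eq_zero h0 h, zero_lie]
  · intro d
    simp [mul_adMatrix_apply_of_notMem hc]

/-- The image of `adMatrix` over a commutative ring `A`. -/
noncomputable def adMatrixOver (B : ChevalleyBasis P H) (U : Set ι) (b : ι) (A : Type*)
    [CommRing A] : Matrix ι ι A :=
  (Int.castRingHom A).mapMatrix (adMatrix B U b)

variable {A A' : Type v} [CommRing A] [CommRing A']

lemma smul_adMatrixOver_sq (b : ι) (r : A) :
    (r • adMatrixOver B U b A) * (r • adMatrixOver B U b A) = 0 := by
  rw [smul_mul_smul_comm, adMatrixOver, ← map_mul, adMatrix_sq, map_zero, smul_zero]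

/-- The exponential of `r • ad e_β` on the span of the root vectors with roots in `U`. -/
noncomputable def expAd (B : ChevalleyBasis P H) (U : Set ι) (b : ι) (r : A) : (Matrix ι ι A)ˣ :=
  oneAdd (r • adMatrixOver B U b A) (smul_adMatrixOver_sq b r)

lemma expAd_val (b : ι) (r : A) :
    (expAd B U b r : Matrix ι ι A) = 1 + r • adMatrixOver B U b A := rfl

lemma expAd_map (f : A →+* A') (b : ι) (r : A) :
    Units.map ((f.mapMatrix : Matrix ι ι A →+* Matrix ι ι A') : Matrix ι ι A →* Matrix ι ι A') (expAd B U b r) =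
      expAd B U b (f r) := by
  refine Units.ext ?_
  ext i j
  simp only [Units.coe_map, MonoidHom.coe_coe, expAd_val, RingHom.mapMatrix_apply, Matrix.map_apply,
    Matrix.add_apply, Matrix.smul_apply, adMatrixOver, smul_eq_mul, map_add, map_mul,
    Int.coe_castRingHom, map_intCast]
  rw [Matrix.one_apply, Matrix.one_apply]
  split_ifs <;> simp

lemma expAd_add (b : ι) (r s : A) :
    expAd B U b r * expAd B U b s = expAd B U b (r + s) := by
  refine Units.ext ?_
  change (1 + r • adMatrixOver B U b A) * (1 + s • adMatrixOver B U b A) =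
    1 + (r + s) • adMatrixOver B U b A
  have h : adMatrixOver B U b A * adMatrixOver B U b A = 0 := by
    rw [adMatrixOver, ← map_mul, adMatrix_sq, map_zero]
  rw [mul_add, add_mul, add_mul, smul_mul_smul_comm, h, smul_zero, add_smul]
  simp only [one_mul, mul_one]
  abel

open scoped commutatorElement in
lemma expAd_commute {Ψ : Subsystem P} (hU : IsRadical Ψ U) {b b' : ι} (hb : b ∈ Ψ)
    (hb' : b' ∈ Ψ) (h0 : P.root b + P.root b' ≠ 0) (h : ∀ k, P.root k ≠ P.root b + P.root b')
    (r s : A) : ⁅expAd B U b r, expAd B U b' s⁆ = 1 := by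
  rw [commutatorElement_eq_one_iff_mul_comm]
  refine Units.ext ?_
  change (1 + r • adMatrixOver B U b A) * (1 + s • adMatrixOver B U b' A) =
    (1 + s • adMatrixOver B U b' A) * (1 + r • adMatrixOver B U b A)
  have h : adMatrixOver B U b A * adMatrixOver B U b' A =
      adMatrixOver B U b' A * adMatrixOver B U b A := by
    rw [adMatrixOver, adMatrixOver, ← map_mul, adMatrix_commute hU hb hb' h0 h, map_mul]
  simp only [mul_add, add_mul, mul_one, one_mul, smul_mul_smul_comm, h, mul_comm r s]
  abel

open scoped commutatorElement in
lemma expAd_commutator {Ψ : Subsystem P} (hU : IsRadical Ψ U) {b b' k : ι} (hb : b ∈ Ψ)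
    (hb' : b' ∈ Ψ) (hk : P.root k = P.root b + P.root b') (r s : A) :
    ⁅expAd B U b r, expAd B U b' s⁆ = expAd B U k ((B.N b b' : A) * r * s) := by
  refine oneAdd_commutator _ _ _ ?_ ?_ ?_
  · rw [smul_mul_smul_comm, smul_mul_smul_comm, mul_comm s r, ← smul_sub, adMatrixOver,
      adMatrixOver, adMatrixOver, ← map_mul, ← map_mul, ← map_sub, adMatrix_commutator hU hb hb' hk, map_zsmul,
      mul_assoc, mul_comm, mul_smul, Int.cast_smul_eq_zsmul]
  · rw [smul_mul_smul_comm, smul_mul_smul_comm, adMatrixOver, adMatrixOver, ← map_mul, ← map_mul,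
      adMatrix_mul_mul (by rw [pairingIn_of_add hk]; norm_num), map_zero, smul_zero]
  · rw [smul_mul_smul_comm, smul_mul_smul_comm, adMatrixOver, adMatrixOver, ← map_mul, ← map_mul,
      adMatrix_mul_mul (by rw [pairingIn_of_add (hk.trans (add_comm _ _))]; norm_num), map_zero,
      smul_zero]

lemma expAd_weyl {Ψ : Subsystem P} (hU : IsRadical Ψ U) {b b' : ι} (hb : b ∈ Ψ)
    (hb' : P.root b' = -P.root b) (u : Aˣ) (z : A) :
    MulAut.conj (expAd B U b (u : A) * expAd B U b' (-((u⁻¹ : Aˣ) : A)) * expAd B U b (u : A))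
        (expAd B U b z) = expAd B U b' (-(((u⁻¹ : Aˣ) : A) ^ 2 * z)) ∧
    MulAut.conj (expAd B U b (u : A) * expAd B U b' (-((u⁻¹ : Aˣ) : A)) * expAd B U b (u : A))
        (expAd B U b' z) = expAd B U b (-((u : A) ^ 2 * z)) := by
  have hm : b' ∈ Ψ := Ψ.mem_of_eq_or_neg hb (Or.inr hb')
  have h := weyl_matrix (A := A) (x := adMatrixOver B U b A) (y := adMatrixOver B U b' A)
    (by rw [adMatrixOver, ← map_mul, adMatrix_sq, map_zero])
    (by rw [adMatrixOver, ← map_mul, adMatrix_sq, map_zero])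
    (by rw [adMatrixOver, adMatrixOver, ← map_mul, ← map_mul, adMatrix_neg hb' hU hb])
    (by rw [adMatrixOver, adMatrixOver, ← map_mul, ← map_mul,
      adMatrix_neg (by rw [hb', neg_neg]) hU hm]) u z
  exact ⟨oneAdd_weyl_aux _ _ _ _ h.1, oneAdd_weyl_aux _ _ _ _ h.2⟩

/-- The action of `St(Ψ, A)` on the free module spanned by the roots, where the roots in the radical
`U` are acted on through the adjoint representation and the other ones trivially. -/
noncomputable def radicalRep (B : ChevalleyBasis P H) {Ψ : Subsystem P} {U : Set ι}
    (hU : IsRadical Ψ U) (A : Type v) [CommRing A] : St B Ψ A →* (Matrix ι ι A)ˣ :=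
  PresentedGroup.toGroup (f := fun a => expAd B U a.1 a.2) (by
    intro r hr
    have hr' : Relator B Ψ A r := hr
    cases hr' with
    | add α ξ η => simp [expAd_add]
    | commute α β ξ η h₀ hn =>
      rw [map_commutatorElement, FreeGroup.lift_apply_of, FreeGroup.lift_apply_of]
      exact expAd_commute hU α.2 β.2 h₀ (fun k hk => hn ⟨k, Ψ.add_mem α.2 β.2 hk⟩ hk) _ _
    | commutator α β γ ξ η hγ =>
      rw [map_mul, map_commutatorElement, map_inv, FreeGroup.lift_apply_of,
        FreeGroup.lift_apply_of, FreeGroup.lift_apply_of, mul_inv_eq_one]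
      exact expAd_commutator hU α.2 β.2 hγ _ _
    | weyl_same α β u ζ hβ hn =>
      have := (expAd_weyl (B := B) hU α.2 hβ u ζ).1
      simp only [MulAut.conj_apply] at this ⊢
      simp only [map_mul, map_inv, FreeGroup.lift_apply_of, mul_inv_eq_one] at this ⊢
      exact this
    | weyl_neg α β u ζ hβ hn =>
      have := (expAd_weyl (B := B) hU α.2 hβ u ζ).2
      simp only [MulAut.conj_apply] at this ⊢
      simp only [map_mul, map_inv, FreeGroup.lift_apply_of, mul_inv_eq_one] at this ⊢
      exact this)

lemma radicalRep_x {Ψ : Subsystem P} (hU : IsRadical Ψ U) (α : Ψ) (r : A) :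
    radicalRep B hU A (St.x B α r) = expAd B U α r :=
  PresentedGroup.toGroup.of _

lemma radicalRep_map {Ψ₁ Ψ₂ : Subsystem P} (h : Ψ₁ ≤ Ψ₂) (hU : IsRadical Ψ₂ U) (f : A →+* A')
    (g : St B Ψ₁ A) : radicalRep B hU A' (St.map B h f g) =
      Units.map ((f.mapMatrix : Matrix ι ι A →+* Matrix ι ι A') : Matrix ι ι A →* Matrix ι ι A') (radicalRep B (hU.mono h) A g) := by
  have : (radicalRep B hU A').comp (St.map B h f) =
      (Units.map ((f.mapMatrix : Matrix ι ι A →+* Matrix ι ι A') : Matrix ι ι A →* Matrix ι ι A')).comp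
        (radicalRep B (hU.mono h) A) :=
    PresentedGroup.ext fun a => by
      change radicalRep B hU A' (St.map B h f (St.x B a.1 a.2)) =
        Units.map _ (radicalRep B (hU.mono h) A (St.x B a.1 a.2))
      rw [St.map_x, radicalRep_x, radicalRep_x, expAd_map]
      rfl
  exact DFunLike.congr_fun this g

lemma radicalRep_map_mulVec {Ψ₁ Ψ₂ : Subsystem P} (h : Ψ₁ ≤ Ψ₂) (hU : IsRadical Ψ₂ U)
    (f : A →+* A') (g : St B Ψ₁ A) (v : ι → A) :
    (radicalRep B hU A' (St.map B h f g) : Matrix ι ι A').mulVec (f ∘ v) =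
      f ∘ (radicalRep B (hU.mono h) A g : Matrix ι ι A).mulVec v := by
  rw [radicalRep_map]
  ext i
  simp only [Units.coe_map, MonoidHom.coe_coe, Function.comp]
  exact (RingHom.map_mulVec f _ v i).symm

lemma expAd_mulVec_single_of_add {b c d : ι} (hc : c ∈ U) (h : P.root d = P.root b + P.root c)
    (r s : A) : (expAd B U b r : Matrix ι ι A).mulVec (Pi.single c s) =
      Pi.single d ((B.N b c : A) * r * s) + Pi.single c s := by
  ext i
  have hi : adMatrixOver B U b A i c = if i = d then (B.N b c : A) else 0 := by
    split_ifs with hid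
    · subst hid
      simp [adMatrixOver, adMatrix_apply hc h]
    · have : adMatrix B U b i c = 0 := by
        by_contra hn
        exact hid (P.root.injective ((adMatrix_apply_ne hn).2.trans h.symm))
      simp [adMatrixOver, this]
  rw [expAd_val, Matrix.add_mulVec, Matrix.one_mulVec, Matrix.smul_mulVec, Matrix.mulVec_single]
  simp only [Pi.add_apply, Pi.smul_apply, Matrix.col_apply, hi, smul_eq_mul,
    MulOpposite.smul_eq_mul_unop, MulOpposite.unop_op, Pi.single_apply]
  split_ifs <;> ring

lemma expAd_mulVec_single {b c : ι} (h : c ∈ U → ∀ d, P.root d ≠ P.root b + P.root c)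
    (r s : A) : (expAd B U b r : Matrix ι ι A).mulVec (Pi.single c s) = Pi.single c s := by
  ext i
  have hi : adMatrixOver B U b A i c = 0 := by
    have : adMatrix B U b i c = 0 := by
      by_contra hn
      exact h (adMatrix_apply_ne hn).1 i (adMatrix_apply_ne hn).2
    simp [adMatrixOver, this]
  rw [expAd_val, Matrix.add_mulVec, Matrix.one_mulVec, Matrix.smul_mulVec, Matrix.mulVec_single]
  simp [hi]

end Representation

/-! ### Products of commuting families of homomorphisms. -/

section Products

variable {ι A G G' : Type*} [Fintype ι] [DecidableEq ι] [AddCommGroup A] [Group G] [Group G']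

/-- A family of homomorphisms `A → G` with commuting images. -/
def CommFamily (y : ι → Multiplicative A →* G) : Prop :=
  Pairwise fun i j => ∀ a b, Commute (y i a) (y j b)

/-- The homomorphism `(ι → A) → G` attached to a family of homomorphisms with commuting images. -/
noncomputable def prodHom (y : ι → Multiplicative A →* G) (hy : CommFamily y) (v : ι → A) : G :=
  MonoidHom.noncommPiCoprod y hy fun i => Multiplicative.ofAdd (v i)

variable {y : ι → Multiplicative A →* G} (hy : CommFamily y)

lemma prodHom_add (v w : ι → A) : prodHom y hy (v + w) = prodHom y hy v * prodHom y hy w :=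
  map_mul (MonoidHom.noncommPiCoprod y hy) (fun i => Multiplicative.ofAdd (v i))
    (fun i => Multiplicative.ofAdd (w i))

lemma prodHom_zero : prodHom y hy 0 = 1 := map_one (MonoidHom.noncommPiCoprod y hy)

lemma prodHom_neg (v : ι → A) : prodHom y hy (-v) = (prodHom y hy v)⁻¹ := by
  rw [eq_inv_iff_mul_eq_one, ← prodHom_add, neg_add_cancel, prodHom_zero]

lemma prodHom_single (i : ι) (a : A) :
    prodHom y hy (Pi.single i a) = y i (Multiplicative.ofAdd a) := by
  have h := MonoidHom.noncommPiCoprod_mulSingle (ϕ := y) (hcomm := hy) i (Multiplicative.ofAdd a)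
  rw [← h]
  refine congrArg _ (funext fun j => ?_)
  change Multiplicative.ofAdd (Pi.single (M := fun _ => A) i a j) =
    Pi.mulSingle (M := fun _ => Multiplicative A) i (Multiplicative.ofAdd a) j
  by_cases hj : j = i
  · subst hj; rw [Pi.single_eq_same, Pi.mulSingle_eq_same]
  · rw [Pi.single_eq_of_ne hj, Pi.mulSingle_eq_of_ne hj]; rfl

lemma support_induction {S : Set ι} {p : (ι → A) → Prop} (h0 : p 0)
    (hadd : ∀ v w, p v → p w → p (v + w)) {v : ι → A} (hs : ∀ i ∈ S, p (Pi.single i (v i)))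
    (hv : ∀ i ∉ S, v i = 0) : p v := by
  rw [← Finset.univ_sum_single v]
  refine Finset.sum_induction _ p hadd h0 fun i _ => ?_
  by_cases hi : i ∈ S
  · exact hs i hi
  · rw [hv i hi, Pi.single_zero]; exact h0

lemma prodHom_mem {K : Subgroup G} {v : ι → A} (h : ∀ i, y i (Multiplicative.ofAdd (v i)) ∈ K) :
    prodHom y hy v ∈ K := by
  rw [← Finset.univ_sum_single v]
  have key (s : Finset ι) : prodHom y hy (∑ i ∈ s, Pi.single i (v i)) ∈ K := by
    induction s using Finset.induction_on with
    | empty => rw [Finset.sum_empty, prodHom_zero]; exact K.one_mem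
    | insert a s ha ih =>
      rw [Finset.sum_insert ha, prodHom_add, prodHom_single]
      exact K.mul_mem (h a) ih
  exact key _

/-- Two products agree if their factors do. -/
lemma map_prodHom_eq {y' : ι → Multiplicative A →* G'} (hy' : CommFamily y') (f : G →* G')
    {v : ι → A}
    (h : ∀ i, f (y i (Multiplicative.ofAdd (v i))) = y' i (Multiplicative.ofAdd (v i))) :
    f (prodHom y hy v) = prodHom y' hy' v := by
  rw [← Finset.univ_sum_single v]
  have key (s : Finset ι) : f (prodHom y hy (∑ i ∈ s, Pi.single i (v i))) =
      prodHom y' hy' (∑ i ∈ s, Pi.single i (v i)) := by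
    induction s using Finset.induction_on with
    | empty => rw [Finset.sum_empty, prodHom_zero, prodHom_zero, map_one]
    | insert a s ha ih =>
      rw [Finset.sum_insert ha, prodHom_add, prodHom_add, map_mul, ih, prodHom_single,
        prodHom_single, h]
  exact key _

end Products

/-! ### Radicals in Steinberg groups and generation of G₁ in rank one. -/

section Radical

variable {ι : Type u} {M V L : Type*} [AddCommGroup M] [Module ℝ M] [AddCommGroup V]
    [Module ℝ V] [LieRing L] [LieAlgebra ℂ L] [FiniteDimensional ℂ L] [LieAlgebra.IsKilling ℂ L]
    {P : RootPairing ι ℝ M V} [P.IsCrystallographic] [IsSimplyLaced P]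
    {H : LieSubalgebra ℂ L} [H.IsCartanSubalgebra]
    {B : ChevalleyBasis P H}

namespace St

open scoped commutatorElement

variable {A : Type v} [CommRing A]

lemma x_zero {Ψ : Subsystem P} (α : Ψ) : x B α (0 : A) = 1 := by
  have := x_add (B := B) α (0 : A) 0
  rw [add_zero] at this
  exact mul_eq_left.mp this

lemma x_neg {Ψ : Subsystem P} (α : Ψ) (r : A) : x B α (-r) = (x B α r)⁻¹ := by
  rw [eq_inv_iff_mul_eq_one, x_add, neg_add_cancel, x_zero]

lemma induction {Ψ : Subsystem P} {p : St B Ψ A → Prop} (h1 : p 1)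
    (hx : ∀ α r g, p g → p (x B α r * g)) (g : St B Ψ A) : p g := by
  have hg : g ∈ Subgroup.closure (Set.range (PresentedGroup.of (rels :=
      {w : FreeGroup (Ψ × A) | Relator B Ψ A w}))) := by
    rw [PresentedGroup.closure_range_of]; trivial
  induction hg using Subgroup.closure_induction_left with
  | one => exact h1
  | mul_left a ha b hb ih =>
    obtain ⟨⟨α, r⟩, rfl⟩ := ha
    exact hx α r b ih
  | inv_mul_cancel a ha b hb ih =>
    obtain ⟨⟨α, r⟩, rfl⟩ := ha
    have h2 := hx α (-r) b ih
    rw [x_neg] at h2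
    exact h2

lemma hom_ext {Ψ : Subsystem P} {G : Type*} [Group G] {f f' : St B Ψ A →* G}
    (h : ∀ α r, f (x B α r) = f' (x B α r)) : f = f' :=
  PresentedGroup.ext fun a => h a.1 a.2

lemma x_commute_of_nonneg {Ψ : Subsystem P} (α β : Ψ)
    (h : 0 ≤ P.pairingIn ℤ α β) (r s : A) : Commute (x B α r) (x B β s) := by
  rw [commute_iff_eq, ← commutatorElement_eq_one_iff_mul_comm]
  refine x_commute α β r s (fun h0 => ?_) fun γ hγ => not_pairingIn_nonneg_of_add hγ h
  have := pairingIn_of_add_eq_zero h0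
  omega

/-- The homomorphism `r ↦ x_α(r)`. -/
def xHom (B : ChevalleyBasis P H) {Ψ : Subsystem P} (α : Ψ) : Multiplicative A →* St B Ψ A where
  toFun r := x B α r.toAdd
  map_one' := x_zero α
  map_mul' _ _ := (x_add α _ _).symm

open Classical in
/-- The root homomorphisms of `St(Ψ, A)` for the roots in `U`. -/
noncomputable def xFamily (B : ChevalleyBasis P H) (Ψ : Subsystem P) (U : Set ι) (A : Type v)
    [CommRing A] (γ : ι) : Multiplicative A →* St B Ψ A :=
  if h : γ ∈ U ∧ γ ∈ Ψ then xHom B ⟨γ, h.2⟩ else 1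

lemma xFamily_apply {Ψ : Subsystem P} {U : Set ι} {γ : ι} (hU : γ ∈ U) (hγ : γ ∈ Ψ) (r : A) :
    xFamily B Ψ U A γ (Multiplicative.ofAdd r) = x B ⟨γ, hγ⟩ r := by
  rw [xFamily, dif_pos ⟨hU, hγ⟩]; rfl

lemma xFamily_eq_one {Ψ : Subsystem P} {U : Set ι} {γ : ι} (h : ¬ (γ ∈ U ∧ γ ∈ Ψ)) :
    xFamily B Ψ U A γ = 1 := by
  rw [xFamily, dif_neg h]

lemma xFamily_commFamily {Ψ₀ : Subsystem P} (Ψ : Subsystem P) {U : Set ι} (hU : IsRadical Ψ₀ U) :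
    CommFamily (xFamily B Ψ U A) := by
  intro i j _ a b
  by_cases hi : i ∈ U ∧ i ∈ Ψ
  · by_cases hj : j ∈ U ∧ j ∈ Ψ
    · rw [← ofAdd_toAdd a, ← ofAdd_toAdd b, xFamily_apply hi.1 hi.2, xFamily_apply hj.1 hj.2]
      exact x_commute_of_nonneg _ _ (hU.pairingIn_nonneg hi.1 hj.1) _ _
    · rw [xFamily_eq_one hj]; exact Commute.one_right _
  · rw [xFamily_eq_one hi]; exact Commute.one_left _

variable [Fintype ι] [DecidableEq ι]

/-- Conjugation by `St(Ψ₀, A)` on the radical is given by the adjoint representation. -/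
lemma conj_prodHom {Ψ₀ Ψ : Subsystem P} (h : Ψ₀ ≤ Ψ) {U : Set ι} (hU : IsRadical Ψ₀ U)
    (g : St B Ψ₀ A) : ∀ {v : ι → A}, (∀ i ∉ U ∩ Ψ, v i = 0) →
      (∀ i ∉ U ∩ Ψ, (radicalRep B hU A g : Matrix ι ι A).mulVec v i = 0) ∧
      map B h (RingHom.id A) g * prodHom _ (xFamily_commFamily Ψ hU) v *
        (map B h (RingHom.id A) g)⁻¹ =
        prodHom _ (xFamily_commFamily (B := B) Ψ hU)
          ((radicalRep B hU A g : Matrix ι ι A).mulVec v) := by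
  induction g using St.induction with
  | h1 =>
    intro v hv
    simp only [map_one, Units.val_one, Matrix.one_mulVec, one_mul, inv_one, mul_one, and_true]
    exact hv
  | hx β r g ih =>
    intro v hv
    obtain ⟨h1, h2⟩ := ih hv
    have h3 (a b w : St B Ψ A) : a * b * w * (a * b)⁻¹ = a * (b * w * b⁻¹) * a⁻¹ := by
      simp only [mul_inv_rev, mul_assoc]
    rw [map_mul, map_mul, Units.val_mul, ← Matrix.mulVec_mulVec, h3, h2, map_x, radicalRep_x]
    generalize (radicalRep B hU A g : Matrix ι ι A).mulVec v = w at h1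
    -- Both sides are multiplicative in w, so a single root γ suffices, where the claim is the
    -- Chevalley commutator formula. Support in Ψ persists because Ψ is closed under sums.
    refine support_induction (S := U ∩ Ψ) (p := fun w => (∀ i ∉ U ∩ Ψ,
        (expAd B U β r : Matrix ι ι A).mulVec w i = 0) ∧
        x B (Subsystem.incl h β) (RingHom.id A r) * prodHom _ (xFamily_commFamily Ψ hU) w *
        (x B (Subsystem.incl h β) (RingHom.id A r))⁻¹ =
        prodHom _ (xFamily_commFamily (B := B) Ψ hU)
          ((expAd B U β r : Matrix ι ι A).mulVec w)) ?_ ?_ ?_ h1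
    · simp [prodHom_zero]
    · rintro v w ⟨h3, h4⟩ ⟨h5, h6⟩
      refine ⟨fun i hi => ?_, ?_⟩
      · rw [Matrix.mulVec_add, Pi.add_apply, h3 i hi, h5 i hi, add_zero]
      · rw [Matrix.mulVec_add, prodHom_add, prodHom_add, ← h4, ← h6]
        group
    · intro γ hγ
      generalize w γ = s
      by_cases hδ : ∃ δ, P.root δ = P.root β + P.root γ
      · obtain ⟨δ, hδ⟩ := hδ
        have hδU : δ ∈ U := hU.add_mem β.2 hγ.1 hδ
        have hδΨ : δ ∈ Ψ := Ψ.add_mem (h β.2) hγ.2 hδ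
        rw [expAd_mulVec_single_of_add hγ.1 hδ]
        refine ⟨fun i hi => ?_, ?_⟩
        · rw [Pi.add_apply, Pi.single_eq_of_ne (by rintro rfl; exact hi ⟨hδU, hδΨ⟩),
            Pi.single_eq_of_ne (by rintro rfl; exact hi hγ), add_zero]
        · rw [prodHom_add, prodHom_single, prodHom_single, xFamily_apply hγ.1 hγ.2,
            xFamily_apply hδU hδΨ]
          exact conj_of_commutator (x_commutator (Subsystem.incl h β) ⟨γ, hγ.2⟩ ⟨δ, hδΨ⟩ r s hδ)
      · push Not at hδ
        rw [expAd_mulVec_single (fun _ => hδ)]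
        refine ⟨fun i hi => Pi.single_eq_of_ne (by rintro rfl; exact hi hγ) _, ?_⟩
        rw [prodHom_single, xFamily_apply hγ.1 hγ.2]
        have h3 := conj_of_commutator (x_commute (B := B) (Subsystem.incl h β) ⟨γ, hγ.2⟩ r s
          (hU.add_ne_zero β.2 hγ.1) fun δ => hδ δ)
        rw [one_mul] at h3
        exact h3

end St

variable {R : Type v} [CommRing R] {I : Ideal R}

/-- The diagonal embedding `R → D(R, I)`. -/
def diag (I : Ideal R) : R →+* double I where
  toFun r := ⟨(r, r), by change r - r ∈ I; rw [sub_self]; exact I.zero_mem⟩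
  map_one' := rfl
  map_mul' _ _ := rfl
  map_zero' := rfl
  map_add' _ _ := rfl

lemma p₁_diag (r : R) : p₁ I (diag I r) = r := rfl

lemma p₂_diag (r : R) : p₂ I (diag I r) = r := rfl

lemma mem_G₁ {Ψ : Subsystem P} {g : St B Ψ (double I)} :
    g ∈ G₁ B Ψ I ↔ St.map B (le_refl Ψ) (p₁ I) g = 1 := Iff.rfl

lemma mem_G₂ {Ψ : Subsystem P} {g : St B Ψ (double I)} :
    g ∈ G₂ B Ψ I ↔ St.map B (le_refl Ψ) (p₂ I) g = 1 := Iff.rfl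

lemma x_mem_G₁ {Ψ : Subsystem P} (α : Ψ) {d : double I} (h : p₁ I d = 0) :
    St.x B α d ∈ G₁ B Ψ I := by
  rw [mem_G₁, St.map_x, h, St.x_zero]

lemma x_mem_G₂ {Ψ : Subsystem P} (α : Ψ) {d : double I} (h : p₂ I d = 0) :
    St.x B α d ∈ G₂ B Ψ I := by
  rw [mem_G₂, St.map_x, h, St.x_zero]

variable [Fintype ι] [DecidableEq ι]

/-- Applied with p₁ to elements of G₁ and with p₂ to elements of G₂: they move vectors only by
vectors in the kernel of the projection. -/
lemma radicalRep_congr {A A' : Type v} [CommRing A] [CommRing A'] {Ψ : Subsystem P} {U : Set ι}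
    (hU : IsRadical Ψ U) (f : A →+* A') {g : St B Ψ A} (hg : St.map B (le_refl Ψ) f g = 1)
    (v : ι → A) (i : ι) : f ((radicalRep B hU A g : Matrix ι ι A).mulVec v i) = f (v i) := by
  have h := radicalRep_map_mulVec (le_refl Ψ) hU f g v
  rw [hg, map_one, Units.val_one, Matrix.one_mulVec] at h
  exact (congrFun h i).symm

/-- Write x g x⁻¹ = x (g x g⁻¹)⁻¹ g; the first two factors lie in the radical, where conjugation by
g is linear. -/
lemma x_conj_eq {Ψ₀ Ψ : Subsystem P} (h : Ψ₀ ≤ Ψ) {U : Set ι} (hU : IsRadical Ψ₀ U)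
    {α : ι} (hα : α ∈ U) (hα' : α ∈ Ψ) {A : Type v} [CommRing A] (r : A) (g : St B Ψ₀ A) :
    St.x B ⟨α, hα'⟩ r * St.map B h (RingHom.id A) g * (St.x B ⟨α, hα'⟩ r)⁻¹ =
      prodHom _ (St.xFamily_commFamily (B := B) Ψ hU)
        (Pi.single α r - (radicalRep B hU A g : Matrix ι ι A).mulVec (Pi.single α r)) *
        St.map B h (RingHom.id A) g := by
  have h1 := (St.conj_prodHom h hU g (v := Pi.single α r) (fun i hi =>
    Pi.single_eq_of_ne (by rintro rfl; exact hi ⟨hα, hα'⟩) _)).2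
  rw [sub_eq_add_neg, prodHom_add, prodHom_neg, ← h1, prodHom_single, St.xFamily_apply hα hα']
  simp only [mul_inv_rev, mul_assoc, inv_inv, inv_mul_cancel, mul_one]

/-- The subgroup generated by the groups `G₁` of the subsystems `{±β}` of `Ψ`. -/
def rankOneSubgroup (B : ChevalleyBasis P H) (Ψ : Subsystem P) (I : Ideal R) :
    Subgroup (St B Ψ (double I)) :=
  ⨆ β : Ψ, (G₁ B (pair P β) I).map (St.map B (pair_le β.2) (RingHom.id _))

lemma map_mem_rankOneSubgroup {Ψ : Subsystem P} {β : ι} (hβ : β ∈ Ψ)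
    {g : St B (pair P β) (double I)} (hg : g ∈ G₁ B (pair P β) I) :
    St.map B (pair_le hβ) (RingHom.id _) g ∈ rankOneSubgroup B Ψ I :=
  le_iSup (fun β : Ψ => (G₁ B (pair P β) I).map (St.map B (pair_le β.2) (RingHom.id _))) ⟨β, hβ⟩
    ⟨g, hg, rfl⟩

lemma x_mem_rankOneSubgroup {Ψ : Subsystem P} (α : Ψ) {d : double I} (h : p₁ I d = 0) :
    St.x B α d ∈ rankOneSubgroup B Ψ I := by
  have h1 := map_mem_rankOneSubgroup α.2 (x_mem_G₁ (B := B) ⟨α.1, mem_pair α.1⟩ h)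
  rw [St.map_x] at h1
  exact h1

/-- Conjugating g ∈ G₁({±β}) by x_α(d) stays in G₁({±β}) if α = ±β. Otherwise it multiplies g by a
product of elements x_i(c) from a radical, and p₁(c) = 0 because g ∈ G₁. -/
instance rankOneSubgroup_normal (Ψ : Subsystem P) : (rankOneSubgroup B Ψ I).Normal := by
  refine ⟨fun t ht g => ?_⟩
  revert t
  induction g using St.induction with
  | h1 => intro t ht; simpa using ht
  | hx α d g ih =>
    intro t ht
    have h1 (a b w : St B Ψ (double I)) : a * b * w * (a * b)⁻¹ = a * (b * w * b⁻¹) * a⁻¹ := by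
      simp only [mul_inv_rev, mul_assoc]
    rw [h1]
    have h2 : rankOneSubgroup B Ψ I ≤
        (rankOneSubgroup B Ψ I).comap (MulAut.conj (St.x B α d)).toMonoidHom := by
      refine iSup_le fun β => ?_
      rintro _ ⟨k, hk, rfl⟩
      change St.x B α d * _ * (St.x B α d)⁻¹ ∈ rankOneSubgroup B Ψ I
      by_cases hα : (α : ι) ∈ pair P β
      · have h3 := map_mem_rankOneSubgroup β.2
          ((inferInstance : (G₁ B (pair P β) I).Normal).conj_mem k hk (St.x B ⟨α, hα⟩ d))
        rw [map_mul, map_mul, map_inv, St.map_x] at h3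
        exact h3
      · have hU := isRadical_pair hα
        rw [x_conj_eq (pair_le β.2) hU (self_mem_radical _ _) α.2]
        refine Subgroup.mul_mem _ (prodHom_mem _ fun i => ?_) (map_mem_rankOneSubgroup β.2 hk)
        by_cases hi : i ∈ radical (pair P β) α ∧ i ∈ Ψ
        · rw [St.xFamily_apply hi.1 hi.2]
          refine x_mem_rankOneSubgroup _ ?_
          rw [Pi.sub_apply, map_sub, radicalRep_congr hU _ hk, sub_self]
        · rw [St.xFamily_eq_one hi]; exact Subgroup.one_mem _
    exact h2 (ih t ht)

/-- `G₁(Ψ)` is generated by the groups `G₁` of the subsystems of type `A₁`. -/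
lemma G₁_le_rankOneSubgroup (Ψ : Subsystem P) : G₁ B Ψ I ≤ rankOneSubgroup B Ψ I := by
  intro g hg
  let π := QuotientGroup.mk' (rankOneSubgroup B Ψ I)
  -- Modulo the rank-one subgroup x_α(d) agrees with x_α(Δp₁(d)), so the quotient map factors
  -- through p₁.
  have h1 : (π.comp (St.map B (le_refl Ψ) (diag I))).comp (St.map B (le_refl Ψ) (p₁ I)) = π := by
    refine St.hom_ext fun α d => ?_
    change π (St.map B _ _ (St.map B _ _ _)) = _
    rw [St.map_x, St.map_x]
    change (QuotientGroup.mk _ : _ ⧸ rankOneSubgroup B Ψ I) = QuotientGroup.mk _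
    rw [QuotientGroup.eq, ← St.x_neg]
    change St.x B α _ * _ ∈ rankOneSubgroup B Ψ I
    rw [St.x_add]
    refine x_mem_rankOneSubgroup _ ?_
    rw [map_add, map_neg, p₁_diag, neg_add_cancel]
  have h2 : π g = 1 := by
    rw [← h1, MonoidHom.comp_apply, mem_G₁.mp hg, map_one]
  exact (QuotientGroup.eq_one_iff g).mp h2

lemma G₁_induction {Ψ : Subsystem P} {p : G₁ B Ψ I → Prop} (h1 : p 1)
    (hmul : ∀ g g', p g → p g' → p (g * g')) (hinv : ∀ g, p g → p g⁻¹)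
    (hβ : ∀ β (hβ : β ∈ Ψ) (g : G₁ B (pair P β) I), p (G₁.map B I (pair_le hβ) g))
    (g : G₁ B Ψ I) : p g := by
  let K : Subgroup (St B Ψ (double I)) :=
    { carrier := {g | ∃ h : g ∈ G₁ B Ψ I, p ⟨g, h⟩}
      one_mem' := ⟨Subgroup.one_mem _, h1⟩
      mul_mem' := fun ⟨h, k⟩ ⟨h', k'⟩ => ⟨Subgroup.mul_mem _ h h', hmul _ _ k k'⟩
      inv_mem' := fun ⟨h, k⟩ => ⟨Subgroup.inv_mem _ h, hinv _ k⟩ }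
  have hK : rankOneSubgroup B Ψ I ≤ K := by
    refine iSup_le fun β => ?_
    rintro _ ⟨k, hk, rfl⟩
    exact ⟨map_mem_G₁ B I _ hk, hβ β β.2 ⟨k, hk⟩⟩
  obtain ⟨_, h⟩ := hK (G₁_le_rankOneSubgroup Ψ g.2)
  exact h

/-- A homomorphism on `G₁(Ψ)` is determined by its values on the subsystems of type `A₁`. -/
lemma G₁_hom_ext {Ψ : Subsystem P} {G : Type*} [Group G] {f f' : G₁ B Ψ I →* G}
    (h : ∀ β (hβ : β ∈ Ψ) (g : G₁ B (pair P β) I),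
      f (G₁.map B I (pair_le hβ) g) = f' (G₁.map B I (pair_le hβ) g)) : f = f' := by
  ext g
  induction g using G₁_induction with
  | h1 => rw [map_one, map_one]
  | hmul g g' h h' => rw [map_mul, map_mul, h, h']
  | hinv g h => rw [map_inv, map_inv, h]
  | hβ β hβ g => exact h β hβ g

lemma RelSt.hom_ext {Ψ : Subsystem P} {G : Type*} [Group G] {f f' : RelSt B Ψ I →* G}
    (h : ∀ β (hβ : β ∈ Ψ) (g : RelSt B (pair P β) I),
      f (RelSt.map B I (pair_le hβ) g) = f' (RelSt.map B I (pair_le hβ) g)) : f = f' :=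
  QuotientGroup.monoidHom_ext _ (G₁_hom_ext fun β hβ g => h β hβ (QuotientGroup.mk g))

end Radical

/-! ### The amalgam and its radicals. -/

section Amalgam

variable {ι : Type u} {M V L : Type*} [AddCommGroup M] [Module ℝ M] [AddCommGroup V]
    [Module ℝ V] [LieRing L] [LieAlgebra ℂ L] [FiniteDimensional ℂ L] [LieAlgebra.IsKilling ℂ L]
    {P : RootPairing ι ℝ M V} [P.IsCrystallographic] [IsSimplyLaced P]
    {H : LieSubalgebra ℂ L} [H.IsCartanSubalgebra]
    (B : ChevalleyBasis P H) {R : Type v} [CommRing R] (I : Ideal R)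

/-- The relations of the amalgam of the relative Steinberg groups of the subsystems of type `A₁`
and `A_n`. -/
inductive AmalgamRel (n : ℕ) :
    Monoid.CoprodI (fun Ψ : {Ψ // bipartite P n Ψ} => G₁ B Ψ.1 I) → Prop
  | commutator (Ψ : {Ψ // bipartite P n Ψ}) (g : G₁ B Ψ.1 I)
      (h : (g : St B Ψ.1 (double I)) ∈ ⁅G₁ B Ψ.1 I, G₂ B Ψ.1 I⁆) :
      AmalgamRel n (Monoid.CoprodI.of g)
  | map (Ψ₁ Ψ₂ : {Ψ // bipartite P n Ψ}) (h : Ψ₁.1 ≤ Ψ₂.1) (g : G₁ B Ψ₁.1 I) :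
      AmalgamRel n (Monoid.CoprodI.of (i := Ψ₂) (G₁.map B I h g) *
        (Monoid.CoprodI.of (i := Ψ₁) g)⁻¹)

/-- The amalgam of the relative Steinberg groups of the subsystems of type `A₁` and `A_n`. -/
abbrev Amalgam (n : ℕ) : Type (max u v) :=
  Monoid.CoprodI (fun Ψ : {Ψ // bipartite P n Ψ} => G₁ B Ψ.1 I) ⧸
    Subgroup.normalClosure {w | AmalgamRel B I n w}

namespace Amalgam

variable {B I} {n : ℕ}

/-- The homomorphism from `G₁(Ψ)` to the amalgam. -/
def leg {Ψ : Subsystem P} (hΨ : bipartite P n Ψ) : G₁ B Ψ I →* Amalgam B I n :=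
  (QuotientGroup.mk' _).comp
    (Monoid.CoprodI.of (M := fun Ψ : {Ψ // bipartite P n Ψ} => G₁ B Ψ.1 I) (i := ⟨Ψ, hΨ⟩))

lemma leg_eq_one {Ψ : Subsystem P} (hΨ : bipartite P n Ψ) {g : G₁ B Ψ I}
    (h : (g : St B Ψ (double I)) ∈ ⁅G₁ B Ψ I, G₂ B Ψ I⁆) : leg hΨ g = 1 :=
  (QuotientGroup.eq_one_iff _).mpr
    (Subgroup.subset_normalClosure (AmalgamRel.commutator (n := n) ⟨Ψ, hΨ⟩ g h))

lemma leg_map {Ψ₁ Ψ₂ : Subsystem P} (h₁ : bipartite P n Ψ₁) (h₂ : bipartite P n Ψ₂)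
    (h : Ψ₁ ≤ Ψ₂) (g : G₁ B Ψ₁ I) : leg h₂ (G₁.map B I h g) = leg h₁ g := by
  rw [← mul_inv_eq_one, ← map_inv]
  exact (QuotientGroup.eq_one_iff _).mpr
    (Subgroup.subset_normalClosure (AmalgamRel.map (n := n) ⟨Ψ₁, h₁⟩ ⟨Ψ₂, h₂⟩ h g))

lemma exists_lift {G : Type*} [Group G] (s : ∀ Ψ : Subsystem P, bipartite P n Ψ → G₁ B Ψ I →* G)
    (hs : ∀ Ψ hΨ (g : G₁ B Ψ I), (g : St B Ψ (double I)) ∈ ⁅G₁ B Ψ I, G₂ B Ψ I⁆ → s Ψ hΨ g = 1)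
    (hs' : ∀ Ψ₁ Ψ₂ h₁ h₂ (h : Ψ₁ ≤ Ψ₂) g, s Ψ₂ h₂ (G₁.map B I h g) = s Ψ₁ h₁ g) :
    ∃ f : Amalgam B I n →* G, ∀ Ψ hΨ g, f (leg (Ψ := Ψ) hΨ g) = s Ψ hΨ g := by
  refine ⟨QuotientGroup.lift _ (Monoid.CoprodI.lift fun Ψ => s Ψ.1 Ψ.2) ?_, fun Ψ hΨ g => ?_⟩
  · have h : Subgroup.normalClosure {w | AmalgamRel B I n w} ≤
        (Monoid.CoprodI.lift fun Ψ : {Ψ // bipartite P n Ψ} => s Ψ.1 Ψ.2).ker := by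
      refine Subgroup.normalClosure_le_normal ?_
      rintro w (⟨Ψ, g, h⟩ | ⟨Ψ₁, Ψ₂, h, g⟩)
      · change Monoid.CoprodI.lift _ _ = 1
        rw [Monoid.CoprodI.lift_of]
        exact hs _ _ _ h
      · change Monoid.CoprodI.lift _ _ = 1
        rw [map_mul, map_inv, Monoid.CoprodI.lift_of, Monoid.CoprodI.lift_of, mul_inv_eq_one]
        exact hs' _ _ _ _ h g
    exact h
  · exact Monoid.CoprodI.lift_of (fun Ψ : {Ψ // bipartite P n Ψ} => s Ψ.1 Ψ.2) (i := ⟨Ψ, hΨ⟩) g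

lemma hom_ext_leg {G : Type*} [Group G] {f f' : Amalgam B I n →* G}
    (h : ∀ Ψ hΨ g, f (leg (Ψ := Ψ) hΨ g) = f' (leg hΨ g)) : f = f' := by
  refine QuotientGroup.monoidHom_ext _ (Monoid.CoprodI.ext_hom _ _ fun Ψ => ?_)
  ext g
  exact h Ψ.1 Ψ.2 g

/-- The homomorphism from `G₁({±β})` to the amalgam. -/
def legOne (n : ℕ) (β : ι) : G₁ B (pair P β) I →* Amalgam B I n := leg (Or.inl (pair_isOfType β))

lemma leg_map_pair {Ψ : Subsystem P} (hΨ : bipartite P n Ψ) {β : ι} (hβ : β ∈ Ψ)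
    (g : G₁ B (pair P β) I) : leg hΨ (G₁.map B I (pair_le hβ) g) = legOne n β g :=
  leg_map _ _ _ _

end Amalgam

lemma G₁.map_map {B : ChevalleyBasis P H} {I : Ideal R} {Ψ₁ Ψ₂ Ψ₃ : Subsystem P} (h : Ψ₁ ≤ Ψ₂)
    (h' : Ψ₂ ≤ Ψ₃) (g : G₁ B Ψ₁ I) :
    G₁.map B I h' (G₁.map B I h g) = G₁.map B I (h.trans h') g :=
  Subtype.ext (St.map_map (B := B) h h' (RingHom.id _) (RingHom.id _) g.1)

namespace Amalgam

variable {B I} {n : ℕ} [Fintype ι] [DecidableEq ι]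

lemma hom_ext {G : Type*} [Group G] {f f' : Amalgam B I n →* G}
    (h : ∀ β g, f (legOne n β g) = f' (legOne n β g)) : f = f' := by
  refine hom_ext_leg fun Ψ hΨ g => ?_
  have : f.comp (leg hΨ) = f'.comp (leg hΨ) := G₁_hom_ext fun β hβ g => by
    rw [MonoidHom.comp_apply, MonoidHom.comp_apply, leg_map_pair hΨ hβ]
    exact h β g
  exact DFunLike.congr_fun this g

/-- The images of a common subsystem under two legs agree. -/
lemma leg_map_eq {Ψ₀ Ψ₁ Ψ₂ : Subsystem P} (h₁ : bipartite P n Ψ₁) (h₂ : bipartite P n Ψ₂)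
    (h : Ψ₀ ≤ Ψ₁) (h' : Ψ₀ ≤ Ψ₂) (g : G₁ B Ψ₀ I) :
    leg h₁ (G₁.map B I h g) = leg h₂ (G₁.map B I h' g) := by
  -- The common subsystem need not have type A₁ or A_n; it is enough that its A₁'s belong to the
  -- diagram.
  have : (leg h₁).comp (G₁.map B I h) = (leg h₂).comp (G₁.map B I h') := G₁_hom_ext fun β hβ g => by
    rw [MonoidHom.comp_apply, MonoidHom.comp_apply, G₁.map_map, G₁.map_map,
      leg_map_pair h₁ (h hβ), leg_map_pair h₂ (h' hβ)]
  exact DFunLike.congr_fun this g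

end Amalgam

/-- The homomorphism `d ↦ x_α(d - p₁(d))` to `G₁(Ψ)`. -/
def relX (B : ChevalleyBasis P H) {I : Ideal R} {Ψ : Subsystem P} (α : Ψ) :
    Multiplicative (double I) →* G₁ B Ψ I where
  -- Removing the diagonal part extends x_α from Ker p₁ to all of D(R, I), so that vectors over D(R,
  -- I) can be used as arguments of products.
  toFun d := ⟨St.x B α (d.toAdd - diag I (p₁ I d.toAdd)), x_mem_G₁ _ (by
    rw [map_sub, p₁_diag, sub_self])⟩
  map_one' := Subtype.ext (by
    change St.x B α ((0 : double I) - diag I (p₁ I 0)) = 1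
    rw [map_zero, map_zero, sub_zero, St.x_zero])
  map_mul' c d := Subtype.ext (by
    change St.x B α (c.toAdd + d.toAdd - diag I (p₁ I (c.toAdd + d.toAdd))) =
      St.x B α (c.toAdd - diag I (p₁ I c.toAdd)) * St.x B α (d.toAdd - diag I (p₁ I d.toAdd))
    rw [St.x_add, map_add, map_add]
    congr 1; abel)

variable {B I}

lemma relX_coe {Ψ : Subsystem P} (α : Ψ) (d : double I) :
    (relX B α (Multiplicative.ofAdd d) : St B Ψ (double I)) =
      St.x B α (d - diag I (p₁ I d)) := rfl

lemma relX_coe_of {Ψ : Subsystem P} (α : Ψ) {d : double I} (hd : p₁ I d = 0) :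
    (relX B α (Multiplicative.ofAdd d) : St B Ψ (double I)) = St.x B α d := by
  rw [relX_coe, hd, map_zero, sub_zero]

lemma map_relX {Ψ₁ Ψ₂ : Subsystem P} (h : Ψ₁ ≤ Ψ₂) (α : Ψ₁) (d : Multiplicative (double I)) :
    G₁.map B I h (relX B α d) = relX B (Subsystem.incl h α) d :=
  Subtype.ext (St.map_x (B := B) h (RingHom.id _) α _)

namespace Amalgam

variable (B I) in
/-- The image of `x_γ(d - p₁(d))` in the amalgam. -/
def y (n : ℕ) (γ : ι) : Multiplicative (double I) →* Amalgam B I n :=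
  (legOne n γ).comp (relX B ⟨γ, mem_pair γ⟩)

lemma leg_relX {n : ℕ} {Ψ : Subsystem P} (hΨ : bipartite P n Ψ) (γ : Ψ)
    (d : Multiplicative (double I)) : leg hΨ (relX B γ d) = y B I n γ d := by
  rw [y, MonoidHom.comp_apply, ← leg_map_pair hΨ γ.2, map_relX]
  rfl

open Classical in
variable (B I) in
/-- The homomorphisms `y_γ` for the roots in `U`. -/
noncomputable def yFamily (n : ℕ) (U : Set ι) (γ : ι) :
    Multiplicative (double I) →* Amalgam B I n :=
  if γ ∈ U then y B I n γ else 1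

variable [Fintype ι] [DecidableEq ι] [P.IsRootSystem] [P.IsIrreducible]
  (hr : 3 ≤ Module.finrank ℝ M)

include hr

/-- Two roots of U lie in a common A₃, and there their root elements commute. -/
lemma yFamily_commFamily {Ψ₀ : Subsystem P} {U : Set ι} (hU : IsRadical Ψ₀ U) :
    CommFamily (yFamily B I 3 U) := by
  intro i j _ a b
  rw [yFamily, yFamily]
  split_ifs with hi hj
  · obtain ⟨Ψ, h1, h2, h3⟩ := exists_isAThree_pair (P := P) hr i j
    have h4 : bipartite P 3 Ψ := Or.inr h1
    rw [← leg_relX h4 ⟨i, h2⟩, ← leg_relX h4 ⟨j, h3⟩]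
    refine Commute.map (Subtype.ext ?_) (leg h4)
    exact St.x_commute_of_nonneg (B := B) (⟨i, h2⟩ : Ψ) ⟨j, h3⟩ (hU.pairingIn_nonneg hi hj) _ _
  · exact Commute.one_right _
  · exact Commute.one_left _
  · exact Commute.one_left _

/-- The product of the `y_γ` in the amalgam is the image of the product of the `x_γ`. -/
lemma leg_eq_prodHom {Ψ₀ Ψ : Subsystem P} (hΨ : bipartite P 3 Ψ) {U : Set ι}
    (hU : IsRadical Ψ₀ U) {v : ι → double I} (hv : ∀ i, p₁ I (v i) = 0)
    (hv' : ∀ i ∉ U ∩ Ψ, v i = 0) (g : G₁ B Ψ I)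
    (hg : (g : St B Ψ (double I)) = prodHom _ (St.xFamily_commFamily Ψ hU) v) :
    leg hΨ g = prodHom _ (yFamily_commFamily hr hU) v := by
  classical
  -- The family is lifted to G₁(Ψ), where the leg can be applied factor by factor.
  let z (γ : ι) : Multiplicative (double I) →* G₁ B Ψ I :=
    if h : γ ∈ U ∧ γ ∈ Ψ then relX B ⟨γ, h.2⟩ else 1
  have hz (γ : ι) (d : double I) : (z γ (Multiplicative.ofAdd d) : St B Ψ (double I)) =
      St.xFamily B Ψ U _ γ (Multiplicative.ofAdd (d - diag I (p₁ I d))) := by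
    by_cases h : γ ∈ U ∧ γ ∈ Ψ
    · rw [St.xFamily_apply h.1 h.2]
      simp only [z, dif_pos h]
      rfl
    · rw [St.xFamily_eq_one h]
      simp only [z, dif_neg h]
      rfl
  have hzc : CommFamily z := fun i j hij a b => Subtype.ext (by
    have := St.xFamily_commFamily (B := B) (A := double I) Ψ hU hij
      (Multiplicative.ofAdd (a.toAdd - diag I (p₁ I a.toAdd)))
      (Multiplicative.ofAdd (b.toAdd - diag I (p₁ I b.toAdd)))
    rw [← hz, ← hz] at this
    exact this)
  have h1 : g = prodHom z hzc v := by
    refine Subtype.ext ?_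
    rw [hg]
    symm
    refine map_prodHom_eq hzc _ (G₁ B Ψ I).subtype fun i => ?_
    rw [Subgroup.subtype_apply, hz, hv i, map_zero, sub_zero]
  rw [h1]
  refine map_prodHom_eq hzc _ (leg hΨ) fun i => ?_
  by_cases h : i ∈ U ∩ Ψ
  · have h' : i ∈ U ∧ i ∈ Ψ := h
    simp only [z, dif_pos h', yFamily, if_pos h'.1]
    exact leg_relX hΨ ⟨i, h'.2⟩ _
  · rw [hv' i h, ofAdd_zero, map_one, map_one, map_one]

omit hr in
lemma mulVec_support {Ψ : Subsystem P} {U : Set ι} (hU : IsRadical Ψ U) (g : St B Ψ (double I))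
    {v : ι → double I} (hv : ∀ i ∉ U, v i = 0) :
    ∀ i ∉ U, (radicalRep B hU _ g : Matrix ι ι (double I)).mulVec v i = 0 := by
  have h := (St.conj_prodHom (B := B) (Ψ := ⊤) le_top hU g (v := v)
    (fun i hi => hv i fun h => hi ⟨h, trivial⟩)).1
  exact fun i hi => h i fun h' => hi h'.1

/-- By additivity in v only one root γ of U matters, and β and γ lie in a common A₃, where
`conj_prodHom` applies. -/
lemma legOne_conj_prodHom {β : ι} {U : Set ι} (hU : IsRadical (pair P β) U)
    (g : G₁ B (pair P β) I) {v : ι → double I} (hv : ∀ i, p₁ I (v i) = 0) (hv' : ∀ i ∉ U, v i = 0) :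
    legOne 3 β g * prodHom _ (yFamily_commFamily hr hU) v * (legOne 3 β g)⁻¹ =
      prodHom _ (yFamily_commFamily hr hU)
        ((radicalRep B hU _ (g : St B _ (double I)) : Matrix ι ι (double I)).mulVec v) := by
  refine support_induction (S := U) (p := fun v =>
    legOne 3 β g * prodHom _ (yFamily_commFamily hr hU) v * (legOne 3 β g)⁻¹ =
      prodHom _ (yFamily_commFamily hr hU)
        ((radicalRep B hU _ (g : St B _ (double I)) : Matrix ι ι (double I)).mulVec v))
    ?_ ?_ ?_ hv'
  · rw [Matrix.mulVec_zero, prodHom_zero]; group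
  · intro v w h1 h2
    rw [Matrix.mulVec_add, prodHom_add, prodHom_add, ← h1, ← h2]
    group
  · intro γ hγ
    have hd := hv γ
    generalize v γ = d at hd
    obtain ⟨Ψ, h1, h2, h3⟩ := exists_isAThree_pair (P := P) hr β γ
    have h4 : bipartite P 3 Ψ := Or.inr h1
    have h5 := St.conj_prodHom (B := B) (pair_le h2) hU g.1 (v := Pi.single γ d)
      (fun i hi => Pi.single_eq_of_ne (by rintro rfl; exact hi ⟨hγ, h3⟩) _)
    have hs (i : ι) : p₁ I ((Pi.single γ d : ι → double I) i) = 0 := by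
      by_cases hi : i = γ
      · subst hi; rw [Pi.single_eq_same, hd]
      · rw [Pi.single_eq_of_ne hi, map_zero]
    rw [prodHom_single, St.xFamily_apply hγ h3, ← relX_coe_of _ hd] at h5
    rw [← leg_eq_prodHom hr h4 hU (fun i => by rw [radicalRep_congr hU _ g.2, hs]) h5.1
      (G₁.map B I (pair_le h2) g * relX B ⟨γ, h3⟩ (Multiplicative.ofAdd d) *
        (G₁.map B I (pair_le h2) g)⁻¹) h5.2, map_mul, map_mul, map_inv, leg_map_pair h4 h2, leg_relX,
      prodHom_single, yFamily, if_pos hγ]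

/-- The legs normalize the images of the radicals. -/
lemma leg_conj_prodHom {Ψ : Subsystem P} (hΨ : bipartite P 3 Ψ) {U : Set ι} (hU : IsRadical Ψ U)
    (g : G₁ B Ψ I) : ∀ {v : ι → double I}, (∀ i, p₁ I (v i) = 0) → (∀ i ∉ U, v i = 0) →
    leg hΨ g * prodHom _ (yFamily_commFamily hr hU) v * (leg hΨ g)⁻¹ =
      prodHom _ (yFamily_commFamily hr hU)
        ((radicalRep B hU _ (g : St B Ψ (double I)) : Matrix ι ι (double I)).mulVec v) := by
  -- Ψ and a root of U need not lie in a common A₃, so the formula is propagated from the rank-one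
  -- generators of G₁(Ψ).
  induction g using G₁_induction with
  | h1 =>
    intro v _ _
    rw [map_one, Subgroup.coe_one, map_one, Units.val_one, Matrix.one_mulVec]
    group
  | hmul g g' ih ih' =>
    intro v hv hv'
    rw [map_mul, Subgroup.coe_mul, map_mul, Units.val_mul, ← Matrix.mulVec_mulVec,
      ← ih (fun i => by rw [radicalRep_congr hU _ g'.2, hv]) (mulVec_support hU _ hv'),
      ← ih' hv hv']
    group
  | hinv g ih =>
    intro v hv hv'
    have h := ih (v := (radicalRep B hU _ ((g⁻¹ : G₁ B Ψ I) : St B Ψ (double I)) :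
      Matrix ι ι (double I)).mulVec v) (fun i => by rw [radicalRep_congr hU _ g⁻¹.2, hv])
      (mulVec_support hU _ hv')
    rw [Matrix.mulVec_mulVec, ← Units.val_mul, ← map_mul, ← Subgroup.coe_mul, mul_inv_cancel,
      Subgroup.coe_one, map_one, Units.val_one, Matrix.one_mulVec] at h
    rw [← h, map_inv]
    group
  | hβ β hβ g =>
    intro v hv hv'
    rw [leg_map_pair hΨ hβ, legOne_conj_prodHom hr (hU.mono (pair_le hβ)) g hv hv']
    congr 2
    have := radicalRep_map (B := B) (pair_le hβ) hU (RingHom.id (double I)) g.1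
    change _ = ((radicalRep B hU _ (St.map B (pair_le hβ) (RingHom.id _) g.1) :
      (Matrix ι ι (double I))ˣ) : Matrix ι ι (double I))
    rw [this]
    exact Matrix.ext fun i j => rfl

end Amalgam

end Amalgam

/-! ### Conjugation by a root element as an endomorphism of the amalgam. -/

section Amalgam

variable {ι : Type u} {M V L : Type*} [AddCommGroup M] [Module ℝ M] [AddCommGroup V]
    [Module ℝ V] [LieRing L] [LieAlgebra ℂ L] [FiniteDimensional ℂ L] [LieAlgebra.IsKilling ℂ L]
    {P : RootPairing ι ℝ M V} [P.IsCrystallographic] [IsSimplyLaced P]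
    {H : LieSubalgebra ℂ L} [H.IsCartanSubalgebra]
    {B : ChevalleyBasis P H} {R : Type v} [CommRing R] {I : Ideal R}

lemma G₁.map_conjNormal {Ψ₁ Ψ₂ : Subsystem P} (h : Ψ₁ ≤ Ψ₂) (x : St B Ψ₁ (double I))
    (g : G₁ B Ψ₁ I) : G₁.map B I h (MulAut.conjNormal x g) =
      MulAut.conjNormal (St.map B h (RingHom.id _) x) (G₁.map B I h g) := by
  refine Subtype.ext ?_
  change St.map B h (RingHom.id _) (MulAut.conjNormal x g : G₁ B Ψ₁ I).1 = _
  rw [MulAut.conjNormal_apply, MulAut.conjNormal_apply, map_mul, map_mul, map_inv]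
  rfl

lemma map_mem_commutator {Ψ₁ Ψ₂ : Subsystem P} (h : Ψ₁ ≤ Ψ₂) {g : St B Ψ₁ (double I)}
    (hg : g ∈ ⁅G₁ B Ψ₁ I, G₂ B Ψ₁ I⁆) :
    St.map B h (RingHom.id _) g ∈ ⁅G₁ B Ψ₂ I, G₂ B Ψ₂ I⁆ := by
  have : ⁅G₁ B Ψ₁ I, G₂ B Ψ₁ I⁆ ≤
      (⁅G₁ B Ψ₂ I, G₂ B Ψ₂ I⁆).comap (St.map B h (RingHom.id (double I))) := by
    rw [Subgroup.commutator_le]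
    intro a ha b hb
    rw [Subgroup.mem_comap, map_commutatorElement]
    exact Subgroup.commutator_mem_commutator (map_mem_G₁ B I h ha) (map_mem_G₂ B I h hb)
  exact this hg

lemma mem_G₂_of_mem_commutator {Ψ : Subsystem P} {g : St B Ψ (double I)}
    (hg : g ∈ ⁅G₁ B Ψ I, G₂ B Ψ I⁆) : g ∈ G₂ B Ψ I :=
  Subgroup.commutator_le_right _ _ hg

lemma double_eq_zero {d : double I} (h₁ : p₁ I d = 0) (h₂ : p₂ I d = 0) : d = 0 :=
  Subtype.ext (Prod.ext h₁ h₂)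

namespace Amalgam

variable [Fintype ι] [DecidableEq ι]

/-- The conjugate already exists in the intersection of Ψ₁ and Ψ₂, which contains α and Ψ₀. -/
lemma leg_conjNormal_eq {n : ℕ} {Ψ₀ Ψ₁ Ψ₂ : Subsystem P} (h₁ : bipartite P n Ψ₁)
    (h₂ : bipartite P n Ψ₂) (h : Ψ₀ ≤ Ψ₁) (h' : Ψ₀ ≤ Ψ₂) {α : ι} (hα : α ∈ Ψ₁) (hα' : α ∈ Ψ₂)
    (d : double I) (g : G₁ B Ψ₀ I) :
    leg h₁ (MulAut.conjNormal (St.x B ⟨α, hα⟩ d) (G₁.map B I h g)) =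
      leg h₂ (MulAut.conjNormal (St.x B ⟨α, hα'⟩ d) (G₁.map B I h' g)) := by
  have h3 : Ψ₀ ≤ Subsystem.inter Ψ₁ Ψ₂ := fun i hi => ⟨h hi, h' hi⟩
  have key := leg_map_eq h₁ h₂ (Subsystem.inter_le_left Ψ₁ Ψ₂) (Subsystem.inter_le_right Ψ₁ Ψ₂)
    (MulAut.conjNormal (St.x B (⟨α, hα, hα'⟩ : Subsystem.inter Ψ₁ Ψ₂) d) (G₁.map B I h3 g))
  rw [G₁.map_conjNormal, G₁.map_conjNormal, G₁.map_map, G₁.map_map, St.map_x, St.map_x] at key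
  exact key

variable [P.IsRootSystem] [P.IsIrreducible] (hr : 3 ≤ Module.finrank ℝ M)

include hr

/-- If `α` lies in a radical of `Ψ`, then the conjugation by `x_α(r)` defines a homomorphism from
`G₁(Ψ)` to the amalgam: it is the leg of `Ψ`, corrected by a cocycle with values in the radical. -/
lemma exists_hom_of_notMem {Ψ : Subsystem P} (hΨ : bipartite P 3 Ψ) {α : ι} {U : Set ι}
    (hU : IsRadical Ψ U) (hα : α ∈ U) (r : R) :
    ∃ s : G₁ B Ψ I →* Amalgam B I 3,
      (∀ g : G₁ B Ψ I, (g : St B Ψ (double I)) ∈ ⁅G₁ B Ψ I, G₂ B Ψ I⁆ → s g = 1) ∧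
      ∀ β (hβ : β ∈ Ψ) (Ψ' : Subsystem P) (hΨ' : bipartite P 3 Ψ') (hα : α ∈ Ψ') (hβ' : β ∈ Ψ') g,
        s (G₁.map B I (pair_le hβ) g) = leg hΨ'
          (MulAut.conjNormal (St.x B ⟨α, hα⟩ (diag I r)) (G₁.map B I (pair_le hβ') g)) := by
  let u : ι → double I := Pi.single α (diag I r)
  -- The vector of the correction x (g x g⁻¹)⁻¹ with x = x_α(r).
  let v (g : St B Ψ (double I)) : ι → double I :=
    u - (radicalRep B hU _ g : Matrix ι ι (double I)).mulVec u
  have hu : ∀ i ∉ U, u i = 0 := fun i hi =>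
    Pi.single_eq_of_ne (by rintro rfl; exact hi hα) _
  have hv (g : G₁ B Ψ I) (i : ι) : p₁ I (v g i) = 0 := by
    simp only [v, Pi.sub_apply]
    rw [map_sub, radicalRep_congr hU _ g.2, sub_self]
  have hv' (g : St B Ψ (double I)) (i : ι) (hi : i ∉ U) : v g i = 0 := by
    simp only [v, Pi.sub_apply]
    rw [hu i hi, mulVec_support hU g hu i hi, sub_self]
  let s : G₁ B Ψ I →* Amalgam B I 3 :=
    { toFun := fun g => prodHom _ (yFamily_commFamily hr hU) (v g) * leg hΨ g
      map_one' := by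
        simp only [v]
        rw [Subgroup.coe_one, map_one, Units.val_one, Matrix.one_mulVec, sub_self, prodHom_zero,
          map_one, mul_one]
      map_mul' := fun g g' => by
        -- The cocycle identity; multiplicativity follows because the leg acts on products over U by
        -- the same representation.
        have h1 : v ((g * g' : G₁ B Ψ I) : St B Ψ (double I)) = v g +
            (radicalRep B hU _ (g : St B Ψ (double I)) : Matrix ι ι (double I)).mulVec (v g') := by
          simp only [v]
          rw [Subgroup.coe_mul, map_mul, Units.val_mul, Matrix.mulVec_sub, Matrix.mulVec_mulVec]
          abel
        rw [h1, prodHom_add, ← leg_conj_prodHom hr hΨ hU g (hv g') (hv' g'), map_mul]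
        group }
  refine ⟨s, fun g hg => ?_, fun β hβ Ψ' hΨ' hα' hβ' g => ?_⟩
  · change prodHom _ (yFamily_commFamily hr hU) (v g) * leg hΨ g = 1
    -- An element of [G₁, G₂] lies in G₁ and in G₂, so both projections of the correction vanish.
    have h0 : v g = 0 := funext fun i => double_eq_zero (hv g i) (by
      simp only [v, Pi.sub_apply]
      rw [map_sub, radicalRep_congr hU _ (mem_G₂_of_mem_commutator hg), sub_self])
    rw [h0, prodHom_zero, one_mul, leg_eq_one hΨ hg]
  · change prodHom _ (yFamily_commFamily hr hU) (v _) * leg hΨ _ = _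
    have hU' := hU.mono (pair_le hβ)
    have h1 := x_conj_eq (B := B) (pair_le hβ') hU' hα hα' (diag I r) g.1
    have h2 := (St.conj_prodHom (B := B) (pair_le hβ') hU' g.1 (v := u) (fun i hi =>
      Pi.single_eq_of_ne (by rintro rfl; exact hi ⟨hα, hα'⟩) _)).1
    have h3 : v (G₁.map B I (pair_le hβ) g) =
        u - (radicalRep B hU' _ g.1 : Matrix ι ι (double I)).mulVec u := by
      have := radicalRep_map (B := B) (pair_le hβ) hU (RingHom.id (double I)) g.1
      change u - (radicalRep B hU _ (St.map B (pair_le hβ) (RingHom.id _) g.1) :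
        Matrix ι ι (double I)).mulVec u = _
      rw [this]
      rfl
    -- For g from {±β}, the correction is supported in Ψ' and there equals the commutator of x_α(r)
    -- with g.
    have h4 := leg_eq_prodHom hr hΨ' hU' (v := v (G₁.map B I (pair_le hβ) g)) (hv _) (fun i hi => by
        rw [h3, Pi.sub_apply, h2 i hi, sub_zero]
        exact Pi.single_eq_of_ne (by rintro rfl; exact hi ⟨hα, hα'⟩) _)
      (MulAut.conjNormal (St.x B ⟨α, hα'⟩ (diag I r)) (G₁.map B I (pair_le hβ') g) *
        (G₁.map B I (pair_le hβ') g)⁻¹) (by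
        rw [Subgroup.coe_mul, MulAut.conjNormal_apply, h3]
        change St.x B ⟨α, hα'⟩ (diag I r) * St.map B (pair_le hβ') (RingHom.id _) g.1 *
          (St.x B ⟨α, hα'⟩ (diag I r))⁻¹ * (St.map B (pair_le hβ') (RingHom.id _) g.1)⁻¹ = _
        rw [h1, mul_inv_cancel_right])
    rw [← h4, leg_map_pair hΨ hβ, ← leg_map_pair hΨ' hβ', ← map_mul, inv_mul_cancel_right]

/-- If Ψ lies in an A₃ containing α, as every A₁ does, conjugation there serves; an A₃ without α has
α in a radical. The second property determines the homomorphism on rank-one parts and so makes these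
choices compatible. -/
lemma exists_hom {Ψ : Subsystem P} (hΨ : bipartite P 3 Ψ) (α : ι) (r : R) :
    ∃ s : G₁ B Ψ I →* Amalgam B I 3,
      (∀ g : G₁ B Ψ I, (g : St B Ψ (double I)) ∈ ⁅G₁ B Ψ I, G₂ B Ψ I⁆ → s g = 1) ∧
      ∀ β (hβ : β ∈ Ψ) (Ψ' : Subsystem P) (hΨ' : bipartite P 3 Ψ') (hα : α ∈ Ψ') (hβ' : β ∈ Ψ') g,
        s (G₁.map B I (pair_le hβ) g) = leg hΨ'
          (MulAut.conjNormal (St.x B ⟨α, hα⟩ (diag I r)) (G₁.map B I (pair_le hβ') g)) := by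
  have key (Ψ' : Subsystem P) (hΨ' : bipartite P 3 Ψ') (hα : α ∈ Ψ') (h : Ψ ≤ Ψ') :
      ∃ s : G₁ B Ψ I →* Amalgam B I 3,
        (∀ g : G₁ B Ψ I, (g : St B Ψ (double I)) ∈ ⁅G₁ B Ψ I, G₂ B Ψ I⁆ → s g = 1) ∧
        ∀ β (hβ : β ∈ Ψ) (Ψ' : Subsystem P) (hΨ' : bipartite P 3 Ψ') (hα : α ∈ Ψ') (hβ' : β ∈ Ψ')
          g, s (G₁.map B I (pair_le hβ) g) = leg hΨ'
            (MulAut.conjNormal (St.x B ⟨α, hα⟩ (diag I r)) (G₁.map B I (pair_le hβ') g)) := by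
    refine ⟨(leg hΨ').comp ((MulAut.conjNormal (St.x B ⟨α, hα⟩ (diag I r))).toMonoidHom.comp
      (G₁.map B I h)), fun g hg => ?_, fun β hβ Ψ₁ h₁ hα₁ hβ₁ g => ?_⟩
    · refine leg_eq_one hΨ' ?_
      change ((MulAut.conjNormal (St.x B ⟨α, hα⟩ (diag I r)) (G₁.map B I h g) : G₁ B Ψ' I) :
        St B Ψ' (double I)) ∈ _
      rw [MulAut.conjNormal_apply]
      exact (inferInstance : (⁅G₁ B Ψ' I, G₂ B Ψ' I⁆).Normal).conj_mem _
        (map_mem_commutator h hg) _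
    · change leg hΨ' (MulAut.conjNormal _ (G₁.map B I h (G₁.map B I (pair_le hβ) g))) = _
      rw [G₁.map_map]
      exact leg_conjNormal_eq hΨ' h₁ _ _ hα hα₁ _ g
  rcases hΨ with h | h
  · obtain ⟨b, -, hb, h3⟩ := h
    obtain ⟨Ψ', h4, h5, h6⟩ := exists_isAThree_pair (P := P) hr α (b 0)
    refine key Ψ' (Or.inr h4) h5 (h3 Ψ' fun i => ?_)
    rwa [Subsingleton.elim i 0]
  · by_cases hα : α ∈ Ψ
    · exact key Ψ (Or.inr h) hα le_rfl
    · obtain ⟨a, b, c, habc⟩ := isOfType_A_three_iff.mp h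
      exact exists_hom_of_notMem hr (Or.inr h) (habc.isRadical hα) (self_mem_radical _ _) r

/-- The conjugation by `x_α(r)` on the legs extends to the amalgam. -/
lemma exists_conj (α : ι) (r : R) : ∃ t : Amalgam B I 3 →* Amalgam B I 3,
    ∀ (Ψ : Subsystem P) (hΨ : bipartite P 3 Ψ) (hα : α ∈ Ψ) (g : G₁ B Ψ I),
      t (leg hΨ g) = leg hΨ (MulAut.conjNormal (St.x B ⟨α, hα⟩ (diag I r)) g) := by
  choose s hs hs' using fun Ψ (hΨ : bipartite P 3 Ψ) => exists_hom (B := B) (I := I) hr hΨ α r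
  obtain ⟨t, ht⟩ := exists_lift s hs fun Ψ₁ Ψ₂ h₁ h₂ h g => by
    have : (s Ψ₂ h₂).comp (G₁.map B I h) = s Ψ₁ h₁ := G₁_hom_ext fun β hβ g => by
      obtain ⟨Ψ', h4, h5, h6⟩ := exists_isAThree_pair (P := P) hr α β
      rw [MonoidHom.comp_apply, G₁.map_map, hs' Ψ₁ h₁ β hβ Ψ' (Or.inr h4) h5 h6,
        hs' Ψ₂ h₂ β (h hβ) Ψ' (Or.inr h4) h5 h6]
    exact DFunLike.congr_fun this g
  refine ⟨t, fun Ψ hΨ hα g => ?_⟩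
  rw [ht]
  have : s Ψ hΨ = (leg hΨ).comp
      (MulAut.conjNormal (St.x B ⟨α, hα⟩ (diag I r))).toMonoidHom := G₁_hom_ext fun β hβ g =>
    hs' Ψ hΨ β hβ Ψ hΨ hα hβ g
  exact DFunLike.congr_fun this g

end Amalgam

end Amalgam

/-! ### The action of St(Φ, R) on the amalgam. -/

section Amalgam

variable {ι : Type u} {M V L : Type*} [AddCommGroup M] [Module ℝ M] [AddCommGroup V]
    [Module ℝ V] [LieRing L] [LieAlgebra ℂ L] [FiniteDimensional ℂ L] [LieAlgebra.IsKilling ℂ L]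
    {P : RootPairing ι ℝ M V} [P.IsCrystallographic] [IsSimplyLaced P]
    {H : LieSubalgebra ℂ L} [H.IsCartanSubalgebra]
    {B : ChevalleyBasis P H} {R : Type v} [CommRing R] {I : Ideal R}

open scoped commutatorElement in
/-- The universal property of the Steinberg group. -/
def St.lift {A : Type v} [CommRing A] {Ψ : Subsystem P} {G : Type*} [Group G] (f : Ψ → A → G)
    (add : ∀ α r s, f α r * f α s = f α (r + s))
    (commute : ∀ (α β : Ψ) (r s : A), P.root α + P.root β ≠ 0 →
      (∀ γ : Ψ, P.root γ ≠ P.root α + P.root β) → f α r * f β s = f β s * f α r)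
    (commutator : ∀ α β γ : Ψ, ∀ r s, P.root γ = P.root α + P.root β →
      ⁅f α r, f β s⁆ = f γ ((B.N α β : A) * r * s))
    (weyl : ∀ α β : Ψ, ∀ (u : Aˣ) (ζ : A), P.root β = -P.root α →
      MulAut.conj (f α u * f β (-((u⁻¹ : Aˣ) : A)) * f α u) (f α ζ) =
        f β (-(((u⁻¹ : Aˣ) : A) ^ 2 * ζ)) ∧
      MulAut.conj (f α u * f β (-((u⁻¹ : Aˣ) : A)) * f α u) (f β ζ) = f α (-((u : A) ^ 2 * ζ))) :
    St B Ψ A →* G :=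
  PresentedGroup.toGroup (f := fun a => f a.1 a.2) (by
    intro w hw
    have hw' : Relator B Ψ A w := hw
    cases hw' with
    | add α r s =>
      rw [map_mul, map_mul, map_inv, FreeGroup.lift_apply_of, FreeGroup.lift_apply_of,
        FreeGroup.lift_apply_of, mul_inv_eq_one, add]
    | commute α β r s h₀ h =>
      rw [map_commutatorElement, FreeGroup.lift_apply_of, FreeGroup.lift_apply_of,
        commutatorElement_eq_one_iff_mul_comm, commute α β r s h₀ h]
    | commutator α β γ r s h =>
      rw [map_mul, map_commutatorElement, map_inv, FreeGroup.lift_apply_of,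
        FreeGroup.lift_apply_of, FreeGroup.lift_apply_of, mul_inv_eq_one, commutator α β γ r s h]
    | weyl_same α β u ζ h _ =>
      have h1 := (weyl α β u ζ h).1
      simp only [MulAut.conj_apply] at h1 ⊢
      simp only [map_mul, map_inv, FreeGroup.lift_apply_of, mul_inv_eq_one, h1]
    | weyl_neg α β u ζ h _ =>
      have h1 := (weyl α β u ζ h).2
      simp only [MulAut.conj_apply] at h1 ⊢
      simp only [map_mul, map_inv, FreeGroup.lift_apply_of, mul_inv_eq_one, h1])

lemma St.lift_x {A : Type v} [CommRing A] {Ψ : Subsystem P} {G : Type*} [Group G] (f : Ψ → A → G)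
    (add commute commutator weyl) (α : Ψ) (r : A) :
    St.lift (B := B) f add commute commutator weyl (St.x B α r) = f α r :=
  PresentedGroup.toGroup.of _

lemma conjNormal_of_orthogonal {Ψ₀ Ψ : Subsystem P} {α : ι} (h : Ψ₀ ≤ Ψ)
    (h' : Ψ₀ ≤ Subsystem.orthogonal P α) (hα : α ∈ Ψ) (d : double I) (g : G₁ B Ψ₀ I) :
    MulAut.conjNormal (St.x B ⟨α, hα⟩ d) (G₁.map B I h g) = G₁.map B I h g := by
  have key (g : St B Ψ₀ (double I)) :
      Commute (St.x B (⟨α, hα⟩ : Ψ) d) (St.map B h (RingHom.id _) g) := by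
    induction g using St.induction with
    | h1 => rw [map_one]; exact Commute.one_right _
    | hx β r g ih =>
      rw [map_mul, St.map_x]
      refine Commute.mul_right (Commute.symm (St.x_commute_of_nonneg _ _ ?_ _ _)) ih
      have : P.pairingIn ℤ β α = 0 := h' β.2
      exact this.ge
  refine Subtype.ext ?_
  rw [MulAut.conjNormal_apply]
  exact (key g.1).mul_inv_cancel

namespace Amalgam

/-- The automorphism `a` of the amalgam restricts to the conjugation by `x` on a leg. -/
def Realizes {n : ℕ} {Ψ : Subsystem P} (hΨ : bipartite P n Ψ) (a : MulAut (Amalgam B I n))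
    (x : St B Ψ R) : Prop :=
  ∀ g, a (leg hΨ g) = leg hΨ (MulAut.conjNormal (St.map B (le_refl Ψ) (diag I) x) g)

namespace Realizes

variable {n : ℕ} {Ψ : Subsystem P} {hΨ : bipartite P n Ψ} {a a' : MulAut (Amalgam B I n)}
  {x x' : St B Ψ R}

lemma one : Realizes hΨ (1 : MulAut (Amalgam B I n)) (1 : St B Ψ R) := fun g => by
  rw [map_one, map_one]; rfl

lemma mul (h : Realizes hΨ a x) (h' : Realizes hΨ a' x') : Realizes hΨ (a * a') (x * x') :=
  fun g => by rw [MulAut.mul_apply, h', h, map_mul, map_mul, MulAut.mul_apply]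

lemma inv (h : Realizes hΨ a x) : Realizes hΨ a⁻¹ x⁻¹ := fun g => by
  refine a.injective ?_
  rw [MulAut.apply_inv_self, h, map_inv, map_inv, MulAut.apply_inv_self]

open scoped commutatorElement in
lemma commutator (h : Realizes hΨ a x) (h' : Realizes hΨ a' x') : Realizes hΨ ⁅a, a'⁆ ⁅x, x'⁆ := by
  rw [commutatorElement_def, commutatorElement_def]
  exact ((h.mul h').mul h.inv).mul h'.inv

lemma conj (h : Realizes hΨ a x) (h' : Realizes hΨ a' x') :
    Realizes hΨ (MulAut.conj a a') (MulAut.conj x x') := by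
  rw [MulAut.conj_apply, MulAut.conj_apply]
  exact (h.mul h').mul h.inv

lemma apply_legOne (h : Realizes hΨ a x) (h' : Realizes hΨ a' x) {β : ι} (hβ : β ∈ Ψ)
    (g : G₁ B (pair P β) I) : a (legOne n β g) = a' (legOne n β g) := by
  rw [← leg_map_pair hΨ hβ, h, h']

end Realizes

variable [Fintype ι] [DecidableEq ι]

lemma mulAut_ext {n : ℕ} {a a' : MulAut (Amalgam B I n)}
    (h : ∀ β g, a (legOne n β g) = a' (legOne n β g)) : a = a' := by
  have : a.toMonoidHom = a'.toMonoidHom := hom_ext h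
  exact MulEquiv.ext fun g => DFunLike.congr_fun this g

variable [P.IsRootSystem] [P.IsIrreducible] (hr : 3 ≤ Module.finrank ℝ M)

/-- The endomorphism of the amalgam that extends the conjugation by `x_α(r)`. -/
noncomputable def conjEnd (α : ι) (r : R) : Amalgam B I 3 →* Amalgam B I 3 :=
  Classical.choose (exists_conj hr α r)

lemma conjEnd_leg (α : ι) (r : R) {Ψ : Subsystem P} (hΨ : bipartite P 3 Ψ) (hα : α ∈ Ψ)
    (g : G₁ B Ψ I) : conjEnd hr α r (leg hΨ g) =
      leg hΨ (MulAut.conjNormal (St.x B ⟨α, hα⟩ (diag I r)) g) :=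
  Classical.choose_spec (exists_conj hr α r) Ψ hΨ hα g

/-- Identities between endomorphisms are tested on legs of type A₁. Such a leg lies with α in an A₃,
where the endomorphisms are honest conjugations. -/
lemma conjEnd_comp (α : ι) (r s : R) :
    (conjEnd (B := B) (I := I) hr α r).comp (conjEnd hr α s) = conjEnd hr α (r + s) := by
  refine hom_ext fun β g => ?_
  obtain ⟨Ψ, h1, h2, h3⟩ := exists_isAThree_pair (P := P) hr α β
  have hΨ : bipartite P 3 Ψ := Or.inr h1
  rw [← leg_map_pair hΨ h3, MonoidHom.comp_apply, conjEnd_leg hr α s _ h2,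
    conjEnd_leg hr α r _ h2, conjEnd_leg hr α _ _ h2, map_add, ← St.x_add, map_mul,
    MulAut.mul_apply]

lemma conjEnd_zero (α : ι) : conjEnd (B := B) (I := I) hr α 0 = MonoidHom.id _ := by
  refine hom_ext fun β g => ?_
  obtain ⟨Ψ, h1, h2, h3⟩ := exists_isAThree_pair (P := P) hr α β
  have hΨ : bipartite P 3 Ψ := Or.inr h1
  rw [← leg_map_pair hΨ h3, conjEnd_leg hr α _ _ h2, map_zero, St.x_zero, map_one]
  rfl

/-- The automorphism of the amalgam that extends the conjugation by `x_α(r)`. -/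
noncomputable def conjAut (α : ι) (r : R) : MulAut (Amalgam B I 3) :=
  MonoidHom.toMulEquiv (conjEnd hr α r) (conjEnd hr α (-r))
    (by rw [conjEnd_comp, neg_add_cancel, conjEnd_zero])
    (by rw [conjEnd_comp, add_neg_cancel, conjEnd_zero])

lemma conjAut_leg (α : ι) (r : R) {Ψ : Subsystem P} (hΨ : bipartite P 3 Ψ) (hα : α ∈ Ψ)
    (g : G₁ B Ψ I) : conjAut hr α r (leg hΨ g) =
      leg hΨ (MulAut.conjNormal (St.x B ⟨α, hα⟩ (diag I r)) g) :=
  conjEnd_leg hr α r hΨ hα g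

lemma realizes_conjAut {Ψ : Subsystem P} (hΨ : bipartite P 3 Ψ) (α : Ψ) (r : R) :
    Realizes hΨ (conjAut (B := B) (I := I) hr α.1 r) (St.x B α r) := fun g => by
  rw [conjAut_leg hr α.1 r hΨ α.2, St.map_x]
  rfl

lemma conjAut_legOne_of_orthogonal {α β : ι} (h : P.pairingIn ℤ β α = 0) (r : R)
    (g : G₁ B (pair P β) I) : conjAut hr α r (legOne 3 β g) = legOne 3 β g := by
  obtain ⟨Ψ, h1, h2, h3⟩ := exists_isAThree_pair (P := P) hr α β
  have h4 : β ∈ Subsystem.orthogonal P α := h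
  have hΨ : bipartite P 3 Ψ := Or.inr h1
  rw [← leg_map_pair hΨ h3, conjAut_leg hr α r _ h2,
    conjNormal_of_orthogonal _ (pair_le h4)]

lemma conjAut_leg_of_orthogonal {Ψ₀ Ψ : Subsystem P} (hΨ : bipartite P 3 Ψ) (h : Ψ₀ ≤ Ψ) {α : ι}
    (h' : Ψ₀ ≤ Subsystem.orthogonal P α) (r : R) (g : G₁ B Ψ₀ I) :
    conjAut hr α r (leg hΨ (G₁.map B I h g)) = leg hΨ (G₁.map B I h g) := by
  have : ((conjAut hr α r).toMonoidHom.comp (leg hΨ)).comp (G₁.map B I h) =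
      (leg hΨ).comp (G₁.map B I h) := G₁_hom_ext fun β hβ g => by
    change conjAut hr α r (leg hΨ (G₁.map B I h (G₁.map B I (pair_le hβ) g))) =
      leg hΨ (G₁.map B I h (G₁.map B I (pair_le hβ) g))
    rw [G₁.map_map, leg_map_pair hΨ (h hβ)]
    exact conjAut_legOne_of_orthogonal hr (h' hβ) r g
  exact DFunLike.congr_fun this g

/-- Here α, β, γ need not lie in one A₃. Conjugation by x_β keeps the leg of γ inside the part of an
A₃ orthogonal to α, which x_α fixes pointwise. -/
lemma conjAut_comm_of_orthogonal {α β γ : ι} (hαβ : P.pairingIn ℤ β α = 0)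
    (hγ : P.pairingIn ℤ γ α = 0) (r s : R) (g : G₁ B (pair P γ) I) :
    conjAut hr α r (conjAut hr β s (legOne 3 γ g)) =
      conjAut hr β s (conjAut hr α r (legOne 3 γ g)) := by
  obtain ⟨Ψ, h1, h2, h3⟩ := exists_isAThree_pair (P := P) hr β γ
  have h4 : β ∈ Subsystem.inter Ψ (Subsystem.orthogonal P α) := ⟨h2, hαβ⟩
  have h5 : γ ∈ Subsystem.inter Ψ (Subsystem.orthogonal P α) := ⟨h3, hγ⟩
  have h6 := Subsystem.inter_le_left Ψ (Subsystem.orthogonal P α)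
  have hΨ : bipartite P 3 Ψ := Or.inr h1
  rw [conjAut_legOne_of_orthogonal hr hγ, ← leg_map_pair hΨ h3,
    conjAut_leg hr β s _ h2, ← G₁.map_map (pair_le h5) h6]
  have h7 := G₁.map_conjNormal h6 (St.x B ⟨β, h4⟩ (diag I s)) (G₁.map B I (pair_le h5) g)
  rw [St.map_x] at h7
  change G₁.map B I h6 _ = MulAut.conjNormal (St.x B ⟨β, h2⟩ (diag I s)) _ at h7
  rw [← h7]
  exact conjAut_leg_of_orthogonal hr _ h6 (Subsystem.inter_le_right _ _) r _

lemma conjAut_add (α : ι) (r s : R) : conjAut (B := B) (I := I) hr α r * conjAut hr α s =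
    conjAut hr α (r + s) :=
  MulEquiv.ext fun g => DFunLike.congr_fun (conjEnd_comp hr α r s) g

lemma conjAut_commute {α β : ι} (h₀ : P.root α + P.root β ≠ 0)
    (h : ∀ γ, P.root γ ≠ P.root α + P.root β) (r s : R) :
    conjAut (B := B) (I := I) hr α r * conjAut hr β s = conjAut hr β s * conjAut hr α r := by
  refine mulAut_ext fun δ g => ?_
  rcases exists_isAThree_triple (P := P) hr α β δ with ⟨Ψ, h1, h2, h3, h4⟩ | ⟨h1, h2⟩ |
    ⟨h1, h2 | h2⟩
  · have hΨ : bipartite P 3 Ψ := Or.inr h1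
    have k := St.x_commute (B := B) (⟨α, h2⟩ : Ψ) ⟨β, h3⟩ r s h₀ fun γ => h γ
    rw [commutatorElement_eq_one_iff_mul_comm] at k
    have k1 := (realizes_conjAut (B := B) (I := I) hr hΨ ⟨α, h2⟩ r).mul
      (realizes_conjAut hr hΨ ⟨β, h3⟩ s)
    rw [k] at k1
    exact k1.apply_legOne ((realizes_conjAut hr hΨ ⟨β, h3⟩ s).mul
      (realizes_conjAut hr hΨ ⟨α, h2⟩ r)) h4 g
  · rw [MulAut.mul_apply, MulAut.mul_apply, conjAut_legOne_of_orthogonal hr h2,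
      conjAut_legOne_of_orthogonal hr h1, conjAut_legOne_of_orthogonal hr h2]
  · rw [pairingIn_symm] at h1
    exact conjAut_comm_of_orthogonal hr h1 h2 r s g
  · exact (conjAut_comm_of_orthogonal hr h1 h2 s r g).symm

open scoped commutatorElement in
lemma conjAut_commutator {α β γ : ι} (hγ : P.root γ = P.root α + P.root β) (r s : R) :
    ⁅conjAut (B := B) (I := I) hr α r, conjAut (B := B) (I := I) hr β s⁆ =
      conjAut hr γ ((B.N α β : R) * r * s) := by
  refine mulAut_ext fun δ g => ?_
  rcases exists_isAThree_triple (P := P) hr α β δ with ⟨Ψ, h1, h2, h3, h4⟩ | ⟨h1, h2⟩ |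
    ⟨h1, _⟩
  · have hΨ : bipartite P 3 Ψ := Or.inr h1
    have h5 : γ ∈ Ψ := Ψ.add_mem h2 h3 hγ
    have k1 := (realizes_conjAut (B := B) (I := I) hr hΨ ⟨α, h2⟩ r).commutator
      (realizes_conjAut hr hΨ ⟨β, h3⟩ s)
    rw [St.x_commutator (⟨α, h2⟩ : Ψ) ⟨β, h3⟩ ⟨γ, h5⟩ r s hγ] at k1
    exact k1.apply_legOne (realizes_conjAut hr hΨ ⟨γ, h5⟩ _) h4 g
  -- If δ is orthogonal to α and β it is orthogonal to α + β, and all the automorphisms fix its leg.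
  · have h3 : P.pairingIn ℤ δ γ = 0 := by rw [pairingIn_add_right hγ, h1, h2, add_zero]
    have h4 (a b : MulAut (Amalgam B I 3)) (y : Amalgam B I 3) (ha : a y = y) (hb : b y = y) :
        ⁅a, b⁆ y = y := by
      have ha' : a⁻¹ y = y := by rw [MulAut.inv_apply, MulEquiv.symm_apply_eq, ha]
      have hb' : b⁻¹ y = y := by rw [MulAut.inv_apply, MulEquiv.symm_apply_eq, hb]
      rw [commutatorElement_def, MulAut.mul_apply, MulAut.mul_apply, MulAut.mul_apply, hb', ha',
        hb, ha]
    rw [conjAut_legOne_of_orthogonal hr h3]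
    exact h4 _ _ _ (conjAut_legOne_of_orthogonal hr h1 _ _)
      (conjAut_legOne_of_orthogonal hr h2 _ _)
  -- This case is void: ⟨α, β⟩ = -1 when α + β is a root.
  · rw [pairingIn_symm, pairingIn_of_add hγ] at h1
    norm_num at h1

lemma conjAut_weyl_same {α β : ι} (hβ : P.root β = -P.root α) (u : Rˣ) (ζ : R) :
    MulAut.conj (conjAut (B := B) (I := I) hr α (u : R) * conjAut hr β (-((u⁻¹ : Rˣ) : R)) *
      conjAut hr α (u : R)) (conjAut hr α ζ) = conjAut hr β (-(((u⁻¹ : Rˣ) : R) ^ 2 * ζ)) := by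
  refine mulAut_ext fun δ g => ?_
  obtain ⟨Ψ, h1, h2, h4⟩ := exists_isAThree_pair (P := P) hr α δ
  have hΨ : bipartite P 3 Ψ := Or.inr h1
  have h3 : β ∈ Ψ := by rw [eq_neg_index hβ]; exact Ψ.neg_mem h2
  have k (r : R) := realizes_conjAut (B := B) (I := I) hr hΨ ⟨α, h2⟩ r
  have k' (r : R) := realizes_conjAut (B := B) (I := I) hr hΨ ⟨β, h3⟩ r
  have k1 := (((k u).mul (k' (-((u⁻¹ : Rˣ) : R)))).mul (k u)).conj (k ζ)
  rw [(St.x_weyl (B := B) (⟨α, h2⟩ : Ψ) ⟨β, h3⟩ u ζ hβ).1] at k1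
  exact k1.apply_legOne (k' (-(((u⁻¹ : Rˣ) : R) ^ 2 * ζ))) h4 g

lemma conjAut_weyl_neg {α β : ι} (hβ : P.root β = -P.root α) (u : Rˣ) (ζ : R) :
    MulAut.conj (conjAut (B := B) (I := I) hr α (u : R) * conjAut hr β (-((u⁻¹ : Rˣ) : R)) *
      conjAut hr α (u : R)) (conjAut hr β ζ) = conjAut hr α (-((u : R) ^ 2 * ζ)) := by
  refine mulAut_ext fun δ g => ?_
  obtain ⟨Ψ, h1, h2, h4⟩ := exists_isAThree_pair (P := P) hr α δ
  have hΨ : bipartite P 3 Ψ := Or.inr h1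
  have h3 : β ∈ Ψ := by rw [eq_neg_index hβ]; exact Ψ.neg_mem h2
  have k (r : R) := realizes_conjAut (B := B) (I := I) hr hΨ ⟨α, h2⟩ r
  have k' (r : R) := realizes_conjAut (B := B) (I := I) hr hΨ ⟨β, h3⟩ r
  have k1 := (((k u).mul (k' (-((u⁻¹ : Rˣ) : R)))).mul (k u)).conj (k' ζ)
  rw [(St.x_weyl (B := B) (⟨α, h2⟩ : Ψ) ⟨β, h3⟩ u ζ hβ).2] at k1
  exact k1.apply_legOne (k (-((u : R) ^ 2 * ζ))) h4 g

variable (B I) in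
/-- The action of the Steinberg group on the amalgam. -/
noncomputable def action : St B (⊤ : Subsystem P) R →* MulAut (Amalgam B I 3) :=
  St.lift (fun α r => conjAut hr α.1 r) (fun α r s => conjAut_add hr α.1 r s)
    (fun _ _ r s h₀ h => conjAut_commute hr h₀ (fun γ => h ⟨γ, trivial⟩) r s)
    (fun _ _ _ r s h => conjAut_commutator hr h r s)
    (fun _ _ u ζ h => ⟨conjAut_weyl_same hr h u ζ, conjAut_weyl_neg hr h u ζ⟩)

lemma action_x (α : (⊤ : Subsystem P)) (r : R) :
    action B I hr (St.x B α r) = conjAut hr α.1 r :=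
  St.lift_x _ _ _ _ _ α r

lemma realizes_action {Ψ : Subsystem P} (hΨ : bipartite P 3 Ψ) (x : St B Ψ R) :
    Realizes hΨ (action B I hr (St.map B le_top (RingHom.id R) x)) x := by
  induction x using St.induction with
  | h1 => rw [map_one, map_one]; exact Realizes.one
  | hx α r g ih =>
    rw [map_mul, map_mul, St.map_x, action_x]
    exact (realizes_conjAut hr hΨ α r).mul ih

end Amalgam

end Amalgam

/-! ### Conjugation in semidirect products. -/

section SemidirectProduct

variable {N G : Type*} [Group N] [Group G] (φ : G →* MulAut N)

/-- The action of a semidirect product on its normal factor by conjugation. -/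
def conjLeft : N ⋊[φ] G →* MulAut N :=
  SemidirectProduct.lift MulAut.conj φ fun g => MonoidHom.ext fun n => by
    refine MulEquiv.ext fun m => ?_
    simp [MulAut.conj_apply]

lemma conjLeft_mk (n : N) (g : G) : conjLeft φ ⟨n, g⟩ = MulAut.conj n * φ g := rfl

open scoped commutatorElement in
-- The element w lies in N, on which z acts trivially by conjugation.
lemma commutator_eq_one_of_conjLeft {z w : N ⋊[φ] G} (hz : conjLeft φ z = 1) (hw : w.right = 1) :
    ⁅z, w⁆ = 1 := by
  have h (n : N) : z * SemidirectProduct.inl n * z⁻¹ = SemidirectProduct.inl (conjLeft φ z n) := by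
    obtain ⟨m, g⟩ := z
    rw [conjLeft_mk, SemidirectProduct.mk_eq_inl_mul_inr, MulAut.mul_apply, MulAut.conj_apply,
      map_mul, map_mul, map_inv, SemidirectProduct.inl_aut, map_inv]
    simp only [mul_inv_rev, mul_assoc]
  have hw' : w = SemidirectProduct.inl w.left := SemidirectProduct.ext rfl hw
  rw [commutatorElement_def, hw', h, hz, MulAut.one_apply, mul_inv_cancel]

end SemidirectProduct

/-! ### The homomorphism from St(Φ, R, I) to the amalgam. -/

section Amalgam

variable {ι : Type u} {M V L : Type*} [AddCommGroup M] [Module ℝ M] [AddCommGroup V]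
    [Module ℝ V] [LieRing L] [LieAlgebra ℂ L] [FiniteDimensional ℂ L] [LieAlgebra.IsKilling ℂ L]
    {P : RootPairing ι ℝ M V} [P.IsCrystallographic] [IsSimplyLaced P]
    {H : LieSubalgebra ℂ L} [H.IsCartanSubalgebra]
    {B : ChevalleyBasis P H} {R : Type v} [CommRing R] {I : Ideal R}

/-- Homomorphisms from the Steinberg groups of subsystems that contain any two given roots define a
homomorphism from the Steinberg group of the root system. -/
lemma St.exists_hom_of_local {A : Type v} [CommRing A] {G : Type*} [Group G] (f : ι → A → G)
    (hf : ∀ α β, ∃ Ψ : Subsystem P, α ∈ Ψ ∧ β ∈ Ψ ∧ ∃ k : St B Ψ A →* G,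
      ∀ γ (hγ : γ ∈ Ψ) r, k (St.x B ⟨γ, hγ⟩ r) = f γ r) :
    ∃ K : St B (⊤ : Subsystem P) A →* G, ∀ α r, K (St.x B α r) = f α.1 r := by
  -- Each relation involves at most two roots and their sum or negatives, hence holds in a subsystem
  -- containing those two.
  refine ⟨St.lift (fun α r => f α.1 r) (fun α r s => ?_) (fun α β r s h₀ h => ?_)
    (fun α β γ r s h => ?_) (fun α β w ζ h => ?_), fun α r => St.lift_x _ _ _ _ _ α r⟩
  · obtain ⟨Ψ, h1, -, k, hk⟩ := hf α α
    rw [← hk _ h1, ← hk _ h1, ← hk _ h1, ← map_mul, St.x_add]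
  · obtain ⟨Ψ, h1, h2, k, hk⟩ := hf α β
    rw [← hk _ h1, ← hk _ h2, ← map_mul, ← map_mul, commutatorElement_eq_one_iff_mul_comm.mp
      (St.x_commute (B := B) ⟨α.1, h1⟩ ⟨β.1, h2⟩ r s h₀ fun γ => h ⟨γ, trivial⟩)]
  · obtain ⟨Ψ, h1, h2, k, hk⟩ := hf α β
    have h3 : γ.1 ∈ Ψ := Ψ.add_mem h1 h2 h
    rw [← hk _ h1, ← hk _ h2, ← hk _ h3, ← map_commutatorElement,
      St.x_commutator ⟨α.1, h1⟩ ⟨β.1, h2⟩ ⟨γ.1, h3⟩ r s h]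
  · obtain ⟨Ψ, h1, -, k, hk⟩ := hf α α
    have h2 : β.1 ∈ Ψ := by rw [eq_neg_index h]; exact Ψ.neg_mem h1
    have key := St.x_weyl (B := B) ⟨α.1, h1⟩ ⟨β.1, h2⟩ w ζ h
    have key₁ := congrArg k key.1
    have key₂ := congrArg k key.2
    rw [MulAut.conj_apply, map_mul, map_mul, map_inv, map_mul, map_mul, hk, hk, hk, hk] at key₁ key₂
    exact ⟨key₁, key₂⟩

lemma map_p₁_diag {Ψ : Subsystem P} (g : St B Ψ R) :
    St.map B (le_refl Ψ) (p₁ I) (St.map B (le_refl Ψ) (diag I) g) = g := by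
  rw [St.map_map]
  exact St.map_id (B := B) g

/-- The element `g Δ(p₁(g))⁻¹` of `G₁(Ψ)`. -/
def relPart {Ψ : Subsystem P} (g : St B Ψ (double I)) : G₁ B Ψ I :=
  ⟨g * (St.map B (le_refl Ψ) (diag I) (St.map B (le_refl Ψ) (p₁ I) g))⁻¹, by
    rw [mem_G₁, map_mul, map_inv, map_p₁_diag, mul_inv_cancel]⟩

/-- This crossed multiplicativity is the multiplication of a semidirect product in its first
component. -/
lemma relPart_mul {Ψ : Subsystem P} (g g' : St B Ψ (double I)) : relPart (g * g') = relPart g *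
    MulAut.conjNormal (St.map B (le_refl Ψ) (diag I) (St.map B (le_refl Ψ) (p₁ I) g))
      (relPart g') := by
  refine Subtype.ext ?_
  rw [Subgroup.coe_mul, MulAut.conjNormal_apply]
  simp only [relPart, map_mul, mul_inv_rev, mul_assoc, inv_mul_cancel_left]

lemma relPart_coe {Ψ : Subsystem P} (g : G₁ B Ψ I) :
    relPart (g : St B Ψ (double I)) = g := by
  refine Subtype.ext ?_
  simp only [relPart]
  rw [mem_G₁.mp g.2, map_one, inv_one, mul_one]

lemma relPart_x {Ψ : Subsystem P} (α : Ψ) (d : double I) :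
    relPart (St.x B α d) = relX B α (Multiplicative.ofAdd d) := by
  refine Subtype.ext ?_
  rw [relX_coe]
  simp only [relPart]
  rw [St.map_x, St.map_x, sub_eq_add_neg, ← St.x_add, St.x_neg]
  rfl

lemma relPart_one {Ψ : Subsystem P} : relPart (1 : St B Ψ (double I)) = 1 :=
  relPart_coe (1 : G₁ B Ψ I)

namespace Amalgam

/-- `G₂(Ψ)` acts trivially on the leg of `Ψ`. -/
lemma leg_conjNormal_of_mem_G₂ {n : ℕ} {Ψ : Subsystem P} (hΨ : bipartite P n Ψ)
    {a : St B Ψ (double I)} (ha : a ∈ G₂ B Ψ I) (g : G₁ B Ψ I) :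
    leg hΨ (MulAut.conjNormal a g) = leg hΨ g := by
  rw [← mul_inv_eq_one, ← map_inv, ← map_mul]
  refine leg_eq_one hΨ ?_
  rw [Subgroup.coe_mul, MulAut.conjNormal_apply, Subgroup.commutator_comm]
  exact Subgroup.commutator_mem_commutator ha g.2

variable [Fintype ι] [DecidableEq ι] [P.IsRootSystem] [P.IsIrreducible]
  (hr : 3 ≤ Module.finrank ℝ M)

/-- The homomorphism `g ↦ (g Δ(p₁(g))⁻¹, p₁(g))`. -/
noncomputable def legSemidirect {Ψ : Subsystem P} (hΨ : bipartite P 3 Ψ) :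
    St B Ψ (double I) →* Amalgam B I 3 ⋊[action B I hr] St B (⊤ : Subsystem P) R where
  toFun g := ⟨leg hΨ (relPart g), St.map B le_top (p₁ I) g⟩
  map_one' := by
    rw [relPart_one, map_one, map_one]; rfl
  map_mul' g g' := by
    refine SemidirectProduct.ext ?_ (map_mul _ _ _)
    rw [SemidirectProduct.mul_left]
    change leg hΨ (relPart (g * g')) = leg hΨ (relPart g) *
      action B I hr (St.map B le_top (p₁ I) g) (leg hΨ (relPart g'))
    have h := realizes_action (I := I) hr hΨ (St.map B (le_refl Ψ) (p₁ I) g) (relPart g')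
    rw [St.map_map] at h
    rw [relPart_mul, map_mul, ← h]
    rfl

/-- The element `(x_α(d - p₁(d)), x_α(p₁(d)))`. -/
noncomputable def xSemidirect (α : ι) (d : double I) :
    Amalgam B I 3 ⋊[action B I hr] St B (⊤ : Subsystem P) R :=
  ⟨y B I 3 α (Multiplicative.ofAdd d), St.x B ⟨α, trivial⟩ (p₁ I d)⟩

lemma legSemidirect_x {Ψ : Subsystem P} (hΨ : bipartite P 3 Ψ) {α : ι} (hα : α ∈ Ψ)
    (d : double I) : legSemidirect hr hΨ (St.x B ⟨α, hα⟩ d) = xSemidirect hr α d := by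
  refine SemidirectProduct.ext ?_ (St.map_x (B := B) _ _ _ _)
  change leg hΨ (relPart _) = _
  rw [relPart_x, leg_relX]
  rfl

variable (B I) in
lemma exists_toSemidirect : ∃ K : St B (⊤ : Subsystem P) (double I) →*
    Amalgam B I 3 ⋊[action B I hr] St B (⊤ : Subsystem P) R,
      ∀ α d, K (St.x B α d) = xSemidirect hr α.1 d :=
  St.exists_hom_of_local _ fun α β => by
    obtain ⟨Ψ, h1, h2, h3⟩ := exists_isAThree_pair (P := P) hr α β
    exact ⟨Ψ, h2, h3, legSemidirect hr (Or.inr h1), fun γ hγ d => legSemidirect_x hr _ hγ d⟩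

variable (B I) in
/-- The homomorphism `x_α(d) ↦ (x_α(d - p₁(d)), x_α(p₁(d)))`. -/
noncomputable def toSemidirect : St B (⊤ : Subsystem P) (double I) →*
    Amalgam B I 3 ⋊[action B I hr] St B (⊤ : Subsystem P) R :=
  Classical.choose (exists_toSemidirect B I hr)

lemma toSemidirect_x (α : (⊤ : Subsystem P)) (d : double I) :
    toSemidirect B I hr (St.x B α d) = xSemidirect hr α.1 d :=
  Classical.choose_spec (exists_toSemidirect B I hr) α d

lemma toSemidirect_map {Ψ : Subsystem P} (hΨ : bipartite P 3 Ψ) (g : St B Ψ (double I)) :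
    toSemidirect B I hr (St.map B le_top (RingHom.id _) g) = legSemidirect hr hΨ g := by
  have : (toSemidirect B I hr).comp (St.map B le_top (RingHom.id _)) = legSemidirect hr hΨ :=
    St.hom_ext fun α d => by
      rw [MonoidHom.comp_apply, St.map_x, toSemidirect_x, legSemidirect_x hr hΨ α.2]
      rfl
  exact DFunLike.congr_fun this g

lemma toSemidirect_right (g : St B (⊤ : Subsystem P) (double I)) :
    (toSemidirect B I hr g).right = St.map B (le_refl _) (p₁ I) g := by
  have : SemidirectProduct.rightHom.comp (toSemidirect B I hr) =
      St.map B (le_refl _) (p₁ I) := St.hom_ext fun α d => by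
    rw [MonoidHom.comp_apply, toSemidirect_x, St.map_x]
    rfl
  exact DFunLike.congr_fun this g

/-- On the leg of an A₃ containing α, the left side is conjugation by x_α(d). Now x_α(d) and
x_α(Δp₂(d)) differ by an element of G₂, which acts trivially on the leg because [G₁, G₂] is killed.
-/
lemma conj_y_mul_conjAut (α : ι) (d : double I) :
    MulAut.conj (y B I 3 α (Multiplicative.ofAdd d)) * conjAut hr α (p₁ I d) =
      conjAut hr α (p₂ I d) := by
  refine mulAut_ext fun δ g => ?_
  obtain ⟨Ψ, h1, h2, h3⟩ := exists_isAThree_pair (P := P) hr α δ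
  have hΨ : bipartite P 3 Ψ := Or.inr h1
  rw [← leg_map_pair hΨ h3, MulAut.mul_apply, conjAut_leg hr _ _ hΨ h2, conjAut_leg hr _ _ hΨ h2,
    MulAut.conj_apply, ← leg_relX hΨ ⟨α, h2⟩, ← map_inv, ← map_mul, ← map_mul]
  have ha : St.x B (⟨α, h2⟩ : Ψ) (d - diag I (p₂ I d)) ∈ G₂ B Ψ I :=
    x_mem_G₂ _ (by rw [map_sub, p₂_diag, sub_self])
  rw [← leg_conjNormal_of_mem_G₂ hΨ ha (MulAut.conjNormal (St.x B ⟨α, h2⟩ (diag I (p₂ I d))) _),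
    ← MulAut.mul_apply, ← map_mul, St.x_add, sub_add_cancel]
  congr 1
  refine Subtype.ext ?_
  have h4 : St.x B (⟨α, h2⟩ : Ψ) d =
      St.x B (⟨α, h2⟩ : Ψ) (d - diag I (p₁ I d)) * St.x B ⟨α, h2⟩ (diag I (p₁ I d)) := by
    rw [St.x_add, sub_add_cancel]
  rw [Subgroup.coe_mul, Subgroup.coe_mul, Subgroup.coe_inv, relX_coe, MulAut.conjNormal_apply,
    MulAut.conjNormal_apply, h4]
  simp only [mul_inv_rev, mul_assoc]

/-- The action on the amalgam through the semidirect product factors through `p₂`. -/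
lemma conjLeft_toSemidirect (g : St B (⊤ : Subsystem P) (double I)) :
    conjLeft _ (toSemidirect B I hr g) = action B I hr (St.map B (le_refl _) (p₂ I) g) := by
  have : (conjLeft (action B I hr)).comp (toSemidirect B I hr) =
      (action B I hr).comp (St.map B (le_refl _) (p₂ I)) := St.hom_ext fun α d => by
    rw [MonoidHom.comp_apply, MonoidHom.comp_apply, toSemidirect_x, St.map_x, action_x,
      xSemidirect, conjLeft_mk, action_x]
    exact conj_y_mul_conjAut hr α.1 d
  exact DFunLike.congr_fun this g

/-- The image of G₁ lies in the amalgam, and the image of G₂ acts trivially on it. -/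
lemma toSemidirect_eq_one {g : St B (⊤ : Subsystem P) (double I)}
    (hg : g ∈ ⁅G₁ B (⊤ : Subsystem P) I, G₂ B (⊤ : Subsystem P) I⁆) :
    toSemidirect B I hr g = 1 := by
  have : ⁅G₂ B (⊤ : Subsystem P) I, G₁ B (⊤ : Subsystem P) I⁆ ≤ (toSemidirect B I hr).ker := by
    rw [Subgroup.commutator_le]
    intro b hb a ha
    rw [MonoidHom.mem_ker, map_commutatorElement]
    refine commutator_eq_one_of_conjLeft _ ?_ ?_
    · rw [conjLeft_toSemidirect, mem_G₂.mp hb, map_one]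
    · rw [toSemidirect_right, mem_G₁.mp ha]
  rw [Subgroup.commutator_comm] at hg
  exact this hg

/-- The homomorphism from `G₁(Φ)` to the amalgam. -/
noncomputable def ofG₁ : G₁ B (⊤ : Subsystem P) I →* Amalgam B I 3 where
  toFun g := (toSemidirect B I hr g).left
  map_one' := by rw [Subgroup.coe_one, map_one, SemidirectProduct.one_left]
  map_mul' g g' := by
    rw [Subgroup.coe_mul, map_mul, SemidirectProduct.mul_left, toSemidirect_right,
      mem_G₁.mp g.2, map_one, MulAut.one_apply]

variable (B I) in
/-- The homomorphism from the relative Steinberg group of `Φ` to the amalgam. -/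
noncomputable def ofRelSt : RelSt B (⊤ : Subsystem P) I →* Amalgam B I 3 :=
  QuotientGroup.lift _ (ofG₁ hr) fun g hg => by
    change (toSemidirect B I hr g).left = 1
    have h : toSemidirect B I hr (g : St B (⊤ : Subsystem P) (double I)) = 1 :=
      toSemidirect_eq_one hr hg
    rw [h, SemidirectProduct.one_left]

lemma ofRelSt_map {Ψ : Subsystem P} (hΨ : bipartite P 3 Ψ) (g : G₁ B Ψ I) :
    ofRelSt B I hr (RelSt.map B I le_top (QuotientGroup.mk g)) = leg hΨ g := by
  change (toSemidirect B I hr (St.map B le_top (RingHom.id _) (g : St B Ψ (double I)))).left = _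
  rw [toSemidirect_map hr hΨ]
  change leg hΨ (relPart _) = _
  rw [relPart_coe]

end Amalgam

end Amalgam

/-! ### The colimit property. -/

section Colimit

variable {ι : Type u} {M V L : Type*} [AddCommGroup M] [Module ℝ M] [AddCommGroup V]
    [Module ℝ V] [LieRing L] [LieAlgebra ℂ L] [FiniteDimensional ℂ L] [LieAlgebra.IsKilling ℂ L]
    {P : RootPairing ι ℝ M V} [P.IsCrystallographic] [IsSimplyLaced P]
    {H : LieSubalgebra ℂ L} [H.IsCartanSubalgebra]
    (B : ChevalleyBasis P H) {R : Type v} [CommRing R] (I : Ideal R)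

/-- Every compatible family of homomorphisms from the relative Steinberg groups of the subsystems of
type `A₁` and `A_n` extends to the relative Steinberg group of the root system. -/
def HasExtensions (n : ℕ) : Prop :=
  ∀ (G : Type (max u v)) [Group G] (s : ∀ Ψ : Subsystem P, bipartite P n Ψ → RelSt B Ψ I →* G),
    (∀ Ψ₁ Ψ₂ h₁ h₂ (h : Ψ₁ ≤ Ψ₂) g, s Ψ₂ h₂ (RelSt.map B I h g) = s Ψ₁ h₁ g) →
    ∃ f : RelSt B ⊤ I →* G, ∀ Ψ hΨ g, f (RelSt.map B I le_top g) = s Ψ hΨ g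

variable {B I} [Fintype ι] [DecidableEq ι]

open CategoryTheory Limits

/-- Only existence comes from the extension property. Uniqueness holds because the A₁'s belong to
the diagram and generate St(Φ, R, I). -/
lemma HasExtensions.nonempty_isColimit {n : ℕ} (h : HasExtensions B I n) :
    Nonempty (IsColimit (relStCocone B I n)) := by
  have key (c : Cocone (relStDiagram B I n)) : ∃ f : RelSt B ⊤ I →* c.pt,
      ∀ Ψ (hΨ : bipartite P n Ψ) (g : RelSt B Ψ I),
        f (RelSt.map B I le_top g) = (c.ι.app ⟨Ψ, hΨ⟩).hom g :=
    h c.pt (fun Ψ hΨ => (c.ι.app ⟨Ψ, hΨ⟩).hom) fun Ψ₁ Ψ₂ h₁ h₂ h g =>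
      ConcreteCategory.congr_hom (c.w (ObjectProperty.homMk (homOfLE h) :
        (⟨Ψ₁, h₁⟩ : (bipartite P n).FullSubcategory) ⟶ ⟨Ψ₂, h₂⟩)) g
  choose f hf using key
  refine ⟨{ desc := fun c => GrpCat.ofHom (f c), fac := fun c Ψ => ?_, uniq := fun c m hm => ?_ }⟩
  · exact GrpCat.hom_ext (MonoidHom.ext fun g => hf c Ψ.1 Ψ.2 g)
  · refine GrpCat.hom_ext (RelSt.hom_ext fun β hβ g => ?_)
    exact (ConcreteCategory.congr_hom (hm ⟨pair P β, Or.inl (pair_isOfType β)⟩) g).trans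
      (hf c _ _ g).symm

variable [P.IsRootSystem] [P.IsIrreducible]

lemma hasExtensions_three (hr : 3 ≤ Module.finrank ℝ M) : HasExtensions B I 3 := by
  intro G _ s hs
  obtain ⟨e, he⟩ := Amalgam.exists_lift (fun Ψ hΨ => (s Ψ hΨ).comp (QuotientGroup.mk' _))
    (fun Ψ hΨ g hg => by
      have h : (QuotientGroup.mk g : RelSt B Ψ I) = 1 := (QuotientGroup.eq_one_iff g).mpr hg
      change s Ψ hΨ (QuotientGroup.mk g) = 1
      rw [h, map_one])
    fun Ψ₁ Ψ₂ h₁ h₂ h g => hs Ψ₁ Ψ₂ h₁ h₂ h (QuotientGroup.mk g)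
  refine ⟨e.comp (Amalgam.ofRelSt B I hr), fun Ψ hΨ g => ?_⟩
  obtain ⟨g, rfl⟩ := QuotientGroup.mk_surjective g
  rw [MonoidHom.comp_apply, Amalgam.ofRelSt_map hr hΨ, he]
  rfl

/-- A homomorphism on an A₃ is obtained by restriction from an A₄ containing it. Its values on the
A₁'s do not depend on the choice of the A₄, so the family is compatible and the case of A₃ applies.
-/
lemma hasExtensions_four (hΦ : (⊤ : Subsystem P).IsOfType CartanMatrix.E₆ ∨
    (⊤ : Subsystem P).IsOfType CartanMatrix.E₇ ∨ (⊤ : Subsystem P).IsOfType CartanMatrix.E₈) :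
    HasExtensions B I 4 := by
  intro G _ s hs
  have hmap {Ψ₁ Ψ₂ Ψ₃ : Subsystem P} (h : Ψ₁ ≤ Ψ₂) (h' : Ψ₂ ≤ Ψ₃) (g : RelSt B Ψ₁ I) :
      RelSt.map B I h' (RelSt.map B I h g) = RelSt.map B I (h.trans h') g := by
    rw [RelSt.map_comp B I h h']; rfl
  have key (Ψ : Subsystem P) (hΨ : bipartite P 3 Ψ) : ∃ t : RelSt B Ψ I →* G, ∀ β (hβ : β ∈ Ψ) g,
      t (RelSt.map B I (pair_le hβ) g) = s (pair P β) (Or.inl (pair_isOfType β)) g := by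
    obtain ⟨Ψ', hΨ', h⟩ : ∃ Ψ', bipartite P 4 Ψ' ∧ Ψ ≤ Ψ' := by
      rcases hΨ with h | h
      · exact ⟨Ψ, Or.inl h, le_rfl⟩
      · obtain ⟨Ψ', h1, h2⟩ := exists_isOfType_A_four hΦ h
        exact ⟨Ψ', Or.inr h1, h2⟩
    refine ⟨(s Ψ' hΨ').comp (RelSt.map B I h), fun β hβ g => ?_⟩
    rw [MonoidHom.comp_apply, hmap]
    exact hs _ _ _ _ _ g
  choose t ht using key
  obtain ⟨f, hf⟩ := hasExtensions_three (three_le_finrank hΦ) G t fun Ψ₁ Ψ₂ h₁ h₂ h g => by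
    have : (t Ψ₂ h₂).comp (RelSt.map B I h) = t Ψ₁ h₁ := RelSt.hom_ext fun β hβ g => by
      rw [MonoidHom.comp_apply, hmap, ht Ψ₁ h₁ β hβ, ht Ψ₂ h₂ β (h hβ)]
    exact DFunLike.congr_fun this g
  refine ⟨f, fun Ψ hΨ g => ?_⟩
  have : f.comp (RelSt.map B I le_top) = s Ψ hΨ := RelSt.hom_ext fun β hβ g => by
    rw [MonoidHom.comp_apply, hmap, hf _ (Or.inl (pair_isOfType β)),
      hs _ _ (Or.inl (pair_isOfType β)) hΨ, ← ht _ (Or.inl (pair_isOfType β)) β (mem_pair β)]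
    exact congrArg _ (DFunLike.congr_fun (RelSt.map_id B I (pair P β)) g).symm
  exact DFunLike.congr_fun this g

end Colimit

end Steinberg

theorem mainTheorem3 {ι M V L : Type*} [Finite ι]
    [AddCommGroup M] [Module ℝ M] [AddCommGroup V] [Module ℝ V]
    -- `Φ` is a simply laced irreducible root system
    (P : RootPairing ι ℝ M V) [P.IsRootSystem] [P.IsCrystallographic] [P.IsReduced]
    [P.IsIrreducible] [Steinberg.IsSimplyLaced P]
    -- a Chevalley basis of the simple complex Lie algebra of type `Φ`
    [LieRing L] [LieAlgebra ℂ L] [FiniteDimensional ℂ L] [LieAlgebra.IsKilling ℂ L]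
    (H : LieSubalgebra ℂ L) [H.IsCartanSubalgebra] (B : Steinberg.ChevalleyBasis P H)
    {R : Type*} [CommRing R] (I : Ideal R) :
    (3 ≤ Module.finrank ℝ M →
      Nonempty (CategoryTheory.Limits.IsColimit (Steinberg.relStCocone B I 3))) ∧
    ((⊤ : Steinberg.Subsystem P).IsOfType CartanMatrix.E₆ ∨
        (⊤ : Steinberg.Subsystem P).IsOfType CartanMatrix.E₇ ∨
        (⊤ : Steinberg.Subsystem P).IsOfType CartanMatrix.E₈ →
      Nonempty (CategoryTheory.Limits.IsColimit (Steinberg.relStCocone B I 4))) := by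
  classical
  have := Fintype.ofFinite ι
  exact ⟨fun hr => (Steinberg.hasExtensions_three hr).nonempty_isColimit,
    fun hΦ => (Steinberg.hasExtensions_four hΦ).nonempty_isColimit⟩
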